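/- There is a universal constant $c_1\in(0,6]$ such that the following holds for all $d\in\{1,2,\dots\}$ and $T>0$. Let $\Omega$ be the space of continuous functions $\omega:[0,T]\to\mathbb R^d$, $S_t(\omega)=\omega(t)$ the coordinate process, and $(\mathcal F_t)_{t\in[0,T]}$ its natural filtration. A *simple strategy* is a process $G:[0,T]\times\Omega\to\mathbb R^d$ of the form $$G_t(\omega)=g_0(\omega)\mathbf 1_{\{0\}}(t)+\sum_{l=0}^\infty g_l(\omega)\mathbf 1_{(\tau_l(\omega),\tau_{l+1}(\omega)]}(t),$$ where $0=\tau_0\le\tau_1\le\cdots$ are stopping times with values in $[0,T]\cup\{+\infty\}$ such that for every $\omega$ the sequence $\tau_l(\omega)$ is constant from some $l$ on, and each $g_l:\Omega\to\mathbb R^d$ is bounded and $\mathcal F_{\tau_l}$-measurable. Its integral process is $(G\cdot S)_t=\sum_{l\ge0}g_l\cdot(S_{\tau_{l+1}\wedge t}-S_{\tau_l\wedge t})$. For $\lambda>0$ let $\mathcal G_\lambda$ be the set of simple strategies with $(G\cdot S)_t(\omega)\ge-\lambda$ for all $t\in[0,T]$ and all $\omega\in\Omega$. *Outer measure and outer expectation.*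 For $A\subseteq\Omega$ let $\bar{\mathbb P}(A)$ be the infimum of all $\lambda>0$ for which there are $H^n\in\mathcal G_\lambda$, $n\in\mathbb N$, with $\liminf_{n\to\infty}(\lambda+(H^n\cdot S)_T(\omega))\ge\mathbf 1_A(\omega)$ for all $\omega\in\Omega$; sets with $\bar{\mathbb P}(A)=0$ are *null sets*, and a property holds for *typical* paths if it fails only on a null set. For $Z:[0,T]\times\Omega\to[0,+\infty]$ let $$\overline{\mathbb E}Z=\inf_{\tilde\Omega}\,\inf\Big\{\lambda>0:\ \exists\,H^n\in\mathcal G_\lambda,\ n\in\mathbb N,\ \forall\omega\in\tilde\Omega\ \forall\tau\in\mathcal T[0,T]:\ \liminf_{n\to\infty}\big(\lambda+(H^n\cdot S)_\tau\big)(\omega)\ge Z_\tau(\omega)\Big\},$$ where $\tilde\Omega$ runs over the subsets of $\Omega$ with $\bar{\mathbb P}(\Omega\setminus\tilde\Omega)=0$, $\mathcal T[0,T]$ is the set of stopping times with values in $[0,T]$, and $\inf\emptyset=+\infty$. *Quadratic variation.* For continuous $x:[0,T]\to\mathbb R$ and $n\ge 0$ let $\pi^n_0(x)=0$ and $\pi^n_{k+1}(x)=\inf\{t\in[\pi^n_k(x),T]:|x(t)-x(\pi^n_k(x))|=2^{-n}\}$,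 with $\pi^n_{k+1}(x)=+\infty$ if $\pi^n_k(x)=+\infty$. For $\omega=(\omega^1,\dots,\omega^d)\in\Omega$ let $\pi^n_0=0$ and let $\pi^n_{k+1}$ be the smallest $t>\pi^n_k$ among all the points $\pi^n_m(\omega^i)$ and $\pi^n_m(\omega^i+\omega^j)$, $i\ne j$, $m\ge 0$ ($+\infty$ if there is none). For typical paths the limits $$[S^i,S^j]_t=\lim_{n\to\infty}\sum_{k=1}^\infty\big(S^i_{\pi^n_{k+1}\wedge t}-S^i_{\pi^n_k\wedge t}\big)\big(S^j_{\pi^n_{k+1}\wedge t}-S^j_{\pi^n_k\wedge t}\big)$$ exist, uniformly in $t\in[0,T]$ (values on the exceptional null set are immaterial for $\overline{\mathbb E}$). For a simple strategy $G$ as above, $$[(G\cdot S)]_t=\sum_{l=0}^\infty\sum_{i,j=1}^d g^i_l g^j_l\big([S^i,S^j]_{\tau_{l+1}\wedge t}-[S^i,S^j]_{\tau_l\wedge t}\big),\qquad (G\cdot S)^*_t=\sup_{0\le s\le t}|(G\cdot S)_s|.$$ **Theorem.** For every simple strategy $G$ with $\overline{\mathbb E}\sqrt{[(G\cdot S)]}<+\infty$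 (that is, $G\in\mathcal H$), $$\overline{\mathbb E}\,(G\cdot S)^*\ \le\ c_1\,\overline{\mathbb E}\sqrt{[(G\cdot S)]}.$$ -/

import Mathlib

open MeasureTheory Filter Topology
open scoped NNReal ENNReal

noncomputable section

namespace ModelFree

/-- The time interval `[0, T]`. -/
abbrev Time (T : ℝ) : Type := Set.Icc (0 : ℝ) T

/-- The space `Ω` of continuous price paths `ω : [0, T] → ℝ^d`, with `ℝ^d` Euclidean.
The coordinate process is `S_t(ω) = ω t`. -/
abbrev PricePath (d : ℕ) (T : ℝ) : Type := C(Time T, EuclideanSpace ℝ (Fin d))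

/-- The σ-algebra on `Ω` generated by the coordinate process. -/
@[reducible] def pathSigma (d : ℕ) (T : ℝ) : MeasurableSpace (PricePath d T) :=
  ⨆ s : Time T, MeasurableSpace.comap (fun ω : PricePath d T => ω s) inferInstance

/-- The natural filtration `F_t = σ(S_s, s ≤ t)` of the coordinate process
(neither completed nor made right-continuous). -/
def natFiltration (d : ℕ) (T : ℝ) : Filtration (Time T) (pathSigma d T) where
  seq t := ⨆ s : Time T, ⨆ _ : s ≤ t,
    MeasurableSpace.comap (fun ω : PricePath d T => ω s) inferInstance
  mono' _ _ h := iSup_mono fun _ => iSup_le fun hs => le_iSup_of_le (hs.trans h) le_rfl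
  le' _ := iSup_mono fun _ => iSup_le fun _ => le_rfl

/-- `s ∧ t` for `s ∈ [0, T] ∪ {+∞}` and `t ∈ [0, T]`, as an element of `[0, T]`. -/
def cap {T : ℝ} (s : WithTop (Time T)) (t : Time T) : Time T := min (s.untopD t) t

/-- A simple strategy, given by its stopping times `0 = τ_0 ≤ τ_1 ≤ …` with values in
`[0, T] ∪ {+∞}`, for every path constant from some index on, and the bounded,
`F_{τ_l}`-measurable positions `g_l`. -/
structure SimpleStrategy (d : ℕ) (T : ℝ) [Fact (0 ≤ T)] where
  τ : ℕ → PricePath d T → WithTop (Time T)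
  isStoppingTime : ∀ l, IsStoppingTime (natFiltration d T) (τ l)
  τ_zero : ∀ ω, τ 0 ω = ((⊥ : Time T) : WithTop (Time T))
  τ_le_succ : ∀ l ω, τ l ω ≤ τ (l + 1) ω
  τ_eventually : ∀ ω, ∃ l, 1 ≤ l ∧ ∀ k, l ≤ k → τ k ω = τ l ω
  g : ℕ → PricePath d T → EuclideanSpace ℝ (Fin d)
  g_measurable : ∀ l, Measurable[(isStoppingTime l).measurableSpace] (g l)
  g_bounded : ∀ l, ∃ C : ℝ, ∀ ω, ‖g l ω‖ ≤ C

variable {d : ℕ} {T : ℝ} [Fact (0 ≤ T)]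

namespace SimpleStrategy

open Classical in
/-- The simple process
`G_t = g_0 1_{0}(t) + ∑_l g_l 1_{(τ_l, τ_{l+1}]}(t)` that the data represent. -/
def process (G : SimpleStrategy d T) (t : Time T) (ω : PricePath d T) :
    EuclideanSpace ℝ (Fin d) :=
  (if t = ⊥ then G.g 0 ω else 0) +
    ∑' l : ℕ, if G.τ l ω < (t : WithTop (Time T)) ∧ (t : WithTop (Time T)) ≤ G.τ (l + 1) ω
      then G.g l ω else 0

/-- The integral process `(G · S)_t = ∑_l g_l · (S_{τ_{l+1} ∧ t} - S_{τ_l ∧ t})`; for every path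
only finitely many summands are nonzero, and the value depends on `G.process` only. -/
def integral (G : SimpleStrategy d T) (t : Time T) (ω : PricePath d T) : ℝ :=
  ∑' l : ℕ, inner ℝ (G.g l ω) (ω (cap (G.τ (l + 1) ω) t) - ω (cap (G.τ l ω) t))

/-- Strong `lam`-admissibility: `(G · S)_t(ω) ≥ -lam` for all `t` and all `ω`. -/
def Admissible (G : SimpleStrategy d T) (lam : ℝ) : Prop :=
  ∀ (t : Time T) (ω : PricePath d T), -lam ≤ G.integral t ω

end SimpleStrategy

/-- Vovk's outer measure of a set of price paths. -/
def vovkMeasure (A : Set (PricePath d T)) : ℝ≥0∞ :=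
  ⨅ (lam : ℝ) (_ : 0 < lam)
    (_ : ∃ H : ℕ → SimpleStrategy d T, (∀ n, (H n).Admissible lam) ∧
      ∀ ω : PricePath d T, A.indicator (fun _ => (1 : EReal)) ω ≤
        liminf (fun n => ((lam + (H n).integral ⊤ ω : ℝ) : EReal)) atTop),
    ENNReal.ofReal lam

/-- The outer expectation of a process `Z : [0, T] × Ω → [0, +∞]`: the first infimum is over the
sets `A` whose complement is a null set, and the stopping times `τ` take values in `[0, T]`. -/
def outerExp (Z : Time T → PricePath d T → ℝ≥0∞) : ℝ≥0∞ :=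
  ⨅ (A : Set (PricePath d T)) (_ : vovkMeasure Aᶜ = 0) (lam : ℝ) (_ : 0 < lam)
    (_ : ∃ H : ℕ → SimpleStrategy d T, (∀ n, (H n).Admissible lam) ∧
      ∀ ω ∈ A, ∀ τ : PricePath d T → Time T,
        IsStoppingTime (natFiltration d T) (fun ω' => (τ ω' : WithTop (Time T))) →
        (Z (τ ω) ω : EReal) ≤
          liminf (fun n => ((lam + (H n).integral (τ ω) ω : ℝ) : EReal)) atTop),
    ENNReal.ofReal lam

/-- The `n`th Lebesgue partition generated by a real path `x`: the next point after a finite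
point `s` is the first time `r ≥ s` with `|x r - x s| = 2^{-n}`; the infimum of the empty set is
`⊤ = +∞`. -/
def lebesgueTime (n : ℕ) (x : Time T → ℝ) : ℕ → WithTop (Time T)
  | 0 => ((⊥ : Time T) : WithTop (Time T))
  | k + 1 => sInf {t : WithTop (Time T) | ∃ s r : Time T,
      lebesgueTime n x k = (s : WithTop (Time T)) ∧ t = (r : WithTop (Time T)) ∧
      s ≤ r ∧ |x r - x s| = (2 ^ n : ℝ)⁻¹}

/-- The union of the points of the `n`th Lebesgue partitions generated by the coordinates `ω^i`
and by the sums `ω^i + ω^j`, `i ≠ j`. -/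
def partitionPoints (n : ℕ) (ω : PricePath d T) : Set (WithTop (Time T)) :=
  (⋃ i : Fin d, Set.range (lebesgueTime n fun t : Time T => ω t i)) ∪
    ⋃ (i : Fin d) (j : Fin d) (_ : i ≠ j),
      Set.range (lebesgueTime n fun t : Time T => ω t i + ω t j)

/-- The `n`th Lebesgue partition generated by `ω ∈ Ω`: the points of `partitionPoints n ω` in
increasing order, continued by `⊤ = +∞`. -/
def partitionTime (n : ℕ) (ω : PricePath d T) : ℕ → WithTop (Time T)
  | 0 => ((⊥ : Time T) : WithTop (Time T))
  | k + 1 => sInf {t : WithTop (Time T) | partitionTime n ω k < t ∧ t ∈ partitionPoints n ω}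

/-- The quadratic covariation `[S^i, S^j]_t` along the Lebesgue partitions. For typical price
paths the limit exists, uniformly in `t`; elsewhere `limUnder` is an unspecified value, which does
not influence `outerExp`. -/
def covariation (i j : Fin d) (t : Time T) (ω : PricePath d T) : ℝ :=
  limUnder atTop fun n : ℕ => ∑' k : ℕ,
    (ω (cap (partitionTime n ω (k + 2)) t) i - ω (cap (partitionTime n ω (k + 1)) t) i) *
    (ω (cap (partitionTime n ω (k + 2)) t) j - ω (cap (partitionTime n ω (k + 1)) t) j)

/-- The quadratic variation process `[(G · S)]` of the integral process. -/
def SimpleStrategy.quadVar (G : SimpleStrategy d T) (t : Time T) (ω : PricePath d T) : ℝ :=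
  ∑' l : ℕ, ∑ i : Fin d, ∑ j : Fin d, G.g l ω i * G.g l ω j *
    (covariation i j (cap (G.τ (l + 1) ω) t) ω - covariation i j (cap (G.τ l ω) t) ω)

/-- The process `√[(G · S)]`. -/
def SimpleStrategy.sqrtQuadVar (G : SimpleStrategy d T) (t : Time T) (ω : PricePath d T) : ℝ≥0∞ :=
  ENNReal.ofReal (Real.sqrt (G.quadVar t ω))

/-- The running maximum `(G · S)^*_t = sup_{s ≤ t} |(G · S)_s|`. -/
def SimpleStrategy.runningMax (G : SimpleStrategy d T) (t : Time T) (ω : PricePath d T) : ℝ≥0∞ :=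
  ⨆ (s : Time T) (_ : s ≤ t), ENNReal.ofReal |G.integral s ω|

/-- The family `𝓗` of the simple strategies with finite outer expectation of `√[(G · S)]`. -/
def finiteQuadVarStrategies (d : ℕ) (T : ℝ) [Fact (0 ≤ T)] : Set (SimpleStrategy d T) :=
  {G | outerExp G.sqrtQuadVar < ∞}

end ModelFree

end

/-!
The inequality holds with `c₁ = 6`. The proof is pathwise and rests on two strategies.

*The pathwise Burkholder–Davis–Gundy inequality* `runMax_le`: for every real sequence `z` with
`z 0 = 0`, the running maximum of `|z|` is at most `6 √[z] + 2 (h · z)`, where `[z]` is the sum of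
the squares of the increments and `h` is an explicit nonanticipating weight bounded by `1`. Applied
to `G · S`, sampled along the `n`th Lebesgue partition refined by the stopping times of `G`
(`SimpleStrategy.grid`), it bounds `|G · S|` by `6 √(sqSum n) + 2 bdgProc n`, where `bdgProc n` is
the integral process of a simple strategy and the sum of squares `sqSum n` converges to
`[(G · S)]` for typical paths (`IsTypical.tendsto_sqSum`). The convergence has to be proved since
`[S^i, S^j]` is defined by the partitions of the paths alone: `vovkMeasure_covSum_sub` shows that
the sums of squares along two sequences of partitions of mesh `O(2^{-n})` differ by `O(2^{-n/2})`,
because otherwise trading on the square of the difference of two discretised Itô integrals would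
make arbitrarily much money. Polarisation along the directions `e_i` and `e_i + e_j` extends this
to covariations.

If `lam + H n` superhedges `√[(G · S)]` in the limit, it is natural to superhedge `(G · S)^*` by
`6 lam + 6 H n + 2 bdgProc n`. This is not admissible, as the process may be very negative before
the limit is reached, and it has to be stopped at the time `σ n` when it reaches `-ε`.

*Betting on recoveries* shows that for typical paths only finitely many `σ n` are finite, so
that stopping does not change the limit. At time `σ n` the wealth `lam + H n` lies below the square
root of `[(G · S)]` by a fixed multiple of `ε`, up to a vanishing error. Since the root increases
and is superhedged at *every later time*, the wealth must soon gain a fixed amount `c`. If this happened for infinitely many `n`,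
one could invest the whole capital in one such wealth process after the other, each time from
`σ n` to the time of the recovery, and the capital would be multiplied each time by a factor
bounded away from `1`. The point is that for each `k` this can be done `k` times in succession even
if the times `σ n` are not ordered in any way (`exists_roundEnd_lt_top`); the resulting null set is
`vovkMeasure_frequently_dip`, and `SimpleStrategy.exists_superhedge` combines the two strategies.

Throughout, stopping times of the natural filtration are handled by Galmarino's test
(`isStoppingTime_iff`), as measurable times that depend only on the path up to that time, and
`IsIntegral` collects the integral processes of simple strategies; it is closed under sums,
stopping, and holding a bounded position between two stopping times.
-/

noncomputable section

namespace ModelFree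

set_option linter.unusedSectionVars false

variable {d : ℕ} {T : ℝ} [Fact (0 ≤ T)]

attribute [local instance] pathSigma

/-! ### Random times and nonanticipating functionals -/

/-- The paths `ω` and `ω'` coincide on `[0, s]`. -/
def AgreeUpTo (s : WithTop (Time T)) (ω ω' : PricePath d T) : Prop :=
  ∀ r : Time T, (r : WithTop (Time T)) ≤ s → ω r = ω' r

/-- A measurable random time which only depends on the path up to that time; this is the
description of the stopping times of the natural filtration given by Galmarino's test, see
`isStoppingTime_iff`. -/
structure IsRandomTime (τ : PricePath d T → WithTop (Time T)) : Prop where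
  measurable : Measurable τ
  nonant : ∀ ω ω', AgreeUpTo (τ ω) ω ω' → τ ω' = τ ω

/-- A measurable functional which only depends on the path up to the random time `τ`; for a stopping
time `τ` these are the `F_τ`-measurable functionals, see `measurable_iff_knownAt`. -/
structure KnownAt {β : Type*} [MeasurableSpace β] (τ : PricePath d T → WithTop (Time T))
    (g : PricePath d T → β) : Prop where
  measurable : Measurable g
  nonant : ∀ ω ω', AgreeUpTo (τ ω) ω ω' → g ω' = g ω

/-- A real process with continuous paths which is adapted to the natural filtration. -/
structure IsContAdapted (X : Time T → PricePath d T → ℝ) : Prop where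
  cont : ∀ ω, Continuous fun t => X t ω
  measurable : ∀ t, Measurable (X t)
  nonant : ∀ (t : Time T) ω ω', AgreeUpTo (t : WithTop (Time T)) ω ω' → X t ω' = X t ω

theorem AgreeUpTo.mono {s t : WithTop (Time T)} {ω ω' : PricePath d T} (h : AgreeUpTo t ω ω')
    (hst : s ≤ t) : AgreeUpTo s ω ω' := fun r hr => h r (hr.trans hst)

theorem AgreeUpTo.symm {s : WithTop (Time T)} {ω ω' : PricePath d T} (h : AgreeUpTo s ω ω') :
    AgreeUpTo s ω' ω := fun r hr => (h r hr).symm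

theorem AgreeUpTo.eq_of_top {ω ω' : PricePath d T} (h : AgreeUpTo ⊤ ω ω') : ω = ω' :=
  ContinuousMap.ext fun r => h r le_top

theorem measurable_eval (t : Time T) : Measurable fun ω : PricePath d T => ω t :=
  Measurable.of_comap_le (le_iSup_of_le t le_rfl)

/-- An event of the natural filtration at time `t` does not distinguish paths that coincide
on `[0, t]`. -/
theorem mem_iff_of_agreeUpTo {t : Time T} {A : Set (PricePath d T)}
    (hA : MeasurableSet[natFiltration d T t] A) {ω ω' : PricePath d T}
    (h : AgreeUpTo (t : WithTop (Time T)) ω ω') : ω ∈ A ↔ ω' ∈ A := by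
  let m : MeasurableSpace (PricePath d T) :=
    { MeasurableSet' := fun A => ω ∈ A ↔ ω' ∈ A
      measurableSet_empty := by simp
      measurableSet_compl := fun s hs => by simp only [Set.mem_compl_iff, hs]
      measurableSet_iUnion := fun f hf => by simp only [Set.mem_iUnion, hf] }
  have hm : natFiltration d T t ≤ m := by
    refine iSup_le fun s => iSup_le fun hs => ?_
    rintro _ ⟨B, -, rfl⟩
    change ω s ∈ B ↔ ω' s ∈ B
    rw [h s (by exact_mod_cast hs)]
  exact hm A hA

/-- The path stopped at time `t`. -/
def stopPath (t : Time T) (ω : PricePath d T) : PricePath d T :=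
  ⟨fun s => ω (min s t), by fun_prop⟩

theorem measurableSet_natFiltration {t : Time T} {A : Set (PricePath d T)} (hA : MeasurableSet A)
    (h : ∀ ω ω', AgreeUpTo (t : WithTop (Time T)) ω ω' → ω ∈ A → ω' ∈ A) :
    MeasurableSet[natFiltration d T t] A := by
  have h1 : Measurable[natFiltration d T t] (stopPath t : PricePath d T → PricePath d T) := by
    rw [measurable_iff_comap_le, MeasurableSpace.comap_iSup]
    refine iSup_le fun s => ?_
    rw [MeasurableSpace.comap_comp]
    exact le_iSup_of_le (min s t) (le_iSup_of_le (min_le_right s t) le_rfl)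
  have h2 : A = stopPath t ⁻¹' A := by
    ext ω
    have h3 : AgreeUpTo (t : WithTop (Time T)) ω (stopPath t ω) := fun r hr => by
      have : r ≤ t := by exact_mod_cast hr
      simp [stopPath, min_eq_left this]
    exact ⟨h _ _ h3, h _ _ h3.symm⟩
  rw [h2]
  exact h1 hA

/-- Galmarino's test. -/
theorem isStoppingTime_iff {τ : PricePath d T → WithTop (Time T)} :
    IsStoppingTime (natFiltration d T) τ ↔ IsRandomTime τ := by
  constructor
  · refine fun h => ⟨h.measurable', fun ω ω' hω => ?_⟩
    rcases hτ : τ ω with _ | t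
    · rw [hτ] at hω
      rw [← hω.eq_of_top, hτ]
    · rw [hτ] at hω
      have h1 : τ ω' ≤ t := (mem_iff_of_agreeUpTo (h t) hω).1 hτ.le
      refine le_antisymm h1 (not_lt.1 fun h2 => ?_)
      obtain ⟨s, hs⟩ := WithTop.ne_top_iff_exists.1 (h1.trans_lt (WithTop.coe_lt_top t)).ne
      have h3 : τ ω ≤ s := (mem_iff_of_agreeUpTo (h s) (hω.mono (hs ▸ h2.le))).2 hs.ge
      rw [hτ, hs] at h3
      exact absurd h3 (not_le.2 h2)
  · refine fun h t => measurableSet_natFiltration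
      (measurableSet_le h.measurable measurable_const) ?_
    intro ω ω' hω hτ
    have hτ' : τ ω ≤ t := hτ
    change τ ω' ≤ t
    rwa [h.nonant ω ω' (hω.mono hτ')]

theorem measurable_iff_knownAt {β : Type*} [MeasurableSpace β] [MeasurableSingletonClass β]
    {τ : PricePath d T → WithTop (Time T)} (hτ : IsStoppingTime (natFiltration d T) τ)
    {g : PricePath d T → β} : Measurable[hτ.measurableSpace] g ↔ KnownAt τ g := by
  constructor
  · refine fun h => ⟨h.mono hτ.measurableSpace_le le_rfl, fun ω ω' hω => ?_⟩
    rcases hτω : τ ω with _ | t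
    · rw [hτω] at hω
      rw [← hω.eq_of_top]
    · rw [hτω] at hω
      have h1 := (h (measurableSet_singleton (g ω))).2 t
      exact ((mem_iff_of_agreeUpTo h1 hω).1 ⟨rfl, hτω.le⟩).1
  · intro h B hB
    refine ⟨?_, fun t => measurableSet_natFiltration ((h.measurable hB).inter
      (measurableSet_le (isStoppingTime_iff.1 hτ).measurable measurable_const)) ?_⟩
    · have h1 : MeasurableSet[natFiltration d T ⊤] (g ⁻¹' B) := by
        refine measurableSet_natFiltration (h.measurable hB) fun ω ω' hω hB => ?_
        have : ω = ω' := ContinuousMap.ext fun r => hω r (by exact_mod_cast le_top)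
        rwa [← this]
      exact le_iSup (fun t => (natFiltration d T t)) ⊤ _ h1
    · rintro ω ω' hω ⟨h1, h2⟩
      have h2' : τ ω ≤ t := h2
      refine ⟨?_, ?_⟩
      · change g ω' ∈ B
        rwa [h.nonant ω ω' (hω.mono h2')]
      · change τ ω' ≤ t
        rwa [(isStoppingTime_iff.1 hτ).nonant ω ω' (hω.mono h2')]

namespace IsRandomTime

variable {σ τ : PricePath d T → WithTop (Time T)}

theorem const (s : WithTop (Time T)) : IsRandomTime fun _ : PricePath d T => s :=
  ⟨measurable_const, fun _ _ _ => rfl⟩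

/-- Paths coinciding up to `s` cannot tell apart the values of a random time before `s`. -/
theorem min_eq (hτ : IsRandomTime τ) {s : WithTop (Time T)} {ω ω' : PricePath d T}
    (h : AgreeUpTo s ω ω') : min (τ ω') s = min (τ ω) s := by
  rcases le_total (τ ω) s with h1 | h1
  · rw [hτ.nonant ω ω' (h.mono h1)]
  · rcases le_total (τ ω') s with h2 | h2
    · rw [hτ.nonant ω' ω (h.symm.mono h2)]
    · rw [min_eq_right h1, min_eq_right h2]

theorem eq_of_le (hτ : IsRandomTime τ) {s : WithTop (Time T)} {ω ω' : PricePath d T}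
    (h : AgreeUpTo s ω ω') (hs : τ ω ≤ s) : τ ω' = τ ω := hτ.nonant ω ω' (h.mono hs)

theorem le_iff (hτ : IsRandomTime τ) {s : WithTop (Time T)} {ω ω' : PricePath d T}
    (h : AgreeUpTo s ω ω') : τ ω' ≤ s ↔ τ ω ≤ s := by
  rw [← min_eq_left_iff, ← min_eq_left_iff]
  constructor <;> intro h1
  · have := hτ.nonant ω' ω (h.symm.mono (min_eq_left_iff.1 h1)); rwa [this]
  · have := hτ.nonant ω ω' (h.mono (min_eq_left_iff.1 h1)); rwa [this]

theorem lt_iff (hτ : IsRandomTime τ) {s : WithTop (Time T)} {ω ω' : PricePath d T}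
    (h : AgreeUpTo s ω ω') : s < τ ω' ↔ s < τ ω := by
  rw [← not_le, ← not_le, hτ.le_iff h]

theorem lt_iff' (hτ : IsRandomTime τ) {s : WithTop (Time T)} {ω ω' : PricePath d T}
    (h : AgreeUpTo s ω ω') : τ ω' < s ↔ τ ω < s := by
  constructor <;> intro h1
  · rwa [hτ.eq_of_le h.symm h1.le]
  · rwa [hτ.eq_of_le h h1.le]

theorem min (hσ : IsRandomTime σ) (hτ : IsRandomTime τ) :
    IsRandomTime fun ω => min (σ ω) (τ ω) := by
  refine ⟨hσ.measurable.min hτ.measurable, fun ω ω' h => ?_⟩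
  rcases le_total (σ ω) (τ ω) with h1 | h1
  · rw [min_eq_left h1] at h ⊢
    rw [hσ.nonant ω ω' h, min_eq_left]
    exact not_lt.1 fun h2 => absurd ((hτ.lt_iff' h).1 h2) (not_lt.2 h1)
  · rw [min_eq_right h1] at h ⊢
    rw [hτ.nonant ω ω' h, min_eq_right]
    exact not_lt.1 fun h2 => absurd ((hσ.lt_iff' h).1 h2) (not_lt.2 h1)

theorem max (hσ : IsRandomTime σ) (hτ : IsRandomTime τ) :
    IsRandomTime fun ω => max (σ ω) (τ ω) := by
  refine ⟨hσ.measurable.max hτ.measurable, fun ω ω' h => ?_⟩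
  rw [hσ.eq_of_le h (le_max_left _ _), hτ.eq_of_le h (le_max_right _ _)]

theorem finset_inf {ι : Type*} (s : Finset ι) {f : ι → PricePath d T → WithTop (Time T)}
    (hf : ∀ i ∈ s, IsRandomTime (f i)) : IsRandomTime fun ω => s.inf fun i => f i ω := by
  classical
  induction s using Finset.induction_on with
  | empty => simpa using const ⊤
  | insert a s _ ih =>
    simp only [Finset.inf_insert]
    exact (hf a (by simp)).min (ih fun i hi => hf i (by simp [hi]))

/-- Switching from one random time to another at an event known at time `σ` that both exceed. -/
theorem ite {τ₁ τ₂ : PricePath d T → WithTop (Time T)}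
    (h₁ : IsRandomTime τ₁) (h₂ : IsRandomTime τ₂) {p : PricePath d T → Prop} [DecidablePred p]
    (hp : KnownAt σ p) (hle₁ : ∀ ω, p ω → σ ω ≤ τ₁ ω) (hle₂ : ∀ ω, ¬ p ω → σ ω ≤ τ₂ ω) :
    IsRandomTime fun ω => if p ω then τ₁ ω else τ₂ ω := by
  refine ⟨Measurable.ite (measurableSet_setOfPred.2 hp.measurable) h₁.measurable h₂.measurable,
    fun ω ω' h => ?_⟩
  by_cases hpω : p ω
  · simp only [hpω, if_true] at h ⊢
    have := hp.nonant ω ω' (h.mono (hle₁ ω hpω))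
    simp only [this, hpω, if_true]
    exact h₁.nonant ω ω' h
  · simp only [hpω, if_false] at h ⊢
    have := hp.nonant ω ω' (h.mono (hle₂ ω hpω))
    simp only [this, hpω, if_false]
    exact h₂.nonant ω ω' h

end IsRandomTime

namespace KnownAt

variable {β : Type*} [MeasurableSpace β] {σ τ : PricePath d T → WithTop (Time T)}

theorem const (c : β) : KnownAt τ fun _ : PricePath d T => c :=
  ⟨measurable_const, fun _ _ _ => rfl⟩

theorem mono {g : PricePath d T → β} (hg : KnownAt σ g) (h : ∀ ω, σ ω ≤ τ ω) : KnownAt τ g :=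
  ⟨hg.measurable, fun ω ω' hω => hg.nonant ω ω' (hω.mono (h ω))⟩

theorem comp {γ : Type*} [MeasurableSpace γ] {g : PricePath d T → β} (hg : KnownAt τ g) {f : β → γ}
    (hf : Measurable f) : KnownAt τ fun ω => f (g ω) :=
  ⟨hf.comp hg.measurable, fun ω ω' h => by rw [hg.nonant ω ω' h]⟩

theorem prodMk {γ : Type*} [MeasurableSpace γ] {g : PricePath d T → β} {f : PricePath d T → γ}
    (hg : KnownAt τ g) (hf : KnownAt τ f) : KnownAt τ fun ω => (g ω, f ω) :=
  ⟨hg.measurable.prodMk hf.measurable, fun ω ω' h => by rw [hg.nonant ω ω' h, hf.nonant ω ω' h]⟩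

theorem comp₂ {γ δ : Type*} [MeasurableSpace γ] [MeasurableSpace δ] {g : PricePath d T → β}
    {f : PricePath d T → γ} (hg : KnownAt τ g) (hf : KnownAt τ f) {u : β → γ → δ}
    (hu : Measurable (Function.uncurry u)) : KnownAt τ fun ω => u (g ω) (f ω) :=
  (hg.prodMk hf).comp hu

theorem le_le (hσ : IsRandomTime σ) (hτ : IsRandomTime τ) : KnownAt τ fun ω => σ ω ≤ τ ω :=
  ⟨measurableSet_setOfPred.1 (measurableSet_le hσ.measurable hτ.measurable), fun ω ω' h => by
    rw [hτ.nonant ω ω' h, eq_iff_iff]; exact hσ.le_iff h⟩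

theorem lt_time (hσ : IsRandomTime σ) (hτ : IsRandomTime τ) : KnownAt τ fun ω => τ ω < σ ω :=
  ⟨measurableSet_setOfPred.1 (measurableSet_lt hτ.measurable hσ.measurable), fun ω ω' h => by
    rw [hτ.nonant ω ω' h, eq_iff_iff]; exact hσ.lt_iff h⟩

theorem and {p q : PricePath d T → Prop} (hp : KnownAt τ p) (hq : KnownAt τ q) :
    KnownAt τ fun ω => p ω ∧ q ω :=
  ⟨measurableSet_setOfPred.1 ((measurableSet_setOfPred.2 hp.measurable).inter
    (measurableSet_setOfPred.2 hq.measurable)),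
    fun ω ω' h => by rw [hp.nonant ω ω' h, hq.nonant ω ω' h]⟩

theorem ite {p : PricePath d T → Prop} [DecidablePred p] (hp : KnownAt τ p)
    {f g : PricePath d T → β} (hf : KnownAt τ f) (hg : KnownAt τ g) :
    KnownAt τ fun ω => if p ω then f ω else g ω :=
  ⟨Measurable.ite (measurableSet_setOfPred.2 hp.measurable) hf.measurable hg.measurable,
    fun ω ω' h => by
      have := hp.nonant ω ω' h
      simp only [this, hf.nonant ω ω' h, hg.nonant ω ω' h]⟩

/-- A functional known at `σ`, switched off unless `σ ≤ τ`, is known at `τ`. -/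
theorem ite_le {g : PricePath d T → β} {p : PricePath d T → Prop} [DecidablePred p]
    (hp : KnownAt τ p) (hle : ∀ ω, p ω → σ ω ≤ τ ω) (hg : KnownAt σ g) (c : β) :
    KnownAt τ fun ω => if p ω then g ω else c :=
  ⟨Measurable.ite (measurableSet_setOfPred.2 hp.measurable) hg.measurable measurable_const,
    fun ω ω' h => by
      have h1 := hp.nonant ω ω' h
      simp only [h1]
      split_ifs with h2
      · exact hg.nonant ω ω' (h.mono (hle ω h2))
      · rfl⟩

end KnownAt

/-! ### Capped times -/

@[simp]
theorem coe_cap (s : WithTop (Time T)) (t : Time T) :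
    ((cap s t : Time T) : WithTop (Time T)) = min s t := by
  induction s with
  | top => simp [cap]
  | coe s => simp [cap]

theorem cap_le (s : WithTop (Time T)) (t : Time T) : cap s t ≤ t := min_le_right _ _

theorem cap_eq_right {s : WithTop (Time T)} {t : Time T} (h : (t : WithTop (Time T)) ≤ s) :
    cap s t = t := by
  have : ((cap s t : Time T) : WithTop (Time T)) = t := by rw [coe_cap, min_eq_right h]
  exact_mod_cast this

theorem coe_cap_eq_left {s : WithTop (Time T)} {t : Time T} (h : s ≤ t) :
    ((cap s t : Time T) : WithTop (Time T)) = s := by rw [coe_cap, min_eq_left h]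

@[simp]
theorem cap_top (t : Time T) : cap ⊤ t = t := cap_eq_right le_top

@[simp]
theorem cap_bot (t : Time T) : cap ⊥ t = ⊥ :=
  min_eq_left (bot_le : (⊥ : Time T) ≤ t)

@[simp]
theorem cap_coe (s t : Time T) : cap (s : WithTop (Time T)) t = min s t := rfl

theorem cap_cap (r s : WithTop (Time T)) (t : Time T) : cap r (cap s t) = cap (min r s) t := by
  have : ((cap r (cap s t) : Time T) : WithTop (Time T)) = (cap (min r s) t : Time T) := by
    simp [min_assoc]
  exact_mod_cast this

theorem cap_mono {r s : WithTop (Time T)} (h : r ≤ s) (t : Time T) : cap r t ≤ cap s t := by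
  have : ((cap r t : Time T) : WithTop (Time T)) ≤ (cap s t : Time T) := by
    simp only [coe_cap]; exact min_le_min_right _ h
  exact_mod_cast this

theorem continuous_cap (s : WithTop (Time T)) : Continuous (cap s) := by
  unfold cap
  induction s with
  | top => simpa using continuous_id'
  | coe s => simpa using continuous_const.min continuous_id

theorem measurable_cap {τ : PricePath d T → WithTop (Time T)} (hτ : Measurable τ) (t : Time T) :
    Measurable fun ω => cap (τ ω) t := by
  refine measurable_of_Iic fun x => ?_
  have : (fun ω => cap (τ ω) t) ⁻¹' Set.Iic x = {ω | min (τ ω) t ≤ (x : WithTop (Time T))} := by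
    ext ω
    change cap (τ ω) t ≤ x ↔ min (τ ω) t ≤ (x : WithTop (Time T))
    rw [← coe_cap, WithTop.coe_le_coe]
  rw [this]
  exact measurableSet_le (hτ.min measurable_const) measurable_const

namespace IsContAdapted

variable {X Y : Time T → PricePath d T → ℝ}

theorem measurable_comp (hX : IsContAdapted X) {u : PricePath d T → Time T} (hu : Measurable u) :
    Measurable fun ω => X (u ω) ω :=
  (measurable_uncurry_of_continuous_of_measurable (u := X) hX.cont hX.measurable).comp
    (hu.prodMk measurable_id)

end IsContAdapted

/-! ### Sums along partitions of the time interval -/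

/-- A sequence of times increasing from `0` which reaches `+∞` after finitely many steps. -/
structure IsPartition (a : ℕ → WithTop (Time T)) : Prop where
  zero : a 0 = ((⊥ : Time T) : WithTop (Time T))
  mono : Monotone a
  top : ∃ L, a L = ⊤

/-- The sum over `l` of the increments of `F l` on `[a_l, a_{l+1}] ∩ [0, t]`. Integral processes,
their quadratic variations and discretised stochastic integrals are all of this form. -/
def stepSum (a : ℕ → WithTop (Time T)) (F : ℕ → Time T → ℝ) (t : Time T) : ℝ :=
  ∑' l : ℕ, (F l (cap (a (l + 1)) t) - F l (cap (a l) t))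

theorem cap_eq_cap {r : WithTop (Time T)} {s t : Time T} (h1 : r ≤ s) (h2 : s ≤ t) :
    cap r s = cap r t := by
  have h3 : (s : WithTop (Time T)) ≤ t := by exact_mod_cast h2
  have : ((cap r s : Time T) : WithTop (Time T)) = (cap r t : Time T) := by
    rw [coe_cap_eq_left h1, coe_cap_eq_left (h1.trans h3)]
  exact_mod_cast this

theorem stepSum_eq_sum {a : ℕ → WithTop (Time T)} (ha : Monotone a) (F : ℕ → Time T → ℝ)
    {t : Time T} {N : ℕ} (hN : (t : WithTop (Time T)) ≤ a N) :
    stepSum a F t = ∑ l ∈ Finset.range N, (F l (cap (a (l + 1)) t) - F l (cap (a l) t)) := by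
  refine tsum_eq_sum fun l hl => ?_
  have hl : N ≤ l := by simpa using hl
  rw [cap_eq_right (hN.trans (ha hl)), cap_eq_right (hN.trans (ha (hl.trans l.le_succ))), sub_self]

namespace IsPartition

variable {a b : ℕ → WithTop (Time T)}

theorem eq_top (ha : IsPartition a) {L k : ℕ} (hL : a L = ⊤) (hk : L ≤ k) : a k = ⊤ :=
  top_le_iff.1 (hL ▸ ha.mono hk)

/-- The partition interval that contains a given time, the right end being excluded. -/
theorem exists_mem (ha : IsPartition a) {s : WithTop (Time T)} (hs : s < ⊤) :
    ∃ l, a l ≤ s ∧ s < a (l + 1) := by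
  classical
  have h : ∃ k, s < a k := ha.top.imp fun L hL => by rwa [hL]
  have h0 : Nat.find h ≠ 0 := fun h0 => by
    have := Nat.find_spec h
    rw [h0, ha.zero] at this
    obtain ⟨r, rfl⟩ := WithTop.ne_top_iff_exists.1 hs.ne
    exact absurd (bot_le : ⊥ ≤ r) (not_le.2 (by exact_mod_cast this))
  refine ⟨Nat.find h - 1, not_lt.1 (Nat.find_min h (by omega)), ?_⟩
  rw [Nat.sub_add_cancel (Nat.pos_of_ne_zero h0)]
  exact Nat.find_spec h

theorem stepSum_sub (ha : IsPartition a) (F : ℕ → Time T → ℝ) {l : ℕ} {s t : Time T}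
    (hs : a l ≤ s) (hst : s ≤ t) (ht : (t : WithTop (Time T)) ≤ a (l + 1)) :
    stepSum a F t - stepSum a F s = F l t - F l s := by
  obtain ⟨L, hL⟩ := ha.top
  have hst' : (s : WithTop (Time T)) ≤ t := by exact_mod_cast hst
  have hM : a (max L (l + 1)) = ⊤ := ha.eq_top hL (le_max_left _ _)
  rw [stepSum_eq_sum ha.mono F (N := max L (l + 1)) (t := t) (by simp [hM]),
    stepSum_eq_sum ha.mono F (N := max L (l + 1)) (t := s) (by simp [hM]),
    ← Finset.sum_sub_distrib, Finset.sum_eq_single l]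
  · rw [cap_eq_cap hs hst, cap_eq_right ht, cap_eq_right (hst'.trans ht)]
    ring
  · intro k _ hk
    rcases lt_or_gt_of_ne hk with hk | hk
    · rw [cap_eq_cap ((ha.mono hk).trans hs) hst,
        cap_eq_cap ((ha.mono hk.le).trans hs) hst, sub_self]
    · have h1 := ht.trans (ha.mono (show l + 1 ≤ k from hk))
      have h2 := h1.trans (ha.mono k.le_succ)
      rw [cap_eq_right h1, cap_eq_right h2, cap_eq_right (hst'.trans h1),
        cap_eq_right (hst'.trans h2)]
      simp
  · intro h
    exact absurd (Finset.mem_range.2 (lt_of_lt_of_le l.lt_succ_self (le_max_right _ _))) h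

theorem stepSum_bot (F : ℕ → Time T → ℝ) : stepSum a F ⊥ = 0 := by
  have h : ∀ r : WithTop (Time T), cap r ⊥ = ⊥ := fun r => le_bot_iff.1 (cap_le r ⊥)
  simp [stepSum, h]

theorem continuous_stepSum (ha : IsPartition a) {F : ℕ → Time T → ℝ} (hF : ∀ l, Continuous (F l)) :
    Continuous (stepSum a F) := by
  obtain ⟨L, hL⟩ := ha.top
  have : stepSum a F = fun t => ∑ l ∈ Finset.range L,
      (F l (cap (a (l + 1)) t) - F l (cap (a l) t)) :=
    funext fun t => stepSum_eq_sum ha.mono F (by simp [hL])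
  rw [this]
  exact continuous_finsetSum _ fun l _ => ((hF l).comp (continuous_cap _)).sub
    ((hF l).comp (continuous_cap _))

/-- A function starting at `0` is the sum of its increments along a partition. -/
theorem eq_stepSum (ha : IsPartition a) {J : Time T → ℝ} (h0 : J ⊥ = 0) {F : ℕ → Time T → ℝ}
    (t : Time T) (h : ∀ j, a j < a (j + 1) → a j < t →
      J (cap (a (j + 1)) t) - J (cap (a j) t) = F j (cap (a (j + 1)) t) - F j (cap (a j) t)) :
    J t = stepSum a F t := by
  obtain ⟨L, hL⟩ := ha.top
  rw [stepSum_eq_sum ha.mono F (N := L) (by simp [hL])]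
  have : ∀ j ∈ Finset.range L, F j (cap (a (j + 1)) t) - F j (cap (a j) t) =
      J (cap (a (j + 1)) t) - J (cap (a j) t) := by
    intro j _
    rcases (ha.mono j.le_succ).eq_or_lt with h1 | h1
    · rw [Nat.succ_eq_add_one] at h1
      simp [h1]
    · rcases lt_or_ge (a j) (t : WithTop (Time T)) with h2 | h2
      · exact (h j h1 h2).symm
      · rw [cap_eq_right h2, cap_eq_right (h2.trans (ha.mono j.le_succ))]
        simp
  rw [Finset.sum_congr rfl this, Finset.sum_range_sub (fun j => J (cap (a j) t)), hL, ha.zero]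
  simp [h0]

end IsPartition

/-- Every nonempty interval of the partition `r` lies in an interval of the partition `a` with at
most the same index. -/
def Refines (r a : ℕ → WithTop (Time T)) : Prop :=
  ∀ j, r j < r (j + 1) → ∀ l, a l ≤ r j → r j < a (l + 1) → l ≤ j ∧ r (j + 1) ≤ a (l + 1)

theorem stepSum_refine {a r : ℕ → WithTop (Time T)} (ha : IsPartition a) (hr : IsPartition r)
    (hra : Refines r a) {F F' : ℕ → Time T → ℝ} (t : Time T)
    (h : ∀ j l, l ≤ j → a l ≤ r j → r j < a (l + 1) → ∀ u v : Time T, r j ≤ u → u ≤ v →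
      (v : WithTop (Time T)) ≤ r (j + 1) → F' j v - F' j u = F l v - F l u) :
    stepSum a F t = stepSum r F' t := by
  refine hr.eq_stepSum (IsPartition.stepSum_bot F) t fun j hj hjt => ?_
  obtain ⟨l, hl1, hl2⟩ := ha.exists_mem (hj.trans_le le_top)
  obtain ⟨hlj, hl3⟩ := hra j hj l hl1 hl2
  have h1 : ((cap (r j) t : Time T) : WithTop (Time T)) = r j := coe_cap_eq_left hjt.le
  have h2 : ((cap (r (j + 1)) t : Time T) : WithTop (Time T)) ≤ r (j + 1) := by simp
  have h3 := cap_mono hj.le t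
  rw [ha.stepSum_sub F (h1.symm ▸ hl1 : a l ≤ ((cap (r j) t : Time T) : WithTop (Time T))) h3
    (h2.trans hl3), h j l hlj hl1 hl2 _ _ h1.ge h3 h2]

/-- The common refinement of two partitions: the points of both in increasing order, counted with
multiplicity. Keeping multiplicities makes the index of an interval of `merge a b` an upper bound
for the indices of the intervals of `a` and `b` around it. -/
def merge (a b : ℕ → WithTop (Time T)) (k : ℕ) : WithTop (Time T) :=
  (Finset.range (k + 1)).inf fun l => max (a l) (b (k - l))

section Merge

variable {a b : ℕ → WithTop (Time T)}

theorem merge_le {l m k : ℕ} (h : l + m = k) : merge a b k ≤ max (a l) (b m) := by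
  subst h
  refine (Finset.inf_le (Finset.mem_range.2 (by omega : l < l + m + 1))).trans ?_
  rw [Nat.add_sub_cancel_left]

theorem exists_merge_eq (a b : ℕ → WithTop (Time T)) (k : ℕ) :
    ∃ l m, l + m = k ∧ merge a b k = max (a l) (b m) := by
  obtain ⟨l, hl, h⟩ := Finset.exists_mem_eq_inf (Finset.range (k + 1)) ⟨0, by simp⟩
    fun l => max (a l) (b (k - l))
  exact ⟨l, k - l, by have := Finset.mem_range.1 hl; omega, h⟩

theorem merge_comm (a b : ℕ → WithTop (Time T)) : merge a b = merge b a := by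
  have h : ∀ a b : ℕ → WithTop (Time T), ∀ k, merge a b k ≤ merge b a k := fun a b k => by
    obtain ⟨l, m, hlm, h⟩ := exists_merge_eq b a k
    rw [h, max_comm]
    exact merge_le (by omega)
  exact funext fun k => le_antisymm (h a b k) (h b a k)

theorem isPartition_merge (ha : IsPartition a) (hb : IsPartition b) :
    IsPartition (merge a b) := by
  refine ⟨?_, monotone_nat_of_le_succ fun k => ?_, ?_⟩
  · simp [merge, ha.zero, hb.zero]
  · obtain ⟨l, m, hlm, h⟩ := exists_merge_eq a b (k + 1)
    rw [h]
    rcases Nat.eq_zero_or_pos l with hl | hl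
    · exact (merge_le (l := l) (m := m - 1) (by omega)).trans
        (max_le_max le_rfl (hb.mono (by omega)))
    · exact (merge_le (l := l - 1) (m := m) (by omega)).trans
        (max_le_max (ha.mono (by omega)) le_rfl)
  · obtain ⟨L, hL⟩ := ha.top
    obtain ⟨M, hM⟩ := hb.top
    obtain ⟨l, m, hlm, h⟩ := exists_merge_eq a b (L + M)
    refine ⟨L + M, ?_⟩
    rw [h]
    rcases le_or_gt L l with hl | hl
    · rw [ha.eq_top hL hl]; exact max_eq_left le_top
    · rw [hb.eq_top hM (by omega)]; exact max_eq_right le_top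

theorem refines_merge_left (ha : IsPartition a) (hb : IsPartition b) : Refines (merge a b) a := by
  intro j hj l hl1 hl2
  constructor
  · by_contra hlj
    have h1 : merge a b (j + 1) ≤ a (j + 1) := by
      refine (merge_le (l := j + 1) (m := 0) rfl).trans (max_le le_rfl ?_)
      rw [hb.zero, ← ha.zero]
      exact ha.mono (Nat.zero_le _)
    exact absurd (hj.trans_le h1) (not_lt.2 ((ha.mono (by omega)).trans hl1))
  · obtain ⟨p, q, hpq, h⟩ := exists_merge_eq a b j
    have h1 : merge a b (j + 1) ≤ max (a (p + 1)) (b q) := merge_le (by omega)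
    have h2 : b q ≤ merge a b j := h ▸ le_max_right _ _
    have h3 : a p ≤ merge a b j := h ▸ le_max_left _ _
    have hpl : p ≤ l := by
      by_contra hlt
      exact absurd (h3.trans_lt hl2) (not_lt.2 (ha.mono (by omega)))
    rcases hpl.eq_or_lt with rfl | hpl
    · exact h1.trans (max_le le_rfl (h2.trans hl2.le))
    · exact absurd hj (not_lt.2 (h1.trans (max_le ((ha.mono hpl).trans hl1) h2)))

theorem refines_merge_right (ha : IsPartition a) (hb : IsPartition b) : Refines (merge a b) b :=
  merge_comm b a ▸ refines_merge_left hb ha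

end Merge

/-! ### Random partitions -/

/-- A sequence of random times that forms a partition for every path. -/
structure IsRandomPartition (p : ℕ → PricePath d T → WithTop (Time T)) : Prop where
  time : ∀ k, IsRandomTime (p k)
  partition : ∀ ω, IsPartition fun k => p k ω

/-- The common refinement of two random partitions. -/
def rmerge (p q : ℕ → PricePath d T → WithTop (Time T)) (k : ℕ) (ω : PricePath d T) :
    WithTop (Time T) :=
  merge (fun l => p l ω) (fun m => q m ω) k

theorem IsRandomPartition.rmerge {p q : ℕ → PricePath d T → WithTop (Time T)}
    (hp : IsRandomPartition p) (hq : IsRandomPartition q) : IsRandomPartition (rmerge p q) :=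
  ⟨fun k => IsRandomTime.finset_inf (Finset.range (k + 1))
    (f := fun l ω => max (p l ω) (q (k - l) ω)) fun l _ => (hp.time l).max (hq.time (k - l)),
    fun ω => isPartition_merge (hp.partition ω) (hq.partition ω)⟩

theorem KnownAt.finset_sum {E ι : Type*} [AddCommMonoid E] [MeasurableSpace E] [MeasurableAdd₂ E]
    {τ : PricePath d T → WithTop (Time T)} (s : Finset ι) {f : ι → PricePath d T → E}
    (hf : ∀ i ∈ s, KnownAt τ (f i)) : KnownAt τ fun ω => ∑ i ∈ s, f i ω :=
  ⟨Finset.measurable_fun_sum s fun i hi => (hf i hi).measurable,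
    fun ω ω' h => Finset.sum_congr rfl fun i hi => (hf i hi).nonant ω ω' h⟩

open Classical in
/-- The step process with value `g l` on the `l`th interval of `p`, read off on the `j`th interval
of a refinement `r` of `p`. -/
def locate {E : Type*} [AddCommMonoid E] (p : ℕ → PricePath d T → WithTop (Time T))
    (g : ℕ → PricePath d T → E) (r : ℕ → PricePath d T → WithTop (Time T)) (j : ℕ)
    (ω : PricePath d T) : E :=
  ∑ l ∈ Finset.range (j + 1), if p l ω ≤ r j ω ∧ r j ω < p (l + 1) ω then g l ω else 0

section Locate

variable {E : Type*} {p r : ℕ → PricePath d T → WithTop (Time T)}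

theorem locate_eq [AddCommMonoid E] (hp : IsRandomPartition p) (g : ℕ → PricePath d T → E) {j l : ℕ}
    {ω : PricePath d T} (hlj : l ≤ j) (h1 : p l ω ≤ r j ω) (h2 : r j ω < p (l + 1) ω) :
    locate p g r j ω = g l ω := by
  rw [locate, Finset.sum_eq_single l]
  · rw [if_pos ⟨h1, h2⟩]
  · intro k _ hk
    refine if_neg fun h => ?_
    rcases lt_or_gt_of_ne hk with hk | hk
    · exact absurd (h.2.trans_le ((hp.partition ω).mono (show k + 1 ≤ l from hk))) (not_lt.2 h1)
    · exact absurd (h2.trans_le ((hp.partition ω).mono (show l + 1 ≤ k from hk))) (not_lt.2 h.1)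
  · intro h
    exact absurd (Finset.mem_range.2 (Nat.lt_succ_of_le hlj)) h

theorem KnownAt.locate [AddCommMonoid E] [MeasurableSpace E] [MeasurableAdd₂ E]
    (hp : IsRandomPartition p) (hr : IsRandomPartition r) {g : ℕ → PricePath d T → E}
    (hg : ∀ l, KnownAt (p l) (g l)) (j : ℕ) : KnownAt (r j) (locate p g r j) := by
  classical
  refine KnownAt.finset_sum _ fun l _ => ?_
  exact KnownAt.ite_le ((KnownAt.le_le (hp.time l) (hr.time j)).and
    (KnownAt.lt_time (hp.time (l + 1)) (hr.time j))) (fun ω h => h.1) (hg l) 0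

theorem locate_bounded [NormedAddCommGroup E] {g : ℕ → PricePath d T → E}
    (hg : ∀ l, ∃ C : ℝ, ∀ ω, ‖g l ω‖ ≤ C) (j : ℕ) : ∃ C : ℝ, ∀ ω, ‖locate p g r j ω‖ ≤ C := by
  choose C hC using hg
  refine ⟨∑ l ∈ Finset.range (j + 1), |C l|, fun ω => (norm_sum_le _ _).trans
    (Finset.sum_le_sum fun l _ => ?_)⟩
  split_ifs
  · exact (hC l ω).trans (le_abs_self _)
  · simp

end Locate

/-! ### Integral processes of simple strategies -/

/-- The process `X` is the integral process of a simple strategy; the stopping times are normalised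
so as to reach `+∞` on every path. -/
def IsIntegral (X : Time T → PricePath d T → ℝ) : Prop :=
  ∃ (p : ℕ → PricePath d T → WithTop (Time T)) (g : ℕ → PricePath d T → EuclideanSpace ℝ (Fin d)),
    IsRandomPartition p ∧ (∀ l, KnownAt (p l) (g l)) ∧ (∀ l, ∃ C : ℝ, ∀ ω, ‖g l ω‖ ≤ C) ∧
    ∀ t ω, X t ω = stepSum (fun l => p l ω) (fun l s => inner ℝ (g l ω) (ω s)) t

theorem IsIntegral.exists_strategy {X : Time T → PricePath d T → ℝ} (hX : IsIntegral X) :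
    ∃ G : SimpleStrategy d T, ∀ t ω, G.integral t ω = X t ω := by
  obtain ⟨p, g, hp, hg, hC, h⟩ := hX
  refine ⟨⟨p, fun l => isStoppingTime_iff.2 (hp.time l), fun ω => (hp.partition ω).zero,
    fun l ω => (hp.partition ω).mono l.le_succ, fun ω => ?_, g,
    fun l => (measurable_iff_knownAt _).2 (hg l), hC⟩, fun t ω => ?_⟩
  · obtain ⟨L, hL⟩ := (hp.partition ω).top
    refine ⟨max 1 L, le_max_left _ _, fun k hk => ?_⟩
    rw [(hp.partition ω).eq_top hL (le_max_right 1 L),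
      (hp.partition ω).eq_top hL ((le_max_right 1 L).trans hk)]
  · simp only [SimpleStrategy.integral, h, stepSum, inner_sub_right]

/-- The event that the stopping times of `G` stay constant from the index `l` on. It is known at
time `τ_l`. -/
def SimpleStrategy.Ended (G : SimpleStrategy d T) (l : ℕ) (ω : PricePath d T) : Prop :=
  ∀ m, G.τ m ω ≤ G.τ l ω

open Classical in
/-- The stopping times of `G`, replaced by `+∞` as soon as they are known to stay constant. -/
def SimpleStrategy.ntime (G : SimpleStrategy d T) : ℕ → PricePath d T → WithTop (Time T)
  | 0, ω => G.τ 0 ω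
  | l + 1, ω => if G.Ended l ω then ⊤ else G.τ (l + 1) ω

open Classical in
/-- The positions of `G`, closed when the stopping times are known to stay constant. -/
def SimpleStrategy.npos (G : SimpleStrategy d T) (l : ℕ) (ω : PricePath d T) :
    EuclideanSpace ℝ (Fin d) := if G.Ended l ω then 0 else G.g l ω

namespace SimpleStrategy

variable (G : SimpleStrategy d T)

theorem isRandomTime_τ (l : ℕ) : IsRandomTime (G.τ l) := isStoppingTime_iff.1 (G.isStoppingTime l)

theorem monotone_τ (ω : PricePath d T) : Monotone fun l => G.τ l ω :=
  monotone_nat_of_le_succ fun l => G.τ_le_succ l ω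

theorem knownAt_ended (l : ℕ) : KnownAt (G.τ l) (G.Ended l) := by
  refine ⟨?_, fun ω ω' h => ?_⟩
  · have : {ω | G.Ended l ω} = ⋂ m, {ω | G.τ m ω ≤ G.τ l ω} := by ext; simp [Ended]
    exact measurableSet_setOfPred.1 (this ▸ MeasurableSet.iInter fun m =>
      measurableSet_le (G.isRandomTime_τ m).measurable (G.isRandomTime_τ l).measurable)
  · rw [eq_iff_iff]
    refine forall_congr' fun m => ?_
    rw [(G.isRandomTime_τ l).nonant ω ω' h]
    exact (G.isRandomTime_τ m).le_iff h

theorem Ended.succ {G : SimpleStrategy d T} {l : ℕ} {ω : PricePath d T} (h : G.Ended l ω) :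
    G.Ended (l + 1) ω := fun m => (h m).trans (G.τ_le_succ l ω)

theorem τ_le_ntime (l : ℕ) (ω : PricePath d T) : G.τ l ω ≤ G.ntime l ω := by
  cases l with
  | zero => exact le_rfl
  | succ l =>
    rw [ntime]
    split_ifs
    · exact le_top
    · exact le_rfl

theorem isRandomPartition_ntime : IsRandomPartition G.ntime := by
  classical
  refine ⟨fun k => ?_, fun ω => ⟨G.τ_zero ω, monotone_nat_of_le_succ fun k => ?_, ?_⟩⟩
  · cases k with
    | zero => exact G.isRandomTime_τ 0
    | succ l =>
      exact IsRandomTime.ite (IsRandomTime.const ⊤) (G.isRandomTime_τ (l + 1))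
        (G.knownAt_ended l) (fun _ _ => le_top) fun ω _ => G.τ_le_succ l ω
  · have h1 : G.ntime (k + 1) ω = if G.Ended k ω then ⊤ else G.τ (k + 1) ω := rfl
    rw [h1]
    split_ifs with h
    · exact le_top
    · cases k with
      | zero => exact G.τ_le_succ 0 ω
      | succ l =>
        rw [ntime, if_neg fun h' => h h'.succ]
        exact G.τ_le_succ _ ω
  · obtain ⟨L, -, hL⟩ := G.τ_eventually ω
    refine ⟨L + 1, if_pos fun m => ?_⟩
    rcases le_total L m with h | h
    · exact (hL m h).le
    · exact G.monotone_τ ω h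

theorem ntime_eq {l : ℕ} {ω : PricePath d T} (hl : ¬ G.Ended l ω) : G.ntime l ω = G.τ l ω := by
  cases l with
  | zero => rfl
  | succ k => exact if_neg fun h => hl h.succ

theorem integral_eq_stepSum (t : Time T) (ω : PricePath d T) : G.integral t ω =
    stepSum (fun l => G.ntime l ω) (fun l s => inner ℝ (G.npos l ω) (ω s)) t := by
  classical
  simp only [integral, stepSum]
  refine tsum_congr fun l => ?_
  by_cases hl : G.Ended l ω
  · have : G.τ (l + 1) ω = G.τ l ω := le_antisymm (hl _) (G.τ_le_succ l ω)
    simp [npos, hl, this]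
  · have h1 : G.ntime (l + 1) ω = G.τ (l + 1) ω := if_neg hl
    rw [h1, G.ntime_eq hl, npos, if_neg hl, inner_sub_right]

theorem isIntegral_integral : IsIntegral G.integral := by
  classical
  refine ⟨G.ntime, G.npos, G.isRandomPartition_ntime, fun l => ?_, fun l => ?_,
    G.integral_eq_stepSum⟩
  · exact ((G.knownAt_ended l).ite (KnownAt.const 0)
      ((measurable_iff_knownAt _).1 (G.g_measurable l))).mono (G.τ_le_ntime l)
  · obtain ⟨C, hC⟩ := G.g_bounded l
    refine ⟨max C 0, fun ω => ?_⟩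
    rw [npos]
    split_ifs
    · simp
    · exact (hC ω).trans (le_max_left _ _)

end SimpleStrategy

namespace IsIntegral

variable {X Y : Time T → PricePath d T → ℝ}

theorem congr (hX : IsIntegral X) (h : ∀ t ω, Y t ω = X t ω) : IsIntegral Y := by
  have : Y = X := funext₂ h
  rwa [this]

theorem bot (hX : IsIntegral X) (ω : PricePath d T) : X ⊥ ω = 0 := by
  obtain ⟨p, g, hp, -, -, h⟩ := hX
  rw [h, IsPartition.stepSum_bot]

theorem add (hX : IsIntegral X) (hY : IsIntegral Y) : IsIntegral fun t ω => X t ω + Y t ω := by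
  obtain ⟨p, g, hp, hg, hCg, hX⟩ := hX
  obtain ⟨q, f, hq, hf, hCf, hY⟩ := hY
  have hr := hp.rmerge hq
  refine ⟨rmerge p q, fun j ω => locate p g (rmerge p q) j ω + locate q f (rmerge p q) j ω, hr,
    fun j => (KnownAt.locate hp hr hg j).comp₂ (KnownAt.locate hq hr hf j)
      (u := fun x y => x + y) measurable_add, fun j => ?_, fun t ω => ?_⟩
  · obtain ⟨C, hC⟩ := locate_bounded (p := p) (r := rmerge p q) hCg j
    obtain ⟨D, hD⟩ := locate_bounded (p := q) (r := rmerge p q) hCf j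
    exact ⟨C + D, fun ω => (norm_add_le _ _).trans (add_le_add (hC ω) (hD ω))⟩
  · obtain ⟨L, hL⟩ := (hr.partition ω).top
    have hp' := hp.partition ω
    have hq' := hq.partition ω
    simp only [hX, hY]
    rw [stepSum_refine hp' (hr.partition ω) (refines_merge_left hp' hq')
        (F' := fun j s => inner ℝ (locate p g (rmerge p q) j ω) (ω s)) t,
      stepSum_refine hq' (hr.partition ω) (refines_merge_right hp' hq')
        (F' := fun j s => inner ℝ (locate q f (rmerge p q) j ω) (ω s)) t,
      stepSum_eq_sum (hr.partition ω).mono _ (N := L) (by simp [hL]),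
      stepSum_eq_sum (hr.partition ω).mono _ (N := L) (by simp [hL]),
      stepSum_eq_sum (hr.partition ω).mono _ (N := L) (by simp [hL]), ← Finset.sum_add_distrib]
    · refine Finset.sum_congr rfl fun j _ => ?_
      simp only [inner_add_left]
      ring
    · intro j l hlj h1 h2 u v _ _ _
      simp only [locate_eq hq f hlj h1 h2]
    · intro j l hlj h1 h2 u v _ _ _
      simp only [locate_eq hp g hlj h1 h2]

/-- A discretised stochastic integral against an integral process is an integral process. -/
theorem stepSum (hX : IsIntegral X) {q : ℕ → PricePath d T → WithTop (Time T)}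
    (hq : IsRandomPartition q) {ξ : ℕ → PricePath d T → ℝ} (hξ : ∀ k, KnownAt (q k) (ξ k))
    (hb : ∀ k, ∃ C : ℝ, ∀ ω, |ξ k ω| ≤ C) :
    IsIntegral fun t ω => stepSum (fun k => q k ω) (fun k s => ξ k ω * X s ω) t := by
  obtain ⟨p, g, hp, hg, hCg, hX⟩ := hX
  have hr := hp.rmerge hq
  refine ⟨rmerge p q, fun j ω => locate q ξ (rmerge p q) j ω • locate p g (rmerge p q) j ω, hr,
    fun j => (KnownAt.locate hq hr hξ j).comp₂ (KnownAt.locate hp hr hg j)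
      (u := fun x y => x • y) measurable_smul, fun j => ?_, fun t ω => ?_⟩
  · obtain ⟨C, hC⟩ := locate_bounded (p := p) (r := rmerge p q) hCg j
    obtain ⟨D, hD⟩ := locate_bounded (p := q) (r := rmerge p q) (g := ξ) hb j
    refine ⟨D * C, fun ω => ?_⟩
    rw [norm_smul]
    exact mul_le_mul (hD ω) (hC ω) (norm_nonneg _) ((norm_nonneg _).trans (hD ω))
  · have hp' := hp.partition ω
    have hq' := hq.partition ω
    refine stepSum_refine hq' (hr.partition ω) (refines_merge_right hp' hq') t ?_
    intro j k hkj h1 h2 u v hu huv hv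
    have hlt : rmerge p q j ω < ⊤ := h2.trans_le le_top
    obtain ⟨l, hl1, hl2⟩ := hp'.exists_mem hlt
    simp only [locate_eq hq ξ hkj h1 h2]
    rw [real_inner_smul_left, real_inner_smul_left, ← mul_sub, ← mul_sub]
    rcases huv.eq_or_lt with rfl | huv'
    · simp
    · have hj : rmerge p q j ω < rmerge p q (j + 1) ω :=
        (hu.trans_lt (by exact_mod_cast huv')).trans_le hv
      obtain ⟨hlj, hl3⟩ := refines_merge_left hp' hq' j hj l hl1 hl2
      rw [locate_eq hp g hlj hl1 hl2, hX, hX, hp'.stepSum_sub _ (hl1.trans hu) huv (hv.trans hl3)]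

theorem isContAdapted (hX : IsIntegral X) : IsContAdapted X := by
  obtain ⟨p, g, hp, hg, -, hX⟩ := hX
  refine ⟨fun ω => ?_, fun t => ?_, fun t ω ω' h => ?_⟩
  · simp only [hX]
    exact (hp.partition ω).continuous_stepSum fun l => by fun_prop
  · have h1 : ∀ (τ : PricePath d T → WithTop (Time T)), Measurable τ →
        Measurable fun ω : PricePath d T => ω (cap (τ ω) t) := fun τ hτ =>
      (measurable_uncurry_of_continuous_of_measurable
        (u := fun (s : Time T) (ω : PricePath d T) => ω s)
        (fun ω => ω.continuous) measurable_eval).comp ((measurable_cap hτ t).prodMk measurable_id)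
    refine measurable_of_tendsto_metrizable (f := fun (N : ℕ) ω => ∑ l ∈ Finset.range N,
      (inner ℝ (g l ω) (ω (cap (p (l + 1) ω) t)) - inner ℝ (g l ω) (ω (cap (p l ω) t))))
      (fun N => ?_) (tendsto_pi_nhds.2 fun ω => ?_)
    · exact Finset.measurable_fun_sum _ fun l _ =>
        ((hg l).measurable.inner (h1 _ (hp.time _).measurable)).sub
          ((hg l).measurable.inner (h1 _ (hp.time _).measurable))
    · obtain ⟨L, hL⟩ := (hp.partition ω).top
      refine tendsto_const_nhds.congr' ?_
      filter_upwards [eventually_ge_atTop L] with N hN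
      rw [hX, stepSum_eq_sum (hp.partition ω).mono _ (N := N)
        (by simp [(hp.partition ω).eq_top hL hN])]
  · rw [hX, hX]
    refine tsum_congr fun l => ?_
    have hc : ∀ k, cap (p k ω') t = cap (p k ω) t := fun k => by
      have : ((cap (p k ω') t : Time T) : WithTop (Time T)) = (cap (p k ω) t : Time T) := by
        simpa using (hp.time k).min_eq h
      exact_mod_cast this
    have he : ∀ k, ω' (cap (p k ω) t) = ω (cap (p k ω) t) := fun k =>
      (h _ (by exact_mod_cast cap_le _ t)).symm
    simp only [hc, he]
    rcases le_total (p l ω) t with h1 | h1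
    · rw [(hg l).nonant ω ω' (h.mono h1)]
    · rw [cap_eq_right h1, cap_eq_right (h1.trans ((hp.partition ω).mono l.le_succ))]
      simp

end IsIntegral

namespace IsIntegral

variable {X Y : Time T → PricePath d T → ℝ}

/-- The increments of the coordinate process in a fixed direction. -/
theorem inner_const (e : EuclideanSpace ℝ (Fin d)) :
    IsIntegral fun (t : Time T) (ω : PricePath d T) => inner ℝ e (ω t) - inner ℝ e (ω ⊥) := by
  refine ⟨fun k _ => if k = 0 then ⊥ else ⊤, fun _ _ => e, ⟨fun k => IsRandomTime.const _,
    fun ω => ⟨rfl, monotone_nat_of_le_succ fun k => ?_, 1, rfl⟩⟩, fun _ => KnownAt.const e,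
    fun _ => ⟨‖e‖, fun _ => le_rfl⟩, fun t ω => ?_⟩
  · simp
  · rw [stepSum_eq_sum (N := 1) _ _ (by simp)]
    · simp
    · exact monotone_nat_of_le_succ fun k => by simp

theorem zero : IsIntegral fun (_ : Time T) (_ : PricePath d T) => (0 : ℝ) :=
  (inner_const 0).congr fun t ω => by simp

/-- Holding `ξ` units of an integral process between two stopping times. -/
theorem startStop (hX : IsIntegral X) {σ ρ : PricePath d T → WithTop (Time T)}
    (hσ : IsRandomTime σ) (hρ : IsRandomTime ρ) (hσρ : ∀ ω, σ ω ≤ ρ ω) {ξ : PricePath d T → ℝ}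
    (hξ : KnownAt σ ξ) (hb : ∃ C : ℝ, ∀ ω, |ξ ω| ≤ C) :
    IsIntegral fun t ω => ξ ω * (X (cap (ρ ω) t) ω - X (cap (σ ω) t) ω) := by
  have hm : ∀ ω, Monotone fun k : ℕ => (fun k ω => if k = 0 then ⊥ else if k = 1 then σ ω else
      if k = 2 then ρ ω else ⊤ : ℕ → PricePath d T → WithTop (Time T)) k ω := fun ω => by
    refine monotone_nat_of_le_succ fun k => ?_
    match k with
    | 0 => simp
    | 1 => simpa using hσρ ω
    | 2 => simp
    | k + 3 => simp
  have hq : IsRandomPartition (fun k ω => if k = 0 then ⊥ else if k = 1 then σ ω else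
      if k = 2 then ρ ω else ⊤ : ℕ → PricePath d T → WithTop (Time T)) := by
    refine ⟨fun k => ?_, fun ω => ⟨rfl, hm ω, 3, rfl⟩⟩
    match k with
    | 0 => exact IsRandomTime.const ⊥
    | 1 => exact hσ
    | 2 => exact hρ
    | k + 3 => exact IsRandomTime.const ⊤
  refine (hX.stepSum hq (ξ := fun k ω => if k = 1 then ξ ω else 0) (fun k => ?_)
    fun k => ?_).congr fun t ω => ?_
  · by_cases hk : k = 1
    · subst hk; simpa using hξ
    · simpa [hk] using KnownAt.const (0 : ℝ)
  · obtain ⟨C, hC⟩ := hb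
    by_cases hk : k = 1
    · exact ⟨C, fun ω => by simpa [hk] using hC ω⟩
    · exact ⟨0, fun ω => by simp [hk]⟩
  · rw [stepSum_eq_sum (N := 3) (hm ω) _ (by simp)]
    simp [mul_sub]

theorem const_mul (hX : IsIntegral X) (c : ℝ) : IsIntegral fun t ω => c * X t ω :=
  (hX.startStop (IsRandomTime.const ⊥) (IsRandomTime.const ⊤) (fun _ => bot_le) (KnownAt.const c)
    ⟨|c|, fun _ => le_rfl⟩).congr fun t ω => by simp [hX.bot]

theorem stopped (hX : IsIntegral X) {ρ : PricePath d T → WithTop (Time T)} (hρ : IsRandomTime ρ) :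
    IsIntegral fun t ω => X (cap (ρ ω) t) ω :=
  (hX.startStop (IsRandomTime.const ⊥) hρ (fun _ => bot_le) (KnownAt.const 1)
    ⟨1, fun _ => by simp⟩).congr fun t ω => by simp [hX.bot]

theorem sub (hX : IsIntegral X) (hY : IsIntegral Y) : IsIntegral fun t ω => X t ω - Y t ω :=
  (hX.add (hY.const_mul (-1))).congr fun t ω => by ring

theorem sum {ι : Type*} (s : Finset ι) {Z : ι → Time T → PricePath d T → ℝ}
    (hZ : ∀ i ∈ s, IsIntegral (Z i)) : IsIntegral fun t ω => ∑ i ∈ s, Z i t ω := by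
  classical
  induction s using Finset.induction_on with
  | empty => simpa using zero
  | insert a s ha ih =>
    simp only [Finset.sum_insert ha]
    exact (hZ a (by simp)).add (ih fun i hi => hZ i (by simp [hi]))

end IsIntegral

/-! ### Continuous adapted processes and hitting times -/

namespace IsContAdapted

variable {X Y : Time T → PricePath d T → ℝ}

theorem coord (i : Fin d) : IsContAdapted fun (t : Time T) (ω : PricePath d T) => ω t i :=
  ⟨fun ω => by fun_prop, fun t => (by fun_prop : Measurable fun x : EuclideanSpace ℝ (Fin d) =>
    x i).comp (measurable_eval t), fun t ω ω' h => by rw [h t le_rfl]⟩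

theorem add (hX : IsContAdapted X) (hY : IsContAdapted Y) :
    IsContAdapted fun t ω => X t ω + Y t ω :=
  ⟨fun ω => (hX.cont ω).add (hY.cont ω), fun t => (hX.measurable t).add (hY.measurable t),
    fun t ω ω' h => by rw [hX.nonant t ω ω' h, hY.nonant t ω ω' h]⟩

theorem sub (hX : IsContAdapted X) (hY : IsContAdapted Y) :
    IsContAdapted fun t ω => X t ω - Y t ω :=
  ⟨fun ω => (hX.cont ω).sub (hY.cont ω), fun t => (hX.measurable t).sub (hY.measurable t),
    fun t ω ω' h => by rw [hX.nonant t ω ω' h, hY.nonant t ω ω' h]⟩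

theorem abs (hX : IsContAdapted X) : IsContAdapted fun t ω => |X t ω| :=
  ⟨fun ω => (hX.cont ω).abs, fun t => (hX.measurable t).norm,
    fun t ω ω' h => by rw [hX.nonant t ω ω' h]⟩

theorem stopped (hX : IsContAdapted X) {σ : PricePath d T → WithTop (Time T)}
    (hσ : IsRandomTime σ) : IsContAdapted fun t ω => X (cap (σ ω) t) ω := by
  refine ⟨fun ω => (hX.cont ω).comp (continuous_cap _),
    fun t => hX.measurable_comp (measurable_cap hσ.measurable t), fun t ω ω' h => ?_⟩
  have hc : cap (σ ω') t = cap (σ ω) t := by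
    have : ((cap (σ ω') t : Time T) : WithTop (Time T)) = (cap (σ ω) t : Time T) := by
      simpa using hσ.min_eq h
    exact_mod_cast this
  rw [hc]
  exact hX.nonant _ ω ω' (h.mono (by exact_mod_cast cap_le _ t))

/-- The value of an adapted process at a random time, the terminal value if the time is infinite. -/
theorem knownAt (hX : IsContAdapted X) {σ : PricePath d T → WithTop (Time T)}
    (hσ : IsRandomTime σ) : KnownAt σ fun ω => X (cap (σ ω) ⊤) ω := by
  refine ⟨hX.measurable_comp (measurable_cap hσ.measurable ⊤), fun ω ω' h => ?_⟩
  rw [hσ.nonant ω ω' h]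
  exact hX.nonant _ ω ω' (h.mono (by simp))

end IsContAdapted

/-- The first time at which the process `X` is at least `c`. -/
def hit (X : Time T → PricePath d T → ℝ) (c : ℝ) (ω : PricePath d T) : WithTop (Time T) :=
  sInf {t : WithTop (Time T) | ∃ r : Time T, t = r ∧ c ≤ X r ω}

section Hit

variable {X : Time T → PricePath d T → ℝ} {c : ℝ} {ω : PricePath d T}

theorem hit_le {r : Time T} (h : c ≤ X r ω) : hit X c ω ≤ r := sInf_le ⟨r, rfl, h⟩

theorem le_of_hit_eq (hX : Continuous fun t => X t ω) {r : Time T}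
    (h : hit X c ω = r) : c ≤ X r ω := by
  have hcl : IsClosed {s : Time T | c ≤ X s ω} := isClosed_le continuous_const hX
  have hne : {s : Time T | c ≤ X s ω}.Nonempty := by
    by_contra hne
    have : hit X c ω = ⊤ := by
      rw [hit, sInf_eq_top]
      rintro _ ⟨s, rfl, hs⟩
      exact absurd ⟨s, hs⟩ hne
    rw [this] at h
    exact WithTop.top_ne_coe h
  have h1 := hcl.isCompact.sInf_mem hne
  have h2 : (r : WithTop (Time T)) ≤ (sInf {s : Time T | c ≤ X s ω} : Time T) := h ▸ hit_le h1
  have h3 : ((sInf {s : Time T | c ≤ X s ω} : Time T) : WithTop (Time T)) ≤ r := by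
    rw [← h]
    refine le_sInf ?_
    rintro _ ⟨s, rfl, hs⟩
    exact_mod_cast sInf_le (α := Time T) hs
  have : r = sInf {s : Time T | c ≤ X s ω} := by exact_mod_cast le_antisymm h2 h3
  rw [this]
  exact h1

/-- A continuous process starting below `c` stays at most `c` until it hits `c`. -/
theorem le_of_le_hit (hX : Continuous fun t => X t ω) (h0 : X ⊥ ω ≤ c) {r : Time T}
    (h : r ≤ hit X c ω) : X r ω ≤ c := by
  by_contra hr
  rw [not_le] at hr
  obtain ⟨s, hs, hsc⟩ := intermediate_value_Icc (bot_le : (⊥ : Time T) ≤ r) hX.continuousOn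
    (⟨h0, hr.le⟩ : c ∈ Set.Icc (X ⊥ ω) (X r ω))
  have hsr : s < r := lt_of_le_of_ne hs.2 fun h' => by
    subst h'
    exact hr.ne hsc.symm
  have : (r : WithTop (Time T)) ≤ s := h.trans (hit_le hsc.ge)
  exact absurd hsr (not_lt.2 (by exact_mod_cast this))

theorem eq_of_hit_eq (hX : Continuous fun t => X t ω) (h0 : X ⊥ ω ≤ c) {r : Time T}
    (h : hit X c ω = r) : X r ω = c :=
  le_antisymm (le_of_le_hit hX h0 h.ge) (le_of_hit_eq hX h)

theorem hit_le_iff (hX : Continuous fun t => X t ω) {t : Time T} :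
    hit X c ω ≤ t ↔ ∃ s, s ≤ t ∧ c ≤ X s ω := by
  constructor
  · intro h
    obtain ⟨r, hr⟩ := WithTop.ne_top_iff_exists.1 (h.trans_lt (WithTop.coe_lt_top t)).ne
    refine ⟨r, ?_, le_of_hit_eq hX hr.symm⟩
    rw [← hr] at h
    exact_mod_cast h
  · rintro ⟨s, hst, hs⟩
    exact (hit_le hs).trans (by exact_mod_cast hst)

theorem hit_eq_top_or (ω : PricePath d T) : hit X c ω = ⊤ ∨ ∃ r : Time T, hit X c ω = r := by
  rcases h : hit X c ω with _ | r
  · exact Or.inl rfl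
  · exact Or.inr ⟨r, rfl⟩

theorem isRandomTime_hit (hX : IsContAdapted X) (c : ℝ) : IsRandomTime (hit X c) := by
  have hm : ∀ t : Time T, MeasurableSet {ω | hit X c ω ≤ t} := fun t => by
    have : {ω | hit X c ω ≤ t} = ⋂ n : ℕ, ⋃ q : ℕ,
        {ω | c - 1 / ((n : ℝ) + 1) < X (min (TopologicalSpace.denseSeq (Time T) q) t) ω} := by
      ext ω
      simp only [Set.mem_ofPred_eq, Set.mem_iInter, Set.mem_iUnion, hit_le_iff (hX.cont ω)]
      constructor
      · rintro ⟨s, hst, hs⟩ n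
        have hopen : IsOpen {u : Time T | c - 1 / ((n : ℝ) + 1) < X (min u t) ω} :=
          isOpen_lt continuous_const ((hX.cont ω).comp (continuous_id.min continuous_const))
        have hne : {u : Time T | c - 1 / ((n : ℝ) + 1) < X (min u t) ω}.Nonempty := by
          refine ⟨s, ?_⟩
          have : (0 : ℝ) < 1 / ((n : ℝ) + 1) := by positivity
          simp only [Set.mem_ofPred_eq, min_eq_left hst]
          linarith
        obtain ⟨q, hq⟩ := (TopologicalSpace.denseRange_denseSeq (Time T)).exists_mem_open hopen hne
        exact ⟨q, hq⟩
      · intro h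
        have hcomp : IsCompact (Set.Iic t) := isClosed_Iic.isCompact
        obtain ⟨s, hs, hmax⟩ := hcomp.exists_isMaxOn ⟨t, le_refl t⟩ (hX.cont ω).continuousOn
        refine ⟨s, hs, le_of_forall_pos_lt_add fun ε hε => ?_⟩
        obtain ⟨n, hn⟩ := exists_nat_one_div_lt hε
        obtain ⟨q, hq⟩ := h n
        have := hmax (Set.mem_Iic.2
          (min_le_right (TopologicalSpace.denseSeq (Time T) q) t))
        simp only [Set.mem_ofPred_eq] at this
        linarith
    rw [this]
    exact MeasurableSet.iInter fun n => MeasurableSet.iUnion fun q =>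
      measurableSet_lt measurable_const (hX.measurable _)
  refine ⟨measurable_of_Iic fun x => ?_, ?_⟩
  · induction x with
    | top => simp
    | coe t => exact hm t
  · have key : ∀ (t : Time T) (ω ω' : PricePath d T), AgreeUpTo (t : WithTop (Time T)) ω ω' →
        hit X c ω ≤ t → hit X c ω' ≤ t := fun t ω ω' h ht => by
      rw [hit_le_iff (hX.cont _)] at ht ⊢
      obtain ⟨s, hst, hs⟩ := ht
      exact ⟨s, hst, by rwa [hX.nonant s ω ω' (h.mono (by exact_mod_cast hst))]⟩
    intro ω ω' h
    rcases hτ : hit X c ω with _ | t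
    · rw [hτ] at h
      rw [← h.eq_of_top, hτ]
    · rw [hτ] at h
      have h1 := key t ω ω' h hτ.le
      refine le_antisymm h1 (not_lt.1 fun h2 => ?_)
      obtain ⟨s, hs⟩ := WithTop.ne_top_iff_exists.1 (h1.trans_lt (WithTop.coe_lt_top t)).ne
      have h3 := key s ω' ω (h.symm.mono (hs ▸ h2.le)) hs.ge
      rw [hτ, hs] at h3
      exact absurd h3 (not_le.2 h2)

end Hit

/-! ### Null sets of the outer measure -/

theorem coe_le_liminf_iff {a : ℝ} {u : ℕ → ℝ} :
    (a : EReal) ≤ liminf (fun n => (u n : EReal)) atTop ↔ ∀ b < a, ∀ᶠ n in atTop, b < u n := by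
  constructor
  · intro h b hb
    have h1 : (b : EReal) < liminf (fun n => (u n : EReal)) atTop :=
      lt_of_lt_of_le (by exact_mod_cast hb) h
    filter_upwards [eventually_lt_of_lt_liminf h1] with n hn
    exact_mod_cast hn
  · intro h
    refine le_of_forall_lt fun c hc => ?_
    obtain ⟨b, hcb, hba⟩ := EReal.lt_iff_exists_real_btwn.1 hc
    refine hcb.trans_le (le_liminf_of_le (by isBoundedDefault) ?_)
    filter_upwards [h b (by exact_mod_cast hba)] with n hn
    exact_mod_cast hn.le

theorem vovkMeasure_eq_zero {A : Set (PricePath d T)} (h : ∀ ε : ℝ, 0 < ε →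
    ∃ K : ℕ → Time T → PricePath d T → ℝ, (∀ n, IsIntegral (K n)) ∧ (∀ n t ω, -ε ≤ K n t ω) ∧
      ∀ ω ∈ A, ∀ b < 1, ∀ᶠ n in atTop, b < ε + K n ⊤ ω) : vovkMeasure A = 0 := by
  refine le_antisymm (ENNReal.le_of_forall_pos_le_add fun ε hε _ => ?_) bot_le
  obtain ⟨K, hK, hadm, hlim⟩ := h ε (by exact_mod_cast hε)
  choose G hG using fun n => (hK n).exists_strategy
  rw [zero_add]
  refine (iInf₂_le_of_le (ε : ℝ) (by exact_mod_cast hε) (iInf_le_of_le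
    ⟨G, fun n t ω => by rw [hG]; exact hadm n t ω, fun ω => ?_⟩ le_rfl)).trans (by simp)
  by_cases hω : ω ∈ A
  · rw [Set.indicator_of_mem hω]
    refine (coe_le_liminf_iff (a := 1)).2 fun b hb => ?_
    filter_upwards [hlim ω hω b hb] with n hn
    rwa [hG]
  · rw [Set.indicator_of_notMem hω]
    refine (coe_le_liminf_iff (a := 0)).2 fun b hb => ?_
    refine Eventually.of_forall fun n => ?_
    rw [hG]
    have := hadm n ⊤ ω
    linarith

theorem exists_of_vovkMeasure_eq_zero {A : Set (PricePath d T)} (h : vovkMeasure A = 0) {ε : ℝ}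
    (hε : 0 < ε) : ∃ K : ℕ → Time T → PricePath d T → ℝ, (∀ n, IsIntegral (K n)) ∧
      (∀ n t ω, -ε ≤ K n t ω) ∧ ∀ ω ∈ A, ∀ b < 1, ∀ᶠ n in atTop, b < ε + K n ⊤ ω := by
  have h1 : vovkMeasure A < ENNReal.ofReal ε := by rw [h]; exact ENNReal.ofReal_pos.2 hε
  simp only [vovkMeasure, iInf_lt_iff] at h1
  obtain ⟨lam, hlam, ⟨H, hadm, hlim⟩, hlt⟩ := h1
  have hlt : lam < ε := (ENNReal.ofReal_lt_ofReal_iff hε).1 hlt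
  refine ⟨fun n => (H n).integral, fun n => (H n).isIntegral_integral, fun n t ω => ?_,
    fun ω hω b hb => ?_⟩
  · have := hadm n t ω
    linarith
  · have h2 := hlim ω
    rw [Set.indicator_of_mem hω] at h2
    filter_upwards [(coe_le_liminf_iff (a := 1)).1 h2 b hb] with n hn
    linarith

theorem vovkMeasure_mono_null {A B : Set (PricePath d T)} (hAB : A ⊆ B) (hB : vovkMeasure B = 0) :
    vovkMeasure A = 0 := by
  refine vovkMeasure_eq_zero fun ε hε => ?_
  obtain ⟨K, hK, hadm, hlim⟩ := exists_of_vovkMeasure_eq_zero hB hε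
  exact ⟨K, hK, hadm, fun ω hω => hlim ω (hAB hω)⟩

theorem sum_div_two_pow_le {ε : ℝ} (hε : 0 ≤ ε) (n : ℕ) :
    ∑ i ∈ Finset.range n, ε / 2 ^ (i + 1) ≤ ε := by
  have h : ∑ i ∈ Finset.range n, ε / 2 ^ (i + 1) = ε - ε / 2 ^ n := by
    induction n with
    | zero => simp
    | succ n ih => rw [Finset.sum_range_succ, ih, pow_succ]; field_simp; ring
  rw [h]
  have : 0 ≤ ε / 2 ^ n := by positivity
  linarith

theorem vovkMeasure_iUnion_null {A : ℕ → Set (PricePath d T)} (hA : ∀ i, vovkMeasure (A i) = 0) :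
    vovkMeasure (⋃ i, A i) = 0 := by
  refine vovkMeasure_eq_zero fun ε hε => ?_
  have hε' : ∀ i : ℕ, 0 < ε / 2 ^ (i + 1) := fun i => by positivity
  choose K hK hadm hlim using fun i => exists_of_vovkMeasure_eq_zero (hA i) (hε' i)
  refine ⟨fun n t ω => ∑ i ∈ Finset.range n, K i n t ω,
    fun n => IsIntegral.sum _ fun i _ => hK i n, fun n t ω => ?_, fun ω hω b hb => ?_⟩
  · have h1 : ∑ i ∈ Finset.range n, -(ε / 2 ^ (i + 1)) ≤ ∑ i ∈ Finset.range n, K i n t ω :=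
      Finset.sum_le_sum fun i _ => hadm i n t ω
    rw [Finset.sum_neg_distrib] at h1
    have := sum_div_two_pow_le hε.le n
    linarith
  · obtain ⟨i, hi⟩ := Set.mem_iUnion.1 hω
    filter_upwards [hlim i ω hi b hb, eventually_gt_atTop i] with n hn hin
    have h1 : ε / 2 ^ (i + 1) + K i n ⊤ ω ≤
        ∑ j ∈ Finset.range n, (ε / 2 ^ (j + 1) + K j n ⊤ ω) :=
      Finset.single_le_sum (f := fun j => ε / 2 ^ (j + 1) + K j n ⊤ ω)
        (fun j _ => by have := hadm j n ⊤ ω; linarith) (Finset.mem_range.2 hin)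
    rw [Finset.sum_add_distrib] at h1
    have := sum_div_two_pow_le hε.le n
    linarith

theorem vovkMeasure_iUnion_null' {ι : Type*} [Countable ι] {A : ι → Set (PricePath d T)}
    (hA : ∀ i, vovkMeasure (A i) = 0) : vovkMeasure (⋃ i, A i) = 0 := by
  rcases isEmpty_or_nonempty ι with h | h
  · obtain ⟨B, hB⟩ : ∃ B : ℕ → Set (PricePath d T), B = fun _ => ∅ := ⟨_, rfl⟩
    refine vovkMeasure_eq_zero fun ε hε => ⟨fun _ _ _ => 0, fun _ => IsIntegral.zero,
      fun _ _ _ => by linarith, fun ω hω => ?_⟩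
    simp at hω
  · obtain ⟨f, hf⟩ := exists_surjective_nat ι
    rw [← hf.iUnion_comp]
    exact vovkMeasure_iUnion_null fun n => hA (f n)

theorem vovkMeasure_union_null {A B : Set (PricePath d T)} (hA : vovkMeasure A = 0)
    (hB : vovkMeasure B = 0) : vovkMeasure (A ∪ B) = 0 := by
  rw [Set.union_eq_iUnion]
  exact vovkMeasure_iUnion_null' fun b => by cases b <;> assumption

/-- It suffices to reach the level `1` at some time, since the strategies can be stopped there. -/
theorem vovkMeasure_eq_zero_of_hit {A : Set (PricePath d T)} (h : ∀ ε : ℝ, 0 < ε →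
    ∃ V : ℕ → Time T → PricePath d T → ℝ, (∀ m, IsIntegral (V m)) ∧ (∀ m t ω, -ε ≤ V m t ω) ∧
      ∀ ω ∈ A, ∀ᶠ m in atTop, ∃ t, 1 ≤ ε + V m t ω) : vovkMeasure A = 0 := by
  refine vovkMeasure_eq_zero fun ε hε => ?_
  obtain ⟨V, hV, hadm, hhit⟩ := h ε hε
  refine ⟨fun m t ω => V m (cap (hit (V m) (1 - ε) ω) t) ω,
    fun m => (hV m).stopped (isRandomTime_hit (hV m).isContAdapted _), fun m t ω => hadm m _ ω,
    fun ω hω b hb => ?_⟩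
  filter_upwards [hhit ω hω] with m hm
  obtain ⟨t, ht⟩ := hm
  have h1 : hit (V m) (1 - ε) ω ≤ t := hit_le (by linarith)
  obtain ⟨r, hr⟩ := WithTop.ne_top_iff_exists.1 (h1.trans_lt (WithTop.coe_lt_top t)).ne
  have h2 := le_of_hit_eq ((hV m).isContAdapted.cont ω) hr.symm
  rw [← hr, cap_coe, min_eq_left le_top]
  linarith

/-! ### Quadratic variation along a partition -/

/-- The sum of the products of the increments of `x` and `y` along a partition, up to time `t`. -/
def covSum (a : ℕ → WithTop (Time T)) (x y : Time T → ℝ) (t : Time T) : ℝ :=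
  ∑' k : ℕ, (x (cap (a (k + 1)) t) - x (cap (a k) t)) * (y (cap (a (k + 1)) t) - y (cap (a k) t))

theorem covSum_eq_sum {a : ℕ → WithTop (Time T)} (ha : Monotone a) (x y : Time T → ℝ)
    {t : Time T} {N : ℕ} (hN : (t : WithTop (Time T)) ≤ a N) :
    covSum a x y t = ∑ k ∈ Finset.range N, (x (cap (a (k + 1)) t) - x (cap (a k) t)) *
      (y (cap (a (k + 1)) t) - y (cap (a k) t)) := by
  refine tsum_eq_sum fun l hl => ?_
  have hl : N ≤ l := by simpa using hl
  rw [cap_eq_right (hN.trans (ha hl)), cap_eq_right (hN.trans (ha (hl.trans l.le_succ))), sub_self,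
    zero_mul]

theorem cap_cap_top (r : WithTop (Time T)) {t : Time T} (h : r ≤ t) : cap r ⊤ = cap r t :=
  (cap_eq_cap h le_top).symm

theorem stepSum_mul_eq_sum {a : ℕ → WithTop (Time T)} (ha : Monotone a) (x y : Time T → ℝ)
    {t : Time T} {N : ℕ} (hN : (t : WithTop (Time T)) ≤ a N) :
    stepSum a (fun k s => y (cap (a k) ⊤) * x s) t =
      ∑ k ∈ Finset.range N, y (cap (a k) t) * (x (cap (a (k + 1)) t) - x (cap (a k) t)) := by
  rw [stepSum_eq_sum ha _ hN]
  refine Finset.sum_congr rfl fun k _ => ?_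
  rcases le_total (a k) t with h | h
  · rw [cap_cap_top _ h, mul_sub]
  · rw [cap_eq_right h, cap_eq_right (h.trans (ha k.le_succ))]
    simp

/-- Discrete integration by parts. -/
theorem IsPartition.sq_eq {a : ℕ → WithTop (Time T)} (ha : IsPartition a) (x : Time T → ℝ)
    (h0 : x ⊥ = 0) (t : Time T) :
    x t ^ 2 = 2 * stepSum a (fun k s => x (cap (a k) ⊤) * x s) t + covSum a x x t := by
  obtain ⟨L, hL⟩ := ha.top
  rw [stepSum_mul_eq_sum ha.mono x x (N := L) (by simp [hL]),
    covSum_eq_sum ha.mono x x (N := L) (by simp [hL]), Finset.mul_sum, ← Finset.sum_add_distrib]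
  have h : ∀ k ∈ Finset.range L, 2 * (x (cap (a k) t) * (x (cap (a (k + 1)) t) - x (cap (a k) t))) +
      (x (cap (a (k + 1)) t) - x (cap (a k) t)) * (x (cap (a (k + 1)) t) - x (cap (a k) t)) =
      x (cap (a (k + 1)) t) ^ 2 - x (cap (a k) t) ^ 2 := fun k _ => by ring
  rw [Finset.sum_congr rfl h, Finset.sum_range_sub (fun k => x (cap (a k) t) ^ 2), hL, ha.zero]
  simp [h0]

/-- The discretisation `∑_k X_{p_k} (X_{p_{k+1} ∧ t} - X_{p_k ∧ t})` of the Itô integral of `X`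
against itself. -/
def selfIntegral (p : ℕ → PricePath d T → WithTop (Time T)) (X : Time T → PricePath d T → ℝ)
    (t : Time T) (ω : PricePath d T) : ℝ :=
  stepSum (fun k => p k ω) (fun k s => X (cap (p k ω) ⊤) ω * X s ω) t

theorem isIntegral_selfIntegral {p : ℕ → PricePath d T → WithTop (Time T)}
    {X : Time T → PricePath d T → ℝ} (hX : IsIntegral X) (hp : IsRandomPartition p)
    (hb : ∀ k, ∃ C : ℝ, ∀ ω, |X (cap (p k ω) ⊤) ω| ≤ C) : IsIntegral (selfIntegral p X) :=
  hX.stepSum hp (fun k => hX.isContAdapted.knownAt (hp.time k)) hb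

/-- The oscillation of `X` on the intervals of the random partition `p`, measured from the left
end, is at most `δ`. -/
def IsFine (p : ℕ → PricePath d T → WithTop (Time T)) (X : Time T → PricePath d T → ℝ) (δ : ℝ) :
    Prop :=
  ∀ ω k (t : Time T), p k ω ≤ t → (t : WithTop (Time T)) ≤ p (k + 1) ω →
    |X t ω - X (cap (p k ω) ⊤) ω| ≤ δ

/-- Two approximations of the Itô integral of `X` against itself differ by an integral process
whose square is dominated by a small constant plus an integral process. -/
theorem exists_integral_sq_le {X : Time T → PricePath d T → ℝ} (hX : IsIntegral X) {m : ℝ}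
    (hm : ∀ t ω, |X t ω| ≤ m) {p q : ℕ → PricePath d T → WithTop (Time T)}
    (hp : IsRandomPartition p) (hq : IsRandomPartition q) {δ : ℝ} (hpδ : IsFine p X δ)
    (hqδ : IsFine q X δ) : ∃ N : Time T → PricePath d T → ℝ, IsIntegral N ∧
      ∀ t ω, (selfIntegral p X t ω - selfIntegral q X t ω) ^ 2 ≤ N t ω + 4 * δ ^ 2 * m ^ 2 := by
  have hr := hp.rmerge hq
  set r := rmerge p q with hrdef
  have hIp := isIntegral_selfIntegral hX hp fun k => ⟨m, fun ω => hm _ ω⟩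
  have hIq := isIntegral_selfIntegral hX hq fun k => ⟨m, fun ω => hm _ ω⟩
  have hIr := isIntegral_selfIntegral hX hr fun k => ⟨m, fun ω => hm _ ω⟩
  obtain ⟨K, hKdef⟩ : ∃ K : Time T → PricePath d T → ℝ,
      K = fun t ω => selfIntegral p X t ω - selfIntegral q X t ω := ⟨_, rfl⟩
  have hK : IsIntegral K := hKdef ▸ hIp.sub hIq
  have hinc : ∀ t ω j, |K (cap (r (j + 1) ω) t) ω - K (cap (r j ω) t) ω| ≤
      2 * δ * |X (cap (r (j + 1) ω) t) ω - X (cap (r j ω) t) ω| := by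
    intro t ω j
    have hrω := hr.partition ω
    rcases (hrω.mono j.le_succ).eq_or_lt with h1 | h1
    · rw [Nat.succ_eq_add_one] at h1
      simp [h1]
    rcases le_or_gt (t : WithTop (Time T)) (r j ω) with h2 | h2
    · rw [cap_eq_right h2, cap_eq_right (h2.trans h1.le)]
      simp
    obtain ⟨k, hk1, hk2⟩ := (hp.partition ω).exists_mem (h2.trans_le le_top)
    obtain ⟨l, hl1, hl2⟩ := (hq.partition ω).exists_mem (h2.trans_le le_top)
    have hk3 := (refines_merge_left (hp.partition ω) (hq.partition ω) j h1 k hk1 hk2).2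
    have hl3 := (refines_merge_right (hp.partition ω) (hq.partition ω) j h1 l hl1 hl2).2
    have hs : ((cap (r j ω) t : Time T) : WithTop (Time T)) = r j ω := coe_cap_eq_left h2.le
    have hv : ((cap (r (j + 1) ω) t : Time T) : WithTop (Time T)) ≤ r (j + 1) ω := by simp
    have hsv := cap_mono h1.le t
    set s := cap (r j ω) t
    set v := cap (r (j + 1) ω) t
    have e1 := (hp.partition ω).stepSum_sub (fun k s => X (cap (p k ω) ⊤) ω * X s ω)
      (l := k) (hs ▸ hk1 : p k ω ≤ (s : WithTop (Time T))) hsv (hv.trans hk3)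
    have e2 := (hq.partition ω).stepSum_sub (fun k s => X (cap (q k ω) ⊤) ω * X s ω)
      (l := l) (hs ▸ hl1 : q l ω ≤ (s : WithTop (Time T))) hsv (hv.trans hl3)
    have e3 : K v ω - K s ω =
        (X (cap (p k ω) ⊤) ω - X (cap (q l ω) ⊤) ω) * (X v ω - X s ω) := by
      simp only [hKdef, selfIntegral]
      linear_combination e1 - e2
    rw [e3, abs_mul]
    refine mul_le_mul_of_nonneg_right ?_ (abs_nonneg _)
    have o1 := hpδ ω k s (hs ▸ hk1) (hs ▸ hk2.le)
    have o2 := hqδ ω l s (hs ▸ hl1) (hs ▸ hl2.le)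
    rw [abs_le] at o1 o2 ⊢
    constructor <;> linarith [o1.1, o1.2, o2.1, o2.2]
  have hδ : 0 ≤ δ := (abs_nonneg _).trans (hpδ 0 0 ⊥ ((hp.partition 0).zero.le)
    (by rw [← (hp.partition 0).zero]; exact (hp.partition 0).mono (Nat.zero_le _)))
  have hKb : ∀ k, ∃ C : ℝ, ∀ ω, |K (cap (r k ω) ⊤) ω| ≤ C := by
    intro k
    induction k with
    | zero =>
      refine ⟨0, fun ω => ?_⟩
      have : r 0 ω = ⊥ := (hr.partition ω).zero
      rw [this, cap_bot, hK.bot]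
      simp
    | succ k ih =>
      obtain ⟨C, hC⟩ := ih
      refine ⟨C + 2 * δ * (m + m), fun ω => ?_⟩
      have h1 := hinc ⊤ ω k
      have h2 : |X (cap (r (k + 1) ω) ⊤) ω - X (cap (r k ω) ⊤) ω| ≤ m + m :=
        (abs_sub _ _).trans (add_le_add (hm _ _) (hm _ _))
      have h3 := h1.trans (mul_le_mul_of_nonneg_left h2 (by positivity : (0 : ℝ) ≤ 2 * δ))
      have h4 := abs_sub_abs_le_abs_sub (K (cap (r (k + 1) ω) ⊤) ω) (K (cap (r k ω) ⊤) ω)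
      linarith [hC ω]
  refine ⟨fun t ω => 2 * selfIntegral r K t ω - 8 * δ ^ 2 * selfIntegral r X t ω,
    ((isIntegral_selfIntegral hK hr hKb).const_mul 2).sub (hIr.const_mul _), fun t ω => ?_⟩
  have hrω := hr.partition ω
  have eK := hrω.sq_eq (fun s => K s ω) (hK.bot ω) t
  have eX := hrω.sq_eq (fun s => X s ω) (hX.bot ω) t
  have hcov : covSum (fun k => r k ω) (fun s => K s ω) (fun s => K s ω) t ≤
      4 * δ ^ 2 * covSum (fun k => r k ω) (fun s => X s ω) (fun s => X s ω) t := by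
    obtain ⟨L, hL⟩ := hrω.top
    rw [covSum_eq_sum hrω.mono _ _ (N := L) (by simp [hL]),
      covSum_eq_sum hrω.mono _ _ (N := L) (by simp [hL]), Finset.mul_sum]
    refine Finset.sum_le_sum fun j _ => ?_
    have h1 := mul_self_le_mul_self (abs_nonneg _) (hinc t ω j)
    rw [abs_mul_abs_self, mul_mul_mul_comm, abs_mul_abs_self] at h1
    linarith
  have hX2 : X t ω ^ 2 ≤ m ^ 2 := sq_le_sq' (abs_le.1 (hm t ω)).1 (abs_le.1 (hm t ω)).2
  have h3 : 4 * δ ^ 2 * X t ω ^ 2 ≤ 4 * δ ^ 2 * m ^ 2 :=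
    mul_le_mul_of_nonneg_left hX2 (by positivity)
  have hKt : K t ω = selfIntegral p X t ω - selfIntegral q X t ω := by rw [hKdef]
  rw [← hKt]
  change K t ω ^ 2 = 2 * selfIntegral r K t ω + _ at eK
  change X t ω ^ 2 = 2 * selfIntegral r X t ω + _ at eX
  nlinarith

/-- Along two sequences of partitions of mesh `O(2^{-n})` the approximations of the Itô integral
of a bounded integral process against itself differ, for typical paths, by `O(2^{-n/2})`: the sums
`∑_n 2^n (K^n)^2` of the squared differences are dominated by integral processes with a
small initial capital. -/
theorem vovkMeasure_selfIntegral_sub {X : Time T → PricePath d T → ℝ} (hX : IsIntegral X) {m : ℝ}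
    (hm0 : 0 < m) (hm : ∀ t ω, |X t ω| ≤ m) {p q : ℕ → ℕ → PricePath d T → WithTop (Time T)}
    (hp : ∀ n, IsRandomPartition (p n)) (hq : ∀ n, IsRandomPartition (q n)) {c : ℝ} (hc : 0 < c)
    (hpδ : ∀ n, IsFine (p n) X (c / 2 ^ n)) (hqδ : ∀ n, IsFine (q n) X (c / 2 ^ n)) :
    vovkMeasure {ω | ∃ t, ∀ C : ℝ, ∃ n : ℕ,
      C < 2 ^ n * (selfIntegral (p n) X t ω - selfIntegral (q n) X t ω) ^ 2} = 0 := by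
  refine vovkMeasure_eq_zero_of_hit fun ε hε => ?_
  choose N hN hle using fun n => exists_integral_sq_le hX hm (hp n) (hq n) (hpδ n) (hqδ n)
  obtain ⟨w, hw⟩ : ∃ w : ℕ → ℝ, w = fun n => ε / (8 * c ^ 2 * m ^ 2) * 2 ^ n := ⟨_, rfl⟩
  have hw0 : ∀ n, 0 ≤ w n := fun n => by rw [hw]; positivity
  -- the weights are chosen so that the constants add up to the initial capital
  have hwc : ∀ n, w n * (4 * (c / 2 ^ n) ^ 2 * m ^ 2) = ε / 2 ^ (n + 1) := fun n => by
    rw [hw]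
    field_simp
    ring
  have key : ∀ M t ω, ∑ n ∈ Finset.range M,
      w n * (selfIntegral (p n) X t ω - selfIntegral (q n) X t ω) ^ 2 ≤
      ε + ∑ n ∈ Finset.range M, w n * N n t ω := fun M t ω => by
    have h1 : ∑ n ∈ Finset.range M,
        w n * (selfIntegral (p n) X t ω - selfIntegral (q n) X t ω) ^ 2 ≤
        ∑ n ∈ Finset.range M, (w n * N n t ω + ε / 2 ^ (n + 1)) :=
      Finset.sum_le_sum fun n _ => by
        rw [← hwc, ← mul_add]
        exact mul_le_mul_of_nonneg_left (hle n t ω) (hw0 n)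
    rw [Finset.sum_add_distrib] at h1
    linarith [sum_div_two_pow_le hε.le M]
  refine ⟨fun M t ω => ∑ n ∈ Finset.range M, w n * N n t ω,
    fun M => IsIntegral.sum _ fun n _ => (hN n).const_mul _, fun M t ω => ?_, fun ω hω => ?_⟩
  · have h1 : 0 ≤ ∑ n ∈ Finset.range M,
        w n * (selfIntegral (p n) X t ω - selfIntegral (q n) X t ω) ^ 2 :=
      Finset.sum_nonneg fun n _ => mul_nonneg (hw0 n) (sq_nonneg _)
    linarith [key M t ω]
  · obtain ⟨t, ht⟩ := hω
    obtain ⟨n, hn⟩ := ht (8 * c ^ 2 * m ^ 2 / ε)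
    filter_upwards [eventually_gt_atTop n] with M hM
    refine ⟨t, le_trans ?_ (key M t ω)⟩
    have h1 := Finset.single_le_sum (f := fun n =>
      w n * (selfIntegral (p n) X t ω - selfIntegral (q n) X t ω) ^ 2)
      (fun n _ => mul_nonneg (hw0 n) (sq_nonneg _)) (Finset.mem_range.2 hM)
    refine le_trans ?_ h1
    simp only [hw]
    rw [mul_assoc, ← div_le_iff₀' (by positivity), one_div_div]
    exact hn.le

/-- For an integral process, the quadratic variations along two sequences of partitions of mesh
`O(2^{-n})` differ, for typical paths, by `O(2^{-n/2})`. -/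
theorem vovkMeasure_covSum_sub {X : Time T → PricePath d T → ℝ} (hX : IsIntegral X)
    {p q : ℕ → ℕ → PricePath d T → WithTop (Time T)}
    (hp : ∀ n, IsRandomPartition (p n)) (hq : ∀ n, IsRandomPartition (q n)) {c : ℝ} (hc : 0 < c)
    (hpδ : ∀ n, IsFine (p n) X (c / 2 ^ n)) (hqδ : ∀ n, IsFine (q n) X (c / 2 ^ n)) :
    vovkMeasure {ω | ∃ t, ∀ C : ℝ, ∃ n : ℕ,
      C < 2 ^ n * (covSum (fun k => p n k ω) (fun s => X s ω) (fun s => X s ω) t -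
        covSum (fun k => q n k ω) (fun s => X s ω) (fun s => X s ω) t) ^ 2} = 0 := by
  have hσ : ∀ m : ℕ, IsRandomTime (hit (fun t ω => |X t ω|) ((m : ℝ) + 1)) := fun m =>
    isRandomTime_hit hX.isContAdapted.abs _
  obtain ⟨Y, hYdef⟩ : ∃ Y : ℕ → Time T → PricePath d T → ℝ, Y = fun (m : ℕ) t ω =>
    X (cap (hit (fun t ω => |X t ω|) ((m : ℝ) + 1) ω) t) ω := ⟨_, rfl⟩
  have hY : ∀ m, IsIntegral (Y m) := fun m => hYdef ▸ hX.stopped (hσ m)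
  have hYm : ∀ m t ω, |Y m t ω| ≤ (m : ℝ) + 1 := fun m t ω => by
    simp only [hYdef]
    exact le_of_le_hit (X := fun t ω => |X t ω|) (hX.isContAdapted.abs.cont ω)
      (by rw [hX.bot, abs_zero]; positivity) (by simp)
  have hYδ : ∀ {p : ℕ → PricePath d T → WithTop (Time T)} (_ : IsRandomPartition p) {δ : ℝ}
      (_ : IsFine p X δ) (m : ℕ), IsFine p (Y m) δ := by
    intro p hp δ h m ω k t hk ht
    have hδ := (abs_nonneg _).trans (h ω k t hk ht)
    simp only [hYdef]
    set σ := hit (fun t ω => |X t ω|) ((m : ℝ) + 1) ω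
    rcases le_total σ (p k ω) with h1 | h1
    · have h2 : cap σ (cap (p k ω) ⊤) = cap σ t := by
        rw [cap_cap, min_eq_left h1, cap_cap_top _ (h1.trans hk)]
      simpa [h2] using hδ
    · have h2 : cap σ (cap (p k ω) ⊤) = cap (p k ω) ⊤ := by
        rw [cap_cap, min_eq_right h1]
      rw [h2]
      refine h ω k _ ?_ ?_
      · rw [coe_cap]; exact le_min h1 hk
      · rw [coe_cap]; exact (min_le_right _ _).trans ht
  refine vovkMeasure_mono_null ?_ (vovkMeasure_iUnion_null fun m =>
    vovkMeasure_selfIntegral_sub (hY m) (m := (m : ℝ) + 1) (by positivity) (hYm m) hp hq hc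
      (fun n => hYδ (hp n) (hpδ n) m) (fun n => hYδ (hq n) (hqδ n) m))
  rintro ω ⟨t, ht⟩
  obtain ⟨B, hB⟩ := isCompact_univ.exists_bound_of_continuousOn
    (hX.isContAdapted.cont ω).continuousOn
  obtain ⟨m, hmB⟩ := exists_nat_ge B
  have hYX : ∀ s, Y m s ω = X s ω := fun s => by
    have : hit (fun t ω => |X t ω|) ((m : ℝ) + 1) ω = ⊤ := by
      rcases hit_eq_top_or (X := fun t ω => |X t ω|) (c := (m : ℝ) + 1) ω with h | ⟨r, hr⟩
      · exact h
      · have h1 := le_of_hit_eq (X := fun t ω => |X t ω|) (hX.isContAdapted.abs.cont ω) hr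
        have h2 : |X r ω| ≤ B := hB r (Set.mem_univ _)
        linarith
    simp only [hYdef, this, cap_top]
  refine Set.mem_iUnion.2 ⟨m, t, fun C => ?_⟩
  obtain ⟨n, hn⟩ := ht (4 * C)
  refine ⟨n, ?_⟩
  have e1 := ((hp n).partition ω).sq_eq (fun s => X s ω) (hX.bot ω) t
  have e2 := ((hq n).partition ω).sq_eq (fun s => X s ω) (hX.bot ω) t
  simp only [selfIntegral, hYX]
  have e3 : covSum (fun k => p n k ω) (fun s => X s ω) (fun s => X s ω) t -
        covSum (fun k => q n k ω) (fun s => X s ω) (fun s => X s ω) t =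
      -2 * (stepSum (fun k => p n k ω) (fun k s => X (cap (p n k ω) ⊤) ω * X s ω) t -
        stepSum (fun k => q n k ω) (fun k s => X (cap (q n k ω) ⊤) ω * X s ω) t) := by
    linear_combination e2 - e1
  rw [e3] at hn
  linarith

/-! ### Lebesgue partitions -/

section Lebesgue

variable {X : Time T → PricePath d T → ℝ}

theorem lebesgueTime_succ_eq_hit (hX : IsContAdapted X) (n k : ℕ) (ω : PricePath d T) :
    lebesgueTime n (fun t => X t ω) (k + 1) =
      hit (fun t ω => |X t ω - X (cap (lebesgueTime n (fun t => X t ω) k) t) ω|) (2 ^ n : ℝ)⁻¹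
        ω := by
  have hpos : (0 : ℝ) < (2 ^ n : ℝ)⁻¹ := by positivity
  rw [lebesgueTime]
  generalize hL : lebesgueTime n (fun t => X t ω) k = L
  have hcont : Continuous fun t => |X t ω - X (cap L t) ω| :=
    ((hX.cont ω).sub ((hX.cont ω).comp (continuous_cap L))).abs
  apply le_antisymm
  · rcases hit_eq_top_or (X := fun t ω => |X t ω - X (cap (lebesgueTime n (fun t => X t ω) k) t) ω|)
      (c := (2 ^ n : ℝ)⁻¹) ω with h | ⟨r, hr⟩
    · rw [h]; exact le_top
    · rw [hr]
      have h0 : X ⊥ ω - X (cap L ⊥) ω = 0 := by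
        rw [le_bot_iff.1 (cap_le L ⊥), sub_self]
      have h1 := eq_of_hit_eq (X := fun t ω => |X t ω -
        X (cap (lebesgueTime n (fun t => X t ω) k) t) ω|) (by simpa only [hL] using hcont)
        (by simp only [hL, h0, abs_zero]; exact hpos.le) hr
      simp only [hL] at h1
      have h2 : L ≤ r := not_lt.1 fun h => by
        rw [cap_eq_right h.le, sub_self, abs_zero] at h1
        exact hpos.ne h1
      obtain ⟨s, hs⟩ := WithTop.ne_top_iff_exists.1 (h2.trans_lt (WithTop.coe_lt_top r)).ne
      refine sInf_le ⟨s, r, hs.symm, rfl, ?_, ?_⟩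
      · rw [← hs] at h2
        exact_mod_cast h2
      · rw [← hs] at h1 h2
        rwa [cap_coe, min_eq_left (by exact_mod_cast h2)] at h1
  · refine le_sInf ?_
    rintro _ ⟨s, r, hs, rfl, hsr, hr⟩
    refine hit_le ?_
    simp only [hL, hs, cap_coe, min_eq_left hsr]
    exact hr.ge

theorem isRandomTime_lebesgueTime (hX : IsContAdapted X) (n k : ℕ) :
    IsRandomTime fun ω => lebesgueTime n (fun t => X t ω) k := by
  induction k with
  | zero => exact IsRandomTime.const _
  | succ k ih =>
    have : (fun ω => lebesgueTime n (fun t => X t ω) (k + 1)) = hit (fun t ω =>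
        |X t ω - X (cap (lebesgueTime n (fun t => X t ω) k) t) ω|) (2 ^ n : ℝ)⁻¹ :=
      funext fun ω => lebesgueTime_succ_eq_hit hX n k ω
    rw [this]
    exact isRandomTime_hit (hX.sub (hX.stopped ih)).abs _

theorem lebesgueTime_le_succ (n k : ℕ) (x : Time T → ℝ) :
    lebesgueTime n x k ≤ lebesgueTime n x (k + 1) := by
  rw [lebesgueTime]
  refine le_sInf ?_
  rintro _ ⟨s, r, hs, rfl, hsr, -⟩
  rw [hs]
  exact_mod_cast hsr

theorem exists_lebesgueTime_eq_top (hX : IsContAdapted X) (n : ℕ) (ω : PricePath d T) :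
    ∃ L, lebesgueTime n (fun t => X t ω) L = ⊤ := by
  by_contra hne
  push Not at hne
  choose s hs using fun k => WithTop.ne_top_iff_exists.1 (hne k)
  have hmono : Monotone s := monotone_nat_of_le_succ fun k => by
    have := lebesgueTime_le_succ n k (fun t => X t ω)
    rw [← hs, ← hs] at this
    exact_mod_cast this
  have hlim : Tendsto (fun k => X (s k) ω) atTop (𝓝 (X (⨆ k, s k) ω)) :=
    ((hX.cont ω).tendsto _).comp (tendsto_atTop_iSup hmono)
  have h1 : Tendsto (fun k => |X (s (k + 1)) ω - X (s k) ω|) atTop (𝓝 0) := by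
    have := ((hlim.comp (tendsto_add_atTop_nat 1)).sub hlim).abs
    simpa using this
  have h2 : ∀ k, |X (s (k + 1)) ω - X (s k) ω| = (2 ^ n : ℝ)⁻¹ := fun k => by
    have h3 := lebesgueTime_succ_eq_hit hX n k ω
    rw [← hs (k + 1)] at h3
    have h4 := eq_of_hit_eq (X := fun t ω => |X t ω -
      X (cap (lebesgueTime n (fun t => X t ω) k) t) ω|)
      (((hX.cont ω).sub ((hX.cont ω).comp (continuous_cap _))).abs)
      (by rw [le_bot_iff.1 (cap_le _ ⊥), sub_self, abs_zero]; positivity) h3.symm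
    simp only [← hs k, cap_coe] at h4
    rwa [min_eq_left (hmono k.le_succ)] at h4
  simp only [h2] at h1
  have := tendsto_nhds_unique h1 tendsto_const_nhds
  have h5 : (0 : ℝ) < (2 ^ n : ℝ)⁻¹ := by positivity
  exact h5.ne this

theorem isRandomPartition_lebesgueTime (hX : IsContAdapted X) (n : ℕ) :
    IsRandomPartition fun k ω => lebesgueTime n (fun t => X t ω) k :=
  ⟨isRandomTime_lebesgueTime hX n, fun ω => ⟨rfl,
    monotone_nat_of_le_succ fun k => lebesgueTime_le_succ n k _,
    exists_lebesgueTime_eq_top hX n ω⟩⟩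

theorem isFine_lebesgueTime (hX : IsContAdapted X) (n : ℕ) :
    IsFine (fun k ω => lebesgueTime n (fun t => X t ω) k) X (2 ^ n : ℝ)⁻¹ := by
  intro ω k t hk ht
  simp only [lebesgueTime_succ_eq_hit hX] at ht
  have := le_of_le_hit (X := fun t ω => |X t ω -
      X (cap (lebesgueTime n (fun t => X t ω) k) t) ω|)
      (((hX.cont ω).sub ((hX.cont ω).comp (continuous_cap _))).abs)
      (by rw [le_bot_iff.1 (cap_le _ ⊥), sub_self, abs_zero]; positivity) ht
  rwa [← cap_cap_top _ hk] at this

end Lebesgue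

/-- Refining a partition at most doubles the oscillation measured from the left end points. -/
theorem IsFine.refine {p r : ℕ → PricePath d T → WithTop (Time T)} {X : Time T → PricePath d T → ℝ}
    {δ : ℝ} (hX : IsFine p X δ) (hp : IsRandomPartition p)
    (h : ∀ ω j, r j ω < r (j + 1) ω → ∀ l, p l ω ≤ r j ω → r j ω < p (l + 1) ω →
      r (j + 1) ω ≤ p (l + 1) ω) : IsFine r X (2 * δ) := by
  intro ω j t hj ht
  obtain ⟨l, hl1, hl2⟩ := (hp.partition ω).exists_mem (hj.trans_lt (WithTop.coe_lt_top t))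
  obtain ⟨s, hs⟩ := WithTop.ne_top_iff_exists.1 (hj.trans_lt (WithTop.coe_lt_top t)).ne
  have hc : cap (r j ω) ⊤ = s := by rw [← hs, cap_coe, min_eq_left le_top]
  rw [hc]
  rw [← hs] at hj hl1 hl2
  have hst : s ≤ t := by exact_mod_cast hj
  have o1 := hX ω l s hl1 hl2.le
  rcases hst.eq_or_lt with rfl | hlt
  · rw [sub_self, abs_zero]
    linarith [abs_nonneg (X s ω - X (cap (p l ω) ⊤) ω)]
  · have h1 : r j ω < r (j + 1) ω :=
      lt_of_lt_of_le (by rw [← hs]; exact_mod_cast hlt) ht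
    have h2 := h ω j h1 l (hs ▸ hl1) (hs ▸ hl2)
    have o2 := hX ω l t (hl1.trans hj) (ht.trans h2)
    rw [abs_le] at o1 o2 ⊢
    constructor <;> linarith [o1.1, o1.2, o2.1, o2.2]

/-- The index set of the directions that generate the partitions: the coordinates and the sums of
two different coordinates. -/
abbrev Dir (d : ℕ) : Type := Fin d ⊕ {ij : Fin d × Fin d // ij.1 ≠ ij.2}

/-- The direction with a given index. -/
def dirVec : Dir d → EuclideanSpace ℝ (Fin d)
  | Sum.inl i => EuclideanSpace.single i 1
  | Sum.inr ij => EuclideanSpace.single ij.1.1 1 + EuclideanSpace.single ij.1.2 1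

/-- The component of the price path in a given direction. -/
def dirProc (e : Dir d) (t : Time T) (ω : PricePath d T) : ℝ := inner ℝ (dirVec e) (ω t)

theorem dirProc_inl (i : Fin d) (t : Time T) (ω : PricePath d T) :
    dirProc (Sum.inl i) t ω = ω t i := by
  simp [dirProc, dirVec, EuclideanSpace.inner_single_left]

theorem dirProc_inr (ij : {ij : Fin d × Fin d // ij.1 ≠ ij.2}) (t : Time T) (ω : PricePath d T) :
    dirProc (Sum.inr ij) t ω = ω t ij.1.1 + ω t ij.1.2 := by
  simp [dirProc, dirVec, inner_add_left, EuclideanSpace.inner_single_left]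

theorem isContAdapted_dirProc (e : Dir d) : IsContAdapted (dirProc (T := T) e) := by
  rcases e with i | ij
  · have : dirProc (T := T) (Sum.inl i) = fun t ω => ω t i := funext₂ (dirProc_inl i)
    rw [this]
    exact IsContAdapted.coord i
  · have : dirProc (T := T) (Sum.inr ij) = fun t ω => ω t ij.1.1 + ω t ij.1.2 :=
      funext₂ (dirProc_inr ij)
    rw [this]
    exact (IsContAdapted.coord _).add (IsContAdapted.coord _)

theorem mem_partitionPoints {n : ℕ} {ω : PricePath d T} {t : WithTop (Time T)} :
    t ∈ partitionPoints n ω ↔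
      ∃ em : Dir d × ℕ, lebesgueTime n (fun t => dirProc em.1 t ω) em.2 = t := by
  simp only [partitionPoints, Set.mem_union, Set.mem_iUnion, Set.mem_range, Prod.exists,
    Sum.exists, dirProc_inl, dirProc_inr, Subtype.exists, exists_prop]

theorem finite_partitionPoints (n : ℕ) (ω : PricePath d T) : (partitionPoints n ω).Finite := by
  have h1 : partitionPoints n ω =
      ⋃ e : Dir d, Set.range (lebesgueTime n fun t => dirProc e t ω) := by
    ext t
    simp [mem_partitionPoints]
  rw [h1]
  refine Set.finite_iUnion fun e => ?_
  have hp := (isRandomPartition_lebesgueTime (isContAdapted_dirProc (T := T) e) n).partition ω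
  obtain ⟨L, hL⟩ := hp.top
  refine ((Set.finite_Iic L).image (lebesgueTime n fun t => dirProc e t ω)).subset ?_
  rintro _ ⟨m, rfl⟩
  rcases le_total m L with h | h
  · exact ⟨m, h, rfl⟩
  · exact ⟨L, le_refl L, hL.trans (hp.eq_top hL h).symm⟩

theorem partitionTime_succ (n k : ℕ) (ω : PricePath d T) : partitionTime n ω (k + 1) =
    sInf {t : WithTop (Time T) | partitionTime n ω k < t ∧ t ∈ partitionPoints n ω} := rfl

theorem partitionTime_succ_mem (n k : ℕ) (ω : PricePath d T) : partitionTime n ω (k + 1) = ⊤ ∨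
    partitionTime n ω k < partitionTime n ω (k + 1) ∧
      partitionTime n ω (k + 1) ∈ partitionPoints n ω := by
  rw [partitionTime_succ]
  rcases Set.eq_empty_or_nonempty
    {t : WithTop (Time T) | partitionTime n ω k < t ∧ t ∈ partitionPoints n ω} with h | h
  · rw [h, sInf_empty]
    exact Or.inl rfl
  · exact Or.inr (h.csInf_mem ((finite_partitionPoints n ω).subset fun t ht => ht.2))

/-- The infimum of countably many random times is a random time if it is attained. -/
theorem IsRandomTime.iInf {ι : Type*} [Countable ι] {τ : ι → PricePath d T → WithTop (Time T)}
    (hτ : ∀ i, IsRandomTime (τ i))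
    (hatt : ∀ ω, (⨅ i, τ i ω) = ⊤ ∨ ∃ i, τ i ω = ⨅ i, τ i ω) :
    IsRandomTime fun ω => ⨅ i, τ i ω := by
  refine ⟨Measurable.iInf fun i => (hτ i).measurable, fun ω ω' h => ?_⟩
  rcases hatt ω with h1 | ⟨i, hi⟩
  · rw [h1] at h
    rw [h.eq_of_top]
  · refine le_antisymm ?_ (not_lt.1 fun hlt => ?_)
    · rw [← hi, ← (hτ i).nonant ω ω' (hi ▸ h)]
      exact iInf_le _ i
    · obtain ⟨j, hj⟩ := iInf_lt_iff.1 hlt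
      have := ((hτ j).lt_iff' h).1 hj
      exact absurd (iInf_le (fun i => τ i ω) j) (not_le.2 this)

theorem partitionTime_succ_eq_iInf (n k : ℕ) (ω : PricePath d T) : partitionTime n ω (k + 1) =
    ⨅ em : Dir d × ℕ, if partitionTime n ω k < lebesgueTime n (fun t => dirProc em.1 t ω) em.2
      then lebesgueTime n (fun t => dirProc em.1 t ω) em.2 else ⊤ := by
  rw [partitionTime_succ]
  apply le_antisymm
  · refine le_iInf fun em => ?_
    split_ifs with h
    · exact sInf_le ⟨h, mem_partitionPoints.2 ⟨em, rfl⟩⟩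
    · exact le_top
  · refine le_sInf ?_
    rintro t ⟨h1, h2⟩
    obtain ⟨em, rfl⟩ := mem_partitionPoints.1 h2
    refine iInf_le_of_le em ?_
    rw [if_pos h1]

theorem isRandomTime_partitionTime (n k : ℕ) :
    IsRandomTime fun ω : PricePath d T => partitionTime n ω k := by
  induction k with
  | zero => exact IsRandomTime.const _
  | succ k ih =>
    simp only [partitionTime_succ_eq_iInf]
    refine IsRandomTime.iInf (fun em => ?_) fun ω => ?_
    · have h1 := isRandomTime_lebesgueTime (isContAdapted_dirProc (T := T) em.1) n em.2
      exact IsRandomTime.ite h1 (IsRandomTime.const ⊤) (KnownAt.lt_time h1 ih)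
        (fun ω h => h.le) fun ω _ => le_top
    · rw [← partitionTime_succ_eq_iInf]
      refine (partitionTime_succ_mem n k ω).imp id ?_
      rintro ⟨h1, h2⟩
      obtain ⟨em, hem⟩ := mem_partitionPoints.1 h2
      exact ⟨em, by rw [hem, if_pos h1]⟩

theorem isRandomPartition_partitionTime (n : ℕ) :
    IsRandomPartition fun k (ω : PricePath d T) => partitionTime n ω k := by
  refine ⟨isRandomTime_partitionTime n, fun ω => ⟨rfl, monotone_nat_of_le_succ fun k => ?_, ?_⟩⟩
  · exact le_sInf fun t ht => ht.1.le
  · by_contra hne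
    push Not at hne
    have h1 := fun k => (partitionTime_succ_mem n k ω).resolve_left (hne (k + 1))
    have hmono : StrictMono (partitionTime n ω) := strictMono_nat_of_lt_succ fun k => (h1 k).1
    exact Set.infinite_of_injective_forall_mem
      (hmono.injective.comp (add_left_injective 1)) (fun k => (h1 k).2) (finite_partitionPoints n ω)

theorem isFine_partitionTime (n : ℕ) (e : Dir d) :
    IsFine (fun k (ω : PricePath d T) => partitionTime n ω k) (dirProc e) (2 * (2 ^ n : ℝ)⁻¹) := by
  refine (isFine_lebesgueTime (isContAdapted_dirProc e) n).refine
    (isRandomPartition_lebesgueTime (isContAdapted_dirProc e) n)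
    fun ω j hj l hl1 hl2 => ?_
  exact sInf_le ⟨hl2, mem_partitionPoints.2 ⟨(e, l + 1), rfl⟩⟩

/-! ### Existence of the quadratic covariation for typical paths -/

theorem covSum_polarization {a : ℕ → WithTop (Time T)} (ha : IsPartition a) (x y : Time T → ℝ)
    (t : Time T) : covSum a x y t = (covSum a (fun s => x s + y s) (fun s => x s + y s) t -
      covSum a x x t - covSum a y y t) / 2 := by
  obtain ⟨L, hL⟩ := ha.top
  simp only [covSum_eq_sum ha.mono _ _ (N := L) (show (t : WithTop (Time T)) ≤ a L by simp [hL])]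
  rw [← Finset.sum_sub_distrib, ← Finset.sum_sub_distrib, Finset.sum_div]
  exact Finset.sum_congr rfl fun k _ => by ring

/-- The quadratic variations of all generating directions converge fast along the Lebesgue
partitions, and have the same limits along the partitions `p n`. -/
def IsTypical (p : ℕ → ℕ → PricePath d T → WithTop (Time T)) (ω : PricePath d T) : Prop :=
  ∀ e : Dir d,
    (∀ t, ∃ C : ℝ, ∀ n : ℕ, 2 ^ n *
      (covSum (partitionTime n ω) (fun s => dirProc e s ω) (fun s => dirProc e s ω) t -
        covSum (partitionTime (n + 1) ω) (fun s => dirProc e s ω) (fun s => dirProc e s ω) t) ^ 2 ≤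
        C) ∧
    ∀ t, ∃ C : ℝ, ∀ n : ℕ, 2 ^ n *
      (covSum (fun k => p n k ω) (fun s => dirProc e s ω) (fun s => dirProc e s ω) t -
        covSum (partitionTime n ω) (fun s => dirProc e s ω) (fun s => dirProc e s ω) t) ^ 2 ≤ C

theorem IsFine.mono {p : ℕ → PricePath d T → WithTop (Time T)} {X : Time T → PricePath d T → ℝ}
    {δ δ' : ℝ} (h : IsFine p X δ) (hδ : δ ≤ δ') : IsFine p X δ' :=
  fun ω k t h1 h2 => (h ω k t h1 h2).trans hδ

theorem vovkMeasure_not_isTypical {p : ℕ → ℕ → PricePath d T → WithTop (Time T)}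
    (hp : ∀ n, IsRandomPartition (p n))
    (hfine : ∀ n (e : Dir d), IsFine (p n) (dirProc e) (4 * (2 ^ n : ℝ)⁻¹)) :
    vovkMeasure {ω | ¬ IsTypical p ω} = 0 := by
  have key : ∀ (e : Dir d) {p q : ℕ → ℕ → PricePath d T → WithTop (Time T)}
      (_ : ∀ n, IsRandomPartition (p n)) (_ : ∀ n, IsRandomPartition (q n))
      (_ : ∀ n, IsFine (p n) (dirProc e) (4 * (2 ^ n : ℝ)⁻¹))
      (_ : ∀ n, IsFine (q n) (dirProc e) (4 * (2 ^ n : ℝ)⁻¹)),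
      vovkMeasure {ω | ¬ ∀ t, ∃ C : ℝ, ∀ n : ℕ, 2 ^ n *
        (covSum (fun k => p n k ω) (fun s => dirProc e s ω) (fun s => dirProc e s ω) t -
          covSum (fun k => q n k ω) (fun s => dirProc e s ω) (fun s => dirProc e s ω) t) ^ 2 ≤
          C} = 0 := by
    intro e p q hp hq hpf hqf
    have hX := IsIntegral.inner_const (T := T) (dirVec e)
    have hf : ∀ {r : ℕ → PricePath d T → WithTop (Time T)} {n : ℕ},
        IsFine r (dirProc e) (4 * (2 ^ n : ℝ)⁻¹) →
        IsFine r (fun t ω => inner ℝ (dirVec e) (ω t) - inner ℝ (dirVec e) (ω ⊥))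
          (4 / 2 ^ n) := fun h ω k t h1 h2 => by
      rw [sub_sub_sub_cancel_right, div_eq_mul_inv]
      exact h ω k t h1 h2
    refine vovkMeasure_mono_null ?_ (vovkMeasure_covSum_sub hX hp hq (c := 4) (by norm_num)
      (fun n => hf (hpf n)) fun n => hf (hqf n))
    intro ω hω
    simp only [Set.mem_ofPred_eq, not_forall, not_exists, not_le] at hω ⊢
    simpa only [covSum, sub_sub_sub_cancel_right, dirProc] using hω
  have hπ : ∀ n (e : Dir d), IsFine (fun k (ω : PricePath d T) => partitionTime n ω k) (dirProc e)
      (4 * (2 ^ n : ℝ)⁻¹) := fun n e => (isFine_partitionTime n e).mono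
    (mul_le_mul_of_nonneg_right (by norm_num) (by positivity))
  refine vovkMeasure_mono_null ?_ (vovkMeasure_iUnion_null' fun e : Dir d => vovkMeasure_union_null
    (key e (p := fun n k ω => partitionTime n ω k) (q := fun n k ω => partitionTime (n + 1) ω k)
      isRandomPartition_partitionTime (fun n => isRandomPartition_partitionTime (n + 1))
      (fun n => hπ n e) fun n => (hπ (n + 1) e).mono ?_)
    (key e hp (q := fun n k ω => partitionTime n ω k) isRandomPartition_partitionTime
      (fun n => hfine n e) fun n => hπ n e))
  · intro ω hω
    by_contra h
    simp only [Set.mem_iUnion, Set.mem_union, Set.mem_ofPred_eq, not_exists, not_or, not_not] at h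
    exact hω fun e => h e
  · rw [pow_succ, mul_inv]
    have : (0 : ℝ) < (2 ^ n : ℝ)⁻¹ := by positivity
    linarith

theorem abs_le_of_two_pow_mul_sq_le {C x : ℝ} {n : ℕ} (h : 2 ^ n * x ^ 2 ≤ C) :
    |x| ≤ √C * √(1 / 2) ^ n := by
  have h1 : x ^ 2 ≤ C * (1 / 2) ^ n := by
    rw [one_div, inv_pow, ← div_eq_mul_inv, le_div_iff₀ (by positivity)]
    linarith
  have hC : 0 ≤ C := le_trans (by positivity) h
  refine Real.abs_le_sqrt h1 |>.trans_eq ?_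
  rw [Real.sqrt_mul hC, Real.sqrt_eq_rpow ((1 / 2 : ℝ) ^ n), Real.sqrt_eq_rpow (1 / 2 : ℝ),
    ← Real.rpow_natCast, ← Real.rpow_natCast, ← Real.rpow_mul (by norm_num),
    ← Real.rpow_mul (by norm_num), mul_comm (n : ℝ)]

theorem sqrt_half_lt_one : √(1 / 2 : ℝ) < 1 := by
  rw [Real.sqrt_lt' one_pos]; norm_num

theorem IsTypical.exists_tendsto {p : ℕ → ℕ → PricePath d T → WithTop (Time T)} {ω : PricePath d T}
    (h : IsTypical p ω) (e : Dir d) (t : Time T) : ∃ L : ℝ,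
      Tendsto (fun n => covSum (partitionTime n ω) (fun s => dirProc e s ω)
        (fun s => dirProc e s ω) t) atTop (𝓝 L) ∧
      Tendsto (fun n => covSum (fun k => p n k ω) (fun s => dirProc e s ω)
        (fun s => dirProc e s ω) t) atTop (𝓝 L) := by
  obtain ⟨C, hC⟩ := (h e).1 t
  obtain ⟨D, hD⟩ := (h e).2 t
  have h1 : CauchySeq fun n => covSum (partitionTime n ω) (fun s => dirProc e s ω)
        (fun s => dirProc e s ω) t :=
    cauchySeq_of_le_geometric (√(1 / 2)) (√C) sqrt_half_lt_one fun n => by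
      rw [Real.dist_eq]
      exact abs_le_of_two_pow_mul_sq_le (hC n)
  obtain ⟨L, hL⟩ := cauchySeq_tendsto_of_complete h1
  refine ⟨L, hL, ?_⟩
  have h2 : Tendsto (fun n => covSum (fun k => p n k ω) (fun s => dirProc e s ω)
        (fun s => dirProc e s ω) t - covSum (partitionTime n ω) (fun s => dirProc e s ω)
        (fun s => dirProc e s ω) t) atTop (𝓝 0) := by
    refine squeeze_zero_norm (fun n => abs_le_of_two_pow_mul_sq_le (hD n)) ?_
    simpa using (tendsto_pow_atTop_nhds_zero_of_lt_one (Real.sqrt_nonneg _)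
      sqrt_half_lt_one).const_mul (√D)
  simpa using h2.add hL

theorem IsTypical.exists_tendsto' {p : ℕ → ℕ → PricePath d T → WithTop (Time T)}
    (hp : ∀ n, IsRandomPartition (p n)) {ω : PricePath d T}
    (h : IsTypical p ω) (i j : Fin d) (t : Time T) : ∃ L : ℝ,
      Tendsto (fun n => covSum (partitionTime n ω) (fun s => ω s i) (fun s => ω s j) t)
        atTop (𝓝 L) ∧
      Tendsto (fun n => covSum (fun k => p n k ω) (fun s => ω s i) (fun s => ω s j) t)
        atTop (𝓝 L) := by
  obtain ⟨L₁, h1, h1'⟩ := h.exists_tendsto (Sum.inl i) t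
  obtain ⟨L₂, h2, h2'⟩ := h.exists_tendsto (Sum.inl j) t
  simp only [dirProc_inl] at h1 h1' h2 h2'
  by_cases hij : i = j
  · subst hij
    exact ⟨L₁, h1, h1'⟩
  · obtain ⟨L₃, h3, h3'⟩ := h.exists_tendsto (Sum.inr ⟨(i, j), hij⟩) t
    simp only [dirProc_inr] at h3 h3'
    refine ⟨(L₃ - L₁ - L₂) / 2, ?_, ?_⟩
    · exact (((h3.sub h1).sub h2).div_const 2).congr fun n => (covSum_polarization
        ((isRandomPartition_partitionTime n).partition ω) (fun s => ω s i) _ t).symm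
    · exact (((h3'.sub h1').sub h2').div_const 2).congr fun n =>
        (covSum_polarization ((hp n).partition ω) (fun s => ω s i) _ t).symm

/-- The convergence that defines `covariation`, whose sums leave out the first interval. -/
theorem IsTypical.tendsto_covariation {p : ℕ → ℕ → PricePath d T → WithTop (Time T)}
    (hp : ∀ n, IsRandomPartition (p n)) {ω : PricePath d T}
    (h : IsTypical p ω) (i j : Fin d) (t : Time T) :
    Tendsto (fun n => covSum (fun k => p n k ω) (fun s => ω s i) (fun s => ω s j) t)
      atTop (𝓝 (covariation i j t ω)) := by
  obtain ⟨L, h1, h2⟩ := h.exists_tendsto' hp i j t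
  have hfirst : ∀ (n : ℕ) (i : Fin d),
      |ω (cap (partitionTime n ω 1) t) i - ω (cap (partitionTime n ω 0) t) i| ≤
        2 * (1 / 2) ^ n := fun n i => by
    have h0 : cap (partitionTime n ω 0) t = ⊥ := cap_bot t
    have h3 := isFine_partitionTime n (Sum.inl i) ω 0 (cap (partitionTime n ω 1) t)
      (WithTop.coe_le_coe.2 bot_le : ((⊥ : Time T) : WithTop (Time T)) ≤ _) (by simp)
    simp only [dirProc_inl] at h3
    have h0' : cap (partitionTime n ω 0) ⊤ = ⊥ := cap_bot ⊤
    rw [h0'] at h3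
    rwa [h0, one_div, inv_pow]
  have hlim : Tendsto (fun n : ℕ => (2 * (1 / 2 : ℝ) ^ n) * (2 * (1 / 2) ^ n)) atTop (𝓝 0) := by
    have := (tendsto_pow_atTop_nhds_zero_of_lt_one (r := (1 / 2 : ℝ)) (by norm_num)
      (by norm_num)).const_mul 2
    simpa using this.mul this
  have h3 : Tendsto (fun n =>
      (ω (cap (partitionTime n ω 1) t) i - ω (cap (partitionTime n ω 0) t) i) *
      (ω (cap (partitionTime n ω 1) t) j - ω (cap (partitionTime n ω 0) t) j)) atTop (𝓝 0) := by
    refine squeeze_zero_norm (fun n => ?_) hlim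
    rw [Real.norm_eq_abs, abs_mul]
    exact mul_le_mul (hfirst n i) (hfirst n j) (abs_nonneg _) (by positivity)
  have h4 : covariation i j t ω = L := by
    refine Tendsto.limUnder_eq ?_
    have h5 := h1.sub h3
    rw [sub_zero] at h5
    refine h5.congr fun n => ?_
    have hπ := (isRandomPartition_partitionTime n).partition ω
    obtain ⟨N, hN⟩ := hπ.top
    have hs : Summable fun k : ℕ =>
        (ω (cap (partitionTime n ω (k + 1)) t) i - ω (cap (partitionTime n ω k) t) i) *
        (ω (cap (partitionTime n ω (k + 1)) t) j - ω (cap (partitionTime n ω k) t) j) := by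
      refine summable_of_ne_finset_zero (s := Finset.range N) fun k hk => ?_
      have hk : N ≤ k := by simpa using hk
      have e1 : partitionTime n ω k = ⊤ := hπ.eq_top hN hk
      have e2 : partitionTime n ω (k + 1) = ⊤ := hπ.eq_top hN (hk.trans k.le_succ)
      rw [e1, e2, sub_self, zero_mul]
    rw [covSum, hs.tsum_eq_zero_add]
    ring
  rw [h4]
  exact h2

/-! ### Quadratic variation of integral processes -/

namespace SimpleStrategy

variable (G : SimpleStrategy d T)

/-- The Lebesgue partition refined by the stopping times of the strategy. -/
def grid (n : ℕ) : ℕ → PricePath d T → WithTop (Time T) :=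
  rmerge (fun k ω => partitionTime n ω k) G.ntime

theorem isRandomPartition_grid (n : ℕ) : IsRandomPartition (G.grid n) :=
  (isRandomPartition_partitionTime n).rmerge G.isRandomPartition_ntime

theorem isFine_grid (n : ℕ) (e : Dir d) :
    IsFine (G.grid n) (dirProc e) (4 * (2 ^ n : ℝ)⁻¹) :=
  ((isFine_partitionTime n e).refine (isRandomPartition_partitionTime n)
    fun ω j hj l hl1 hl2 => (refines_merge_left ((isRandomPartition_partitionTime n).partition ω)
      (G.isRandomPartition_ntime.partition ω) j hj l hl1 hl2).2).mono
    (by rw [← mul_assoc]; norm_num)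

theorem quadVar_eq_stepSum (t : Time T) (ω : PricePath d T) : G.quadVar t ω =
    stepSum (fun l => G.ntime l ω) (fun l s => ∑ i : Fin d, ∑ j : Fin d,
      G.npos l ω i * G.npos l ω j * covariation i j s ω) t := by
  classical
  simp only [quadVar, stepSum, ← Finset.sum_sub_distrib, ← mul_sub]
  refine tsum_congr fun l => ?_
  by_cases hl : G.Ended l ω
  · have : G.τ (l + 1) ω = G.τ l ω := le_antisymm (hl _) (G.τ_le_succ l ω)
    simp [npos, hl, this]
  · have h1 : G.ntime (l + 1) ω = G.τ (l + 1) ω := if_neg hl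
    rw [h1, G.ntime_eq hl, npos, if_neg hl]

/-- On an interval of the grid the integral process is a linear functional of the path. -/
theorem integral_sub (n j : ℕ) {ω : PricePath d T} {u v : Time T} (hu : G.grid n j ω ≤ u)
    (huv : u ≤ v) (hv : (v : WithTop (Time T)) ≤ G.grid n (j + 1) ω) {l : ℕ}
    (hl1 : G.ntime l ω ≤ G.grid n j ω) (hl2 : G.grid n j ω < G.ntime (l + 1) ω) :
    G.integral v ω - G.integral u ω = inner ℝ (G.npos l ω) (ω v - ω u) := by
  rcases huv.eq_or_lt with rfl | hlt
  · simp
  have hj : G.grid n j ω < G.grid n (j + 1) ω := (hu.trans_lt (by exact_mod_cast hlt)).trans_le hv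
  have hl3 := (refines_merge_right ((isRandomPartition_partitionTime n).partition ω)
      (G.isRandomPartition_ntime.partition ω) j hj l hl1 hl2).2
  rw [G.integral_eq_stepSum, G.integral_eq_stepSum,
    (G.isRandomPartition_ntime.partition ω).stepSum_sub _ (hl1.trans hu) huv (hv.trans hl3),
    inner_sub_right]

end SimpleStrategy

theorem covSum_eq_stepSum (a : ℕ → WithTop (Time T)) (ha : Monotone a) (x y : Time T → ℝ)
    (t : Time T) : covSum a x y t = stepSum a (fun k s => (x s - x (cap (a k) s)) *
      (y s - y (cap (a k) s))) t := by
  rw [covSum, stepSum]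
  refine tsum_congr fun k => ?_
  have h1 : cap (a k) (cap (a (k + 1)) t) = cap (a k) t := by
    rw [cap_cap, min_eq_left (ha k.le_succ)]
  have h2 : cap (a k) (cap (a k) t) = cap (a k) t := by rw [cap_cap, min_self]
  rw [h1, h2]
  ring

theorem inner_eq_sum (x y : EuclideanSpace ℝ (Fin d)) : inner ℝ x y = ∑ i, x i * y i := by
  simp [PiLp.inner_apply, mul_comm]

/-- The sum of squares of the increments of the integral process along the grid. -/
def SimpleStrategy.sqSum (G : SimpleStrategy d T) (n : ℕ) (t : Time T) (ω : PricePath d T) : ℝ :=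
  covSum (fun k => G.grid n k ω) (fun s => G.integral s ω) (fun s => G.integral s ω) t

theorem SimpleStrategy.sqSum_eq (G : SimpleStrategy d T) (n : ℕ) (t : Time T)
    (ω : PricePath d T) : G.sqSum n t ω =
      stepSum (fun l => G.ntime l ω) (fun l s => ∑ i : Fin d, ∑ j : Fin d,
        G.npos l ω i * G.npos l ω j *
          covSum (fun k => G.grid n k ω) (fun s => ω s i) (fun s => ω s j) s) t := by
  have hg := (G.isRandomPartition_grid n).partition ω
  have hτ := G.isRandomPartition_ntime.partition ω
  rw [sqSum, covSum_eq_stepSum _ hg.mono]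
  refine (stepSum_refine hτ hg (refines_merge_right
    ((isRandomPartition_partitionTime n).partition ω) hτ) t ?_).symm
  intro k l _ hl1 hl2 u v hu huv hv
  obtain ⟨s, hs⟩ := WithTop.ne_top_iff_exists.1 (hl2.trans_le le_top).ne
  have hsu : s ≤ u := by rw [← hs] at hu; exact_mod_cast hu
  have hcap : ∀ w, s ≤ w → cap (G.grid n k ω) w = s := fun w hw => by
    rw [← hs, cap_coe, min_eq_left hw]
  have hsq : ∀ w, s ≤ w → (w : WithTop (Time T)) ≤ G.grid n (k + 1) ω →
      (G.integral w ω - G.integral s ω) * (G.integral w ω - G.integral s ω) =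
      ∑ i : Fin d, ∑ j : Fin d, G.npos l ω i * G.npos l ω j *
        ((ω w i - ω s i) * (ω w j - ω s j)) := fun w hw hw' => by
    rw [G.integral_sub n k hs.ge hw hw' hl1 hl2, inner_eq_sum, Finset.sum_mul_sum]
    refine Finset.sum_congr rfl fun i _ => Finset.sum_congr rfl fun j _ => ?_
    simp only [PiLp.sub_apply]
    ring
  have hcov : ∀ i j : Fin d, covSum (fun k => G.grid n k ω) (fun s => ω s i) (fun s => ω s j) v -
      covSum (fun k => G.grid n k ω) (fun s => ω s i) (fun s => ω s j) u =
      (ω v i - ω s i) * (ω v j - ω s j) - (ω u i - ω s i) * (ω u j - ω s j) := fun i j => by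
    rw [covSum_eq_stepSum _ hg.mono, covSum_eq_stepSum _ hg.mono, hg.stepSum_sub _ hu huv hv,
      hcap v (hsu.trans huv), hcap u hsu]
  simp only [hcap v (hsu.trans huv), hcap u hsu]
  rw [hsq v (hsu.trans huv) hv, hsq u hsu ((WithTop.coe_le_coe.2 huv).trans hv),
    ← Finset.sum_sub_distrib, ← Finset.sum_sub_distrib]
  refine Finset.sum_congr rfl fun i _ => ?_
  rw [← Finset.sum_sub_distrib, ← Finset.sum_sub_distrib]
  refine Finset.sum_congr rfl fun j _ => ?_
  rw [← mul_sub, ← mul_sub, hcov]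

/-- For typical paths the sums of squares of the increments of the integral process converge to
its quadratic variation. -/
theorem IsTypical.tendsto_sqSum {G : SimpleStrategy d T} {ω : PricePath d T}
    (h : IsTypical G.grid ω) (t : Time T) :
    Tendsto (fun n => G.sqSum n t ω) atTop (𝓝 (G.quadVar t ω)) := by
  have hτ := G.isRandomPartition_ntime.partition ω
  obtain ⟨L, hL⟩ := hτ.top
  simp only [SimpleStrategy.sqSum_eq, SimpleStrategy.quadVar_eq_stepSum,
    stepSum_eq_sum hτ.mono _ (N := L) (show (t : WithTop (Time T)) ≤ G.ntime L ω by simp [hL])]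
  refine tendsto_finsetSum _ fun l _ => Tendsto.sub ?_ ?_ <;>
  exact tendsto_finsetSum _ fun i _ => tendsto_finsetSum _ fun j _ =>
    (h.tendsto_covariation G.isRandomPartition_grid i j _).const_mul _

/-! ### The pathwise Burkholder–Davis–Gundy inequality -/

/-- The elementary inequality behind the case of a large jump in `davis_step`, in normalised
variables. -/
theorem davis_large_jump_aux {a m b D : ℝ} (ha : 0 ≤ a) (hm : 0 ≤ m) (h1 : a ^ 2 + m ^ 2 = 1)
    (hb : 0 ≤ b) (hbD : b ^ 2 = a ^ 2 + D ^ 2) (hab : 3 ≤ a + b) :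
    D * (1 + m) ≤ 1 + 2 * b + m - 3 * a := by
  have ha1 : a ≤ 1 := by nlinarith
  have hm1 : m ≤ 1 := by nlinarith
  have hb3 : 0 ≤ b - (3 - a) := by linarith
  rcases le_total m (3 / 5) with h | h
  · -- the geometric mean of `2 (b - a)` and `(b + a) / 2` is at most their arithmetic mean
    have hD : D ≤ 5 / 4 * b - 3 / 4 * a := by
      refine abs_le_of_sq_le_sq' ?_ (by linarith) |>.2
      nlinarith [sq_nonneg (3 * b - 5 * a)]
    have ha2 : a ≤ 1 - m ^ 2 / 2 := by nlinarith
    have h2 : D * (1 + m) ≤ (5 / 4 * b - 3 / 4 * a) * (1 + m) :=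
      mul_le_mul_of_nonneg_right hD (by linarith)
    have h3 : 0 ≤ (3 / 4 - 5 / 4 * m) * (b - (3 - a)) := mul_nonneg (by linarith) hb3
    have h4 : 0 ≤ (3 - 2 * m) * (1 - m ^ 2 / 2 - a) := mul_nonneg (by linarith) (by linarith)
    nlinarith [sq_nonneg (m - 1 / 3), mul_nonneg hm (sq_nonneg (m - 1 / 3)),
      mul_nonneg hm (sub_nonneg.2 h), mul_nonneg (mul_nonneg hm hm) (sub_nonneg.2 h)]
  · have hD : D ≤ b := abs_le_of_sq_le_sq' (by nlinarith) hb |>.2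
    have h2 : D * (1 + m) ≤ b * (1 + m) := mul_le_mul_of_nonneg_right hD (by linarith)
    have h3 : 0 ≤ (1 - m) * (b - (3 - a)) := mul_nonneg (by linarith) hb3
    have h4 : a * (4 - m) ≤ 4 - 2 * m := by
      refine abs_le_of_sq_le_sq' ?_ (by linarith) |>.2
      have h5 : 0 ≤ m * (-8 + 19 * m - 8 * m ^ 2 + m ^ 3) :=
        mul_nonneg hm (by nlinarith [mul_nonneg hm (sub_nonneg.2 hm1), pow_nonneg hm 3])
      nlinarith
    nlinarith

/-- The case of `davis_step` in which the running maximum does not change. -/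
theorem davis_old_max_aux {a b f g m D : ℝ} (hf : 0 < f) (hab : a ≤ b)
    (haf : a ≤ f) (hbg : b ≤ g) (hfm : f ^ 2 = a ^ 2 + m ^ 2) (hbD : b ^ 2 = a ^ 2 + D ^ 2)
    (hgm : g ^ 2 = b ^ 2 + m ^ 2) (hDm : D ^ 2 ≤ 4 * m ^ 2) :
    2 * D ^ 2 + f * (g - f) ≤ f * (6 * (b - a)) := by
  have hD2 : D ^ 2 = (b - a) * (b + a) := by linear_combination -hbD
  have h1 : 2 * (a + b) ≤ 5 * f := by
    refine abs_le_of_sq_le_sq' ?_ (by positivity) |>.2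
    nlinarith [sq_nonneg (2 * a - b)]
  have h2 : g - f ≤ b - a := by
    have h3 : (g - f) * (g + f) = (b - a) * (b + a) := by linear_combination hgm - hfm
    by_contra hcon
    rw [not_le] at hcon
    have h4 := mul_pos (sub_pos.2 hcon) (by linarith : 0 < g + f)
    have h5 := mul_le_mul_of_nonneg_left (add_le_add hbg haf) (sub_nonneg.2 hab)
    linarith
  have h3 : (b - a) * (2 * (a + b)) ≤ (b - a) * (5 * f) :=
    mul_le_mul_of_nonneg_left h1 (sub_nonneg.2 hab)
  have h4 := mul_le_mul_of_nonneg_left h2 hf.le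
  rw [hD2]
  linarith

/-- The case of `davis_step` in which the running maximum increases. -/
theorem davis_new_max_aux {a b f g m D y : ℝ} (ha : 0 ≤ a) (hb : 0 ≤ b) (hf : 0 < f)
    (hm : 0 ≤ m) (hD : 0 ≤ D) (hab : a ≤ b) (hfg : f ≤ g) (hfm : f ^ 2 = a ^ 2 + m ^ 2)
    (hbD : b ^ 2 = a ^ 2 + D ^ 2) (hgm : g ^ 2 = b ^ 2 + y ^ 2) (hy : D - m ≤ y) :
    0 ≤ (g - f) ^ 2 - 2 * D ^ 2 + 6 * f * (b - a) := by
  have hD2 : D ^ 2 = (b - a) * (b + a) := by linear_combination -hbD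
  rcases le_or_gt (a + b) (3 * f) with hs | hs
  · have h1 := mul_nonneg (sub_nonneg.2 hab) (sub_nonneg.2 hs)
    have h2 := sq_nonneg (g - f)
    rw [hD2]
    linarith
  · have haf : a ≤ f := abs_le_of_sq_le_sq' (by nlinarith) hf.le |>.2
    have hDf : 3 * f ^ 2 ≤ D ^ 2 := by
      have h1 : (2 * f) ^ 2 ≤ b ^ 2 := pow_le_pow_left₀ (by positivity) (by linarith) 2
      have h2 : a ^ 2 ≤ f ^ 2 := pow_le_pow_left₀ ha haf 2
      linarith
    have hDm : m ≤ D := abs_le_of_sq_le_sq' (by nlinarith) hD |>.2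
    have hy2 : (D - m) ^ 2 ≤ y ^ 2 := pow_le_pow_left₀ (sub_nonneg.2 hDm) hy 2
    have haux := davis_large_jump_aux (a := a / f) (m := m / f) (b := b / f) (D := D / f)
      (by positivity) (by positivity) (by field_simp; linarith) (by positivity)
      (by rw [div_pow, div_pow, div_pow, ← add_div, hbD])
      (by rw [← add_div, le_div_iff₀ hf]; linarith)
    have haux2 : D * (f + m) ≤ f ^ 2 + 2 * b * f + m * f - 3 * a * f := by
      have h1 := mul_le_mul_of_nonneg_left haux (sq_nonneg f)
      have e1 : f ^ 2 * (D / f * (1 + m / f)) = D * (f + m) := by field_simp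
      have e2 : f ^ 2 * (1 + 2 * (b / f) + m / f - 3 * (a / f)) =
          f ^ 2 + 2 * b * f + m * f - 3 * a * f := by field_simp
      rwa [e1, e2] at h1
    obtain ⟨e, he⟩ : ∃ e, e = √(b ^ 2 + (D - m) ^ 2) := ⟨_, rfl⟩
    have he2 : e ^ 2 = b ^ 2 + (D - m) ^ 2 := by
      rw [he]; exact Real.sq_sqrt (by positivity)
    have he0 : 0 ≤ e := he ▸ Real.sqrt_nonneg _
    have heg : e ≤ g := abs_le_of_sq_le_sq' (by linarith) (hf.le.trans hfg) |>.2
    have hfe : f ≤ e := by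
      refine abs_le_of_sq_le_sq' ?_ he0 |>.2
      have := sq_nonneg (D - m)
      have := sq_nonneg a
      have := sq_nonneg f
      linarith
    have heb : e ≤ b + (D - m) := by
      refine abs_le_of_sq_le_sq' ?_ (by linarith) |>.2
      have := mul_nonneg hb (sub_nonneg.2 hDm)
      rw [he2]
      linarith
    have h1 : (e - f) ^ 2 ≤ (g - f) ^ 2 := pow_le_pow_left₀ (sub_nonneg.2 hfe) (by linarith) 2
    have h2 := mul_le_mul_of_nonneg_left heb hf.le
    have h3 : (e - f) ^ 2 = b ^ 2 + (D - m) ^ 2 - 2 * (f * e) + f ^ 2 := by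
      linear_combination he2
    nlinarith

/-- The potential of Davis' argument; `A` stands for the quadratic variation and `m` for the
running maximum. -/
def davisPotential (x A m : ℝ) : ℝ :=
  (x ^ 2 + A) / √(A + m ^ 2) + √(A + m ^ 2) - 6 * √A

/-- In one step the potential increases at most by twice the gain of the strategy
`x / √(A + m ^ 2)`. -/
theorem davis_step {x A m : ℝ} (hA : 0 ≤ A) (hxm : |x| ≤ m) (y : ℝ) :
    davisPotential y (A + (y - x) ^ 2) (max m |y|) - davisPotential x A m ≤
      2 * (x / √(A + m ^ 2) * (y - x)) := by
  have hm : 0 ≤ m := (abs_nonneg x).trans hxm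
  obtain ⟨D, rfl⟩ : ∃ D, y = x + D := ⟨y - x, by ring⟩
  rw [add_sub_cancel_left]
  have hM2 : m ^ 2 ≤ max m |x + D| ^ 2 := pow_le_pow_left₀ hm (le_max_left _ _) 2
  have hab : √A ≤ √(A + D ^ 2) := Real.sqrt_le_sqrt (by linarith [sq_nonneg D])
  have hbg : √(A + D ^ 2) ≤ √(A + D ^ 2 + max m |x + D| ^ 2) :=
    Real.sqrt_le_sqrt (by linarith [sq_nonneg (max m |x + D|)])
  have haf : √A ≤ √(A + m ^ 2) := Real.sqrt_le_sqrt (by linarith [sq_nonneg m])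
  have hfg : √(A + m ^ 2) ≤ √(A + D ^ 2 + max m |x + D| ^ 2) :=
    Real.sqrt_le_sqrt (by linarith [sq_nonneg D])
  have ha2 : √A ^ 2 = A := Real.sq_sqrt hA
  have hb2 : √(A + D ^ 2) ^ 2 = A + D ^ 2 := Real.sq_sqrt (by positivity)
  have hf2 : √(A + m ^ 2) ^ 2 = A + m ^ 2 := Real.sq_sqrt (by positivity)
  have hg2 : √(A + D ^ 2 + max m |x + D| ^ 2) ^ 2 = A + D ^ 2 + max m |x + D| ^ 2 :=
    Real.sq_sqrt (by positivity)
  unfold davisPotential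
  rcases (Real.sqrt_nonneg (A + m ^ 2)).eq_or_lt with hf00 | hfpos
  · rw [← hf00] at hf2
    have hA0 : A = 0 := by linarith [sq_nonneg m]
    have hm0 : m = 0 := pow_eq_zero_iff two_ne_zero |>.1 (by linarith)
    have hx0 : x = 0 := abs_eq_zero.1 (le_antisymm (hm0 ▸ hxm) (abs_nonneg _))
    subst hx0 hA0 hm0
    have h1 : √(D ^ 2 + D ^ 2) ≤ 2 * √(D ^ 2) := by
      rw [Real.sqrt_le_left (by positivity), mul_pow, Real.sq_sqrt (sq_nonneg D)]
      linarith [sq_nonneg D]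
    have h2 : (D ^ 2 + D ^ 2) / √(D ^ 2 + D ^ 2) = √(D ^ 2 + D ^ 2) := Real.div_sqrt
    simp only [zero_add, zero_mul, mul_zero, max_eq_right (abs_nonneg D),
      sq_abs, sub_zero, ne_eq, OfNat.ofNat_ne_zero, not_false_eq_true, zero_pow, add_zero,
      div_zero, Real.sqrt_zero]
    rw [h2]
    linarith [Real.sqrt_nonneg (D ^ 2)]
  have ha0 := Real.sqrt_nonneg A
  have hb0 := Real.sqrt_nonneg (A + D ^ 2)
  rcases le_total |x + D| m with hle | hle
  · rw [max_eq_left hle] at hg2 hbg hfg ⊢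
    generalize √A = a at *
    generalize √(A + D ^ 2) = b at *
    generalize √(A + m ^ 2) = f at *
    generalize √(A + D ^ 2 + m ^ 2) = g at *
    have hDm : D ^ 2 ≤ 4 * m ^ 2 := by
      have h1 : |D| ≤ 2 * m := by
        have := abs_sub (x + D) x
        rw [add_sub_cancel_left] at this
        linarith
      have h2 := pow_le_pow_left₀ (abs_nonneg D) h1 2
      rw [sq_abs] at h2
      linarith
    have h1 := davis_old_max_aux (m := m) (D := D) hfpos hab haf hbg (by linarith)
      (by linarith) (by linarith) hDm
    have h2 : ((x + D) ^ 2 + (A + D ^ 2)) / g ≤ ((x + D) ^ 2 + (A + D ^ 2)) / f :=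
      div_le_div_of_nonneg_left (by positivity) hfpos hfg
    have h3 : ((x + D) ^ 2 + (A + D ^ 2)) / f - (x ^ 2 + A) / f - 2 * (x / f * D) =
        2 * D ^ 2 / f := by
      field_simp
      ring
    have h4 : 2 * D ^ 2 / f ≤ 6 * (b - a) - (g - f) := by
      rw [div_le_iff₀ hfpos]
      linarith
    linarith
  · rw [max_eq_right hle] at hg2 hbg hfg ⊢
    generalize √A = a at *
    generalize √(A + D ^ 2) = b at *
    generalize √(A + m ^ 2) = f at *
    have hxD : |D| - m ≤ |x + D| := by
      have := abs_sub (x + D) x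
      rw [add_sub_cancel_left] at this
      linarith
    generalize √(A + D ^ 2 + |x + D| ^ 2) = g at *
    have h1 := davis_new_max_aux (m := m) (D := |D|) (y := |x + D|) ha0 hb0 hfpos hm
      (abs_nonneg D) hab hfg (by linarith) (by rw [sq_abs]; linarith) (by linarith) hxD
    rw [sq_abs] at h1
    rw [sq_abs] at hg2
    have hgpos : 0 < g := hfpos.trans_le hfg
    have h2 : ((x + D) ^ 2 + (A + D ^ 2)) / g = g := by
      rw [div_eq_iff hgpos.ne']
      linarith
    have h3 : (x ^ 2 + A) / f + 2 * (x / f * D) = (g ^ 2 - 2 * D ^ 2) / f := by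
      rw [hg2]
      field_simp
      ring
    have h4 : 2 * g - f - 6 * (b - a) ≤ (g ^ 2 - 2 * D ^ 2) / f := by
      rw [le_div_iff₀ hfpos]
      linarith
    linarith

/-- The running maximum of the absolute values of a sequence. -/
def runMax (z : ℕ → ℝ) : ℕ → ℝ
  | 0 => |z 0|
  | k + 1 => max (runMax z k) |z (k + 1)|

/-- The integrand `x_k / √([x]_k + (x^*_k)^2)` of the pathwise Burkholder–Davis–Gundy inequality. -/
def bdgWeight (z : ℕ → ℝ) (k : ℕ) : ℝ :=
  z k / √(∑ i ∈ Finset.range k, (z (i + 1) - z i) ^ 2 + runMax z k ^ 2)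

theorem abs_le_runMax (z : ℕ → ℝ) {i k : ℕ} (h : i ≤ k) : |z i| ≤ runMax z k := by
  induction k with
  | zero => rw [Nat.le_zero.1 h]; exact le_rfl
  | succ k ih =>
    rcases h.eq_or_lt with rfl | h
    · exact le_max_right _ _
    · exact (ih (by omega)).trans (le_max_left _ _)

theorem abs_bdgWeight_le_one (z : ℕ → ℝ) (k : ℕ) : |bdgWeight z k| ≤ 1 := by
  rw [bdgWeight, abs_div, abs_of_nonneg (Real.sqrt_nonneg _)]
  refine div_le_one_of_le₀ (Real.le_sqrt_of_sq_le ?_) (Real.sqrt_nonneg _)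
  have h1 := pow_le_pow_left₀ (abs_nonneg _) (abs_le_runMax z le_rfl : |z k| ≤ runMax z k) 2
  have h2 : 0 ≤ ∑ i ∈ Finset.range k, (z (i + 1) - z i) ^ 2 :=
    Finset.sum_nonneg fun i _ => sq_nonneg _
  linarith

theorem runMax_congr {z z' : ℕ → ℝ} {k : ℕ} (h : ∀ i ≤ k, z i = z' i) :
    runMax z k = runMax z' k := by
  induction k with
  | zero => simp [runMax, h 0 le_rfl]
  | succ k ih =>
    rw [runMax, runMax, ih fun i hi => h i (hi.trans k.le_succ), h (k + 1) le_rfl]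

theorem bdgWeight_congr {z z' : ℕ → ℝ} {k : ℕ} (h : ∀ i ≤ k, z i = z' i) :
    bdgWeight z k = bdgWeight z' k := by
  rw [bdgWeight, bdgWeight, runMax_congr h, h k le_rfl]
  congr 3
  refine Finset.sum_congr rfl fun i hi => ?_
  have := Finset.mem_range.1 hi
  rw [h i (by omega), h (i + 1) (by omega)]

theorem measurable_bdgWeight (k : ℕ) : Measurable fun z : ℕ → ℝ => bdgWeight z k := by
  have h : Measurable fun z : ℕ → ℝ => runMax z k := by
    induction k with
    | zero => exact (measurable_pi_apply 0).norm
    | succ k ih => exact ih.max (measurable_pi_apply (k + 1)).norm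
  unfold bdgWeight
  fun_prop

/-- The pathwise Burkholder–Davis–Gundy inequality of Beiglböck and Siorpaes. -/
theorem runMax_le (z : ℕ → ℝ) (h0 : z 0 = 0) (N : ℕ) :
    runMax z N ≤ 6 * √(∑ i ∈ Finset.range N, (z (i + 1) - z i) ^ 2) +
      2 * ∑ k ∈ Finset.range N, bdgWeight z k * (z (k + 1) - z k) := by
  have key : ∀ N, davisPotential (z N) (∑ i ∈ Finset.range N, (z (i + 1) - z i) ^ 2) (runMax z N) ≤
      2 * ∑ k ∈ Finset.range N, bdgWeight z k * (z (k + 1) - z k) := by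
    intro N
    induction N with
    | zero => simp [davisPotential, runMax, h0]
    | succ N ih =>
      have h := davis_step (Finset.sum_nonneg fun i _ => sq_nonneg _ :
        0 ≤ ∑ i ∈ Finset.range N, (z (i + 1) - z i) ^ 2) (abs_le_runMax z (le_refl N)) (z (N + 1))
      rw [Finset.sum_range_succ, Finset.sum_range_succ, runMax, bdgWeight]
      linarith
  have h1 := key N
  unfold davisPotential at h1
  have hA : 0 ≤ ∑ i ∈ Finset.range N, (z (i + 1) - z i) ^ 2 :=
    Finset.sum_nonneg fun i _ => sq_nonneg _
  have h2 : runMax z N ≤ √(∑ i ∈ Finset.range N, (z (i + 1) - z i) ^ 2 + runMax z N ^ 2) :=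
    Real.le_sqrt_of_sq_le (by linarith)
  have h3 : 0 ≤ (z N ^ 2 + ∑ i ∈ Finset.range N, (z (i + 1) - z i) ^ 2) /
      √(∑ i ∈ Finset.range N, (z (i + 1) - z i) ^ 2 + runMax z N ^ 2) := by positivity
  linarith

namespace SimpleStrategy

variable (G : SimpleStrategy d T)

/-- The discretised stochastic integral in the pathwise Burkholder–Davis–Gundy inequality for the
integral process of `G`, sampled along the grid. -/
def bdgProc (n : ℕ) (t : Time T) (ω : PricePath d T) : ℝ :=
  stepSum (fun k => G.grid n k ω)
    (fun k s => bdgWeight (fun i => G.integral (cap (G.grid n i ω) ⊤) ω) k * G.integral s ω) t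

theorem isIntegral_bdgProc (n : ℕ) : IsIntegral (G.bdgProc n) := by
  have hg := G.isRandomPartition_grid n
  refine G.isIntegral_integral.stepSum hg (fun k => ?_) fun k =>
    ⟨1, fun ω => abs_bdgWeight_le_one _ k⟩
  have hz := fun i => G.isIntegral_integral.isContAdapted.knownAt (hg.time i)
  refine ⟨(measurable_bdgWeight k).comp (measurable_pi_lambda _ fun i => (hz i).measurable),
    fun ω ω' h => bdgWeight_congr fun i hi => ?_⟩
  exact (hz i).nonant ω ω' (h.mono ((hg.partition ω).mono hi))

theorem sqSum_eq_sum (n : ℕ) {t : Time T} {ω : PricePath d T} {N : ℕ}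
    (hN : (t : WithTop (Time T)) ≤ G.grid n N ω) : G.sqSum n t ω = ∑ k ∈ Finset.range N,
      (G.integral (cap (G.grid n (k + 1) ω) t) ω - G.integral (cap (G.grid n k ω) t) ω) ^ 2 := by
  rw [sqSum, covSum_eq_sum ((G.isRandomPartition_grid n).partition ω).mono _ _ hN]
  exact Finset.sum_congr rfl fun k _ => (pow_two _).symm

/-- The pathwise Burkholder–Davis–Gundy inequality along the grid. After time `t` the capped
sequence stops moving, so that the weights may be read off from the uncapped one. -/
theorem abs_integral_cap_le (n j : ℕ) (t : Time T) (ω : PricePath d T) :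
    |G.integral (cap (G.grid n j ω) t) ω| ≤ 6 * √(G.sqSum n t ω) + 2 * G.bdgProc n t ω := by
  have hg := (G.isRandomPartition_grid n).partition ω
  obtain ⟨L, hL⟩ := hg.top
  have hN : (t : WithTop (Time T)) ≤ G.grid n (max L j) ω := by
    rw [hg.eq_top hL (le_max_left _ _)]; exact le_top
  have h := runMax_le (fun i => G.integral (cap (G.grid n i ω) t) ω) (by
    have : G.grid n 0 ω = ⊥ := hg.zero
    simp only [this, cap_bot, G.isIntegral_integral.bot]) (max L j)
  refine (abs_le_runMax (fun i => G.integral (cap (G.grid n i ω) t) ω) (le_max_right L j)).trans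
    (h.trans_eq ?_)
  rw [sqSum_eq_sum G n hN, bdgProc, stepSum_eq_sum hg.mono _ hN]
  congr 2
  refine Finset.sum_congr rfl fun k _ => ?_
  rw [← mul_sub]
  rcases le_total (G.grid n k ω) t with hk | hk
  · congr 1
    refine bdgWeight_congr fun i hi => ?_
    rw [cap_cap_top _ ((hg.mono hi).trans hk)]
  · rw [cap_eq_right hk, cap_eq_right (hk.trans (hg.mono k.le_succ))]
    simp

end SimpleStrategy

/-! ### Bounds between the points of the grids -/

namespace SimpleStrategy

variable (G : SimpleStrategy d T)

/-- Along a fixed path the oscillation of the integral process on the intervals of the grids is of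
order `2^{-n}`, since only finitely many positions of the strategy are active. -/
theorem exists_oscillation (ω : PricePath d T) : ∃ C : ℝ, 0 ≤ C ∧ ∀ (n j : ℕ) (t : Time T),
    G.grid n j ω ≤ t → (t : WithTop (Time T)) ≤ G.grid n (j + 1) ω →
      |G.integral t ω - G.integral (cap (G.grid n j ω) t) ω| ≤ C * (1 / 2) ^ n := by
  obtain ⟨L, hL⟩ := (G.isRandomPartition_ntime.partition ω).top
  refine ⟨4 * ∑ l ∈ Finset.range L, ∑ i : Fin d, |G.npos l ω i|, by positivity,
    fun n j t hj ht => ?_⟩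
  obtain ⟨l, hl1, hl2⟩ := (G.isRandomPartition_ntime.partition ω).exists_mem
    (hj.trans_lt (WithTop.coe_lt_top t))
  have hlL : l < L := not_le.1 fun h => by
    have : G.ntime l ω = ⊤ := (G.isRandomPartition_ntime.partition ω).eq_top hL h
    rw [this] at hl1
    exact absurd (hl1.trans hj) (not_le.2 (WithTop.coe_lt_top t))
  have hs : G.grid n j ω = (cap (G.grid n j ω) t : Time T) := (coe_cap_eq_left hj).symm
  have hc : cap (G.grid n j ω) ⊤ = cap (G.grid n j ω) t := cap_cap_top _ hj
  rw [G.integral_sub n j hs.le (cap_le _ t) ht hl1 hl2, inner_eq_sum]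
  have h1 : ∀ i : Fin d, |G.npos l ω i * (ω t - ω (cap (G.grid n j ω) t)) i| ≤
      |G.npos l ω i| * (4 * (1 / 2) ^ n) := fun i => by
    rw [abs_mul]
    refine mul_le_mul_of_nonneg_left ?_ (abs_nonneg _)
    have := G.isFine_grid n (Sum.inl i) ω j t hj ht
    rw [hc] at this
    simpa [dirProc_inl] using this
  refine (Finset.abs_sum_le_sum_abs _ _).trans ((Finset.sum_le_sum fun i _ => h1 i).trans ?_)
  rw [← Finset.sum_mul]
  have h2 := Finset.single_le_sum (f := fun l => ∑ i : Fin d, |G.npos l ω i|)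
    (fun l _ => Finset.sum_nonneg fun i _ => abs_nonneg _) (Finset.mem_range.2 hlL)
  have h3 := mul_le_mul_of_nonneg_right h2 (by positivity : (0 : ℝ) ≤ 4 * (1 / 2) ^ n)
  linarith

theorem sqSum_nonneg (n : ℕ) (t : Time T) (ω : PricePath d T) : 0 ≤ G.sqSum n t ω := by
  obtain ⟨L, hL⟩ := ((G.isRandomPartition_grid n).partition ω).top
  rw [G.sqSum_eq_sum n (N := L) (by simp [hL])]
  exact Finset.sum_nonneg fun _ _ => sq_nonneg _

/-- The sums of squares are increasing in time, up to the oscillation on one interval. -/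
theorem sqSum_le {ω : PricePath d T} {C : ℝ} (hC : ∀ (n j : ℕ) (t : Time T),
    G.grid n j ω ≤ t → (t : WithTop (Time T)) ≤ G.grid n (j + 1) ω →
      |G.integral t ω - G.integral (cap (G.grid n j ω) t) ω| ≤ C * (1 / 2) ^ n)
    (n : ℕ) {s t : Time T} (hst : s ≤ t) :
    G.sqSum n s ω ≤ G.sqSum n t ω + (C * (1 / 2) ^ n) ^ 2 := by
  have hg := (G.isRandomPartition_grid n).partition ω
  obtain ⟨L, hL⟩ := hg.top
  obtain ⟨j, hj1, hj2⟩ := hg.exists_mem (WithTop.coe_lt_top s)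
  have hN : (t : WithTop (Time T)) ≤ G.grid n (max L j) ω := by
    rw [hg.eq_top hL (le_max_left _ _)]; exact le_top
  rw [G.sqSum_eq_sum n hj2.le, G.sqSum_eq_sum n hN, Finset.sum_range_succ]
  refine add_le_add ?_ ?_
  · refine le_trans (le_of_eq (Finset.sum_congr rfl fun k hk => ?_))
      (Finset.sum_le_sum_of_subset_of_nonneg
        (Finset.range_subset_range.2 (le_max_right L j)) fun _ _ _ => sq_nonneg _)
    have hk := Finset.mem_range.1 hk
    rw [cap_eq_cap ((hg.mono (show k + 1 ≤ j from hk)).trans hj1) hst,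
      cap_eq_cap ((hg.mono hk.le).trans hj1) hst]
  · rw [cap_eq_right hj2.le, ← sq_abs]
    exact pow_le_pow_left₀ (abs_nonneg _) (hC n j s hj1 hj2.le) 2

theorem abs_integral_le {ω : PricePath d T} {C : ℝ} (hC : ∀ (n j : ℕ) (t : Time T),
    G.grid n j ω ≤ t → (t : WithTop (Time T)) ≤ G.grid n (j + 1) ω →
      |G.integral t ω - G.integral (cap (G.grid n j ω) t) ω| ≤ C * (1 / 2) ^ n)
    (n : ℕ) {s t : Time T} (hst : s ≤ t) :
    |G.integral s ω| ≤ 6 * √(G.sqSum n t ω) + 2 * G.bdgProc n t ω + C * (1 / 2) ^ n := by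
  obtain ⟨j, hj1, hj2⟩ :=
    ((G.isRandomPartition_grid n).partition ω).exists_mem (WithTop.coe_lt_top s)
  have h1 := hC n j s hj1 hj2.le
  have h2 := G.abs_integral_cap_le n j t ω
  rw [← cap_eq_cap hj1 hst] at h2
  have h3 := abs_sub_abs_le_abs_sub (G.integral s ω) (G.integral (cap (G.grid n j ω) s) ω)
  linarith

end SimpleStrategy

/-! ### Rounds of betting on recoveries -/

section Rounds

/-- The first of the times `s n`, `n ∈ I`, that is not before `r`. -/
def nextDip (s : ℕ → WithTop (Time T)) (I : Finset ℕ) (r : WithTop (Time T)) : WithTop (Time T) :=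
  I.inf fun n => if r ≤ s n then s n else ⊤

/-- The index `n` is the first one in `I` with `s n = D`. -/
def IsFirst (s : ℕ → WithTop (Time T)) (I : Finset ℕ) (D : WithTop (Time T)) (n : ℕ) : Prop :=
  s n = D ∧ ∀ k ∈ I, k < n → s k ≠ D

open Classical in
/-- The recovery time `R n` that belongs to the first dip `s n` after `r`. -/
def nextRecovery (s R : ℕ → WithTop (Time T)) (I : Finset ℕ) (r : WithTop (Time T)) :
    WithTop (Time T) :=
  I.inf fun n => if IsFirst s I (nextDip s I r) n then R n else ⊤

/-- The end of the `k`th round, each round consisting of the first dip after the end of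
the preceding round and the corresponding recovery. -/
def roundEnd (s R : ℕ → WithTop (Time T)) (I : Finset ℕ) : ℕ → WithTop (Time T)
  | 0 => ((⊥ : Time T) : WithTop (Time T))
  | k + 1 => nextRecovery s R I (roundEnd s R I k)

variable {s R : ℕ → WithTop (Time T)} {I : Finset ℕ} {r : WithTop (Time T)}

theorem le_nextDip : r ≤ nextDip s I r :=
  Finset.le_inf fun n _ => by split_ifs with h; exacts [h, le_top]

theorem nextDip_le {n : ℕ} (hn : n ∈ I) (h : r ≤ s n) : nextDip s I r ≤ s n :=
  (Finset.inf_le hn).trans (by rw [if_pos h])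

theorem nextDip_le_nextRecovery (hR : ∀ n, s n ≤ R n) : nextDip s I r ≤ nextRecovery s R I r :=
  Finset.le_inf fun n _ => by
    split_ifs with h
    · exact h.1 ▸ hR n
    · exact le_top

theorem roundEnd_mono (hR : ∀ n, s n ≤ R n) : Monotone (roundEnd s R I) :=
  monotone_nat_of_le_succ fun _ => le_nextDip.trans (nextDip_le_nextRecovery hR)

theorem IsFirst.unique {D : WithTop (Time T)} {n k : ℕ} (hn : IsFirst s I D n)
    (hk : IsFirst s I D k) (hnI : n ∈ I) (hkI : k ∈ I) : n = k := by
  rcases lt_trichotomy n k with h | h | h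
  · exact absurd hn.1 (hk.2 n hnI h)
  · exact h
  · exact absurd hk.1 (hn.2 k hkI h)

theorem nextRecovery_eq {n : ℕ} (hn : n ∈ I) (h : IsFirst s I (nextDip s I r) n) :
    nextRecovery s R I r = R n := by
  apply le_antisymm
  · exact (Finset.inf_le hn).trans (by rw [if_pos h])
  · refine Finset.le_inf fun k hk => ?_
    split_ifs with h'
    · rw [h.unique h' hn hk]
    · exact le_top

theorem exists_isFirst (h : nextDip s I r < ⊤) : ∃ n ∈ I, IsFirst s I (nextDip s I r) n := by
  classical
  have hne : I.Nonempty := by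
    by_contra hI
    rw [Finset.not_nonempty_iff_eq_empty] at hI
    simp [nextDip, hI] at h
  obtain ⟨n, hn, hn'⟩ := Finset.exists_mem_eq_inf I hne fun n => if r ≤ s n then s n else ⊤
  have h1 : ∃ n, n ∈ I ∧ s n = nextDip s I r := by
    refine ⟨n, hn, ?_⟩
    rw [nextDip] at h ⊢
    rw [hn'] at h ⊢
    split_ifs at h ⊢ with h2
    · rfl
    · exact absurd rfl h.ne
  exact ⟨Nat.find h1, (Nat.find_spec h1).1, (Nat.find_spec h1).2,
    fun k hk hlt heq => Nat.find_min h1 hlt ⟨hk, heq⟩⟩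

/-- If infinitely many of the times `s n` are finite, and if for every time `t` all but finitely
many of the dips before `t` have recovered before `t`, then arbitrarily many rounds are completed,
provided the window of indices is large enough. The proof looks at the smallest accumulation point
`u` of the dips: either infinitely many of them happen up to time `u`, and then the rounds can be
completed before `u`, or the dips accumulate at `u` from the right, and then the rounds can be
completed within an arbitrarily short time after `u`. -/
theorem exists_roundEnd_lt_top (hsR : ∀ n, s n ≤ R n)
    (H : ∀ t : Time T, ∀ᶠ n in atTop, s n ≤ t → R n < t) (hfin : ∃ᶠ n in atTop, s n < ⊤) (N₀ : ℕ) :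
    ∃ N, N₀ ≤ N ∧ ∀ k, ∀ᶠ m in atTop, roundEnd s R (Finset.Icc N m) k < ⊤ := by
  obtain ⟨u, hu⟩ : ∃ u : Time T, u = sInf {t : Time T | ∃ᶠ n in atTop, s n ≤ t} := ⟨_, rfl⟩
  have hlow : ∀ v : WithTop (Time T), v < u → ∀ᶠ n in atTop, v < s n := fun v hv => by
    obtain ⟨t, rfl⟩ := WithTop.ne_top_iff_exists.1 (hv.trans (WithTop.coe_lt_top u)).ne
    have htu : t < u := by exact_mod_cast hv
    have h1 : ¬ ∃ᶠ n in atTop, s n ≤ t := fun h => absurd htu (not_lt.2 (hu ▸ sInf_le h))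
    rw [not_frequently] at h1
    exact h1.mono fun n hn => not_le.1 hn
  have hhigh : ∀ t : Time T, u < t → ∃ᶠ n in atTop, s n ≤ t := fun t ht => by
    have hne : {t : Time T | ∃ᶠ n in atTop, s n ≤ t}.Nonempty := by
      refine ⟨⊤, hfin.mono fun n hn => ?_⟩
      obtain ⟨r, hr⟩ := WithTop.ne_top_iff_exists.1 hn.ne
      rw [← hr]
      exact_mod_cast le_top
    obtain ⟨t', ht', hlt⟩ := exists_lt_of_csInf_lt hne (hu ▸ ht)
    exact Frequently.mono ht' fun n hn => hn.trans (by exact_mod_cast hlt.le)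
  by_cases hcase : ∃ᶠ n in atTop, s n ≤ u
  · obtain ⟨N₁, hN₁⟩ := eventually_atTop.1 (H u)
    have hbot : (⊥ : WithTop (Time T)) < u := by
      obtain ⟨n, hn1, hn2⟩ := (hcase.and_eventually (H u)).exists
      exact bot_le.trans_lt (hn2 hn1)
    refine ⟨max N₀ N₁, le_max_left _ _, fun k => ?_⟩
    suffices h : ∃ v < (u : WithTop (Time T)), ∀ᶠ m in atTop,
        roundEnd s R (Finset.Icc (max N₀ N₁) m) k ≤ v by
      obtain ⟨v, hv, h⟩ := h
      exact h.mono fun m hm => (hm.trans_lt hv).trans (WithTop.coe_lt_top u)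
    induction k with
    | zero => exact ⟨⊥, hbot, Eventually.of_forall fun m => le_rfl⟩
    | succ k ih =>
      obtain ⟨v, hv, hm⟩ := ih
      obtain ⟨n, ⟨hn1, hn2⟩, hn3⟩ := ((hcase.and_eventually (hlow v hv)).and_eventually
        (eventually_ge_atTop (max N₀ N₁))).exists
      have hsn : s n < u := (hsR n).trans_lt (hN₁ n ((le_max_right _ _).trans hn3) hn1)
      obtain ⟨M, hM⟩ := eventually_atTop.1 (hlow _ hsn)
      -- only indices below `M` can be responsible for the next dip, and these have recovered
      refine ⟨(Finset.Icc (max N₀ N₁) M).sup fun k => if s k ≤ u then R k else ⊥,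
        (Finset.sup_lt_iff hbot).2 fun k hk => ?_, ?_⟩
      · split_ifs with h
        · exact hN₁ k ((le_max_right _ _).trans (Finset.mem_Icc.1 hk).1) h
        · exact hbot
      · filter_upwards [hm, eventually_ge_atTop n] with m hm hnm
        have hdip : nextDip s (Finset.Icc (max N₀ N₁) m)
            (roundEnd s R (Finset.Icc (max N₀ N₁) m) k) ≤ s n :=
          nextDip_le (Finset.mem_Icc.2 ⟨hn3, hnm⟩) (hm.trans hn2.le)
        obtain ⟨q, hq, hfirst⟩ := exists_isFirst
          ((hdip.trans_lt hsn).trans (WithTop.coe_lt_top u))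
        rw [roundEnd, nextRecovery_eq hq hfirst]
        have hsq : s q ≤ s n := hfirst.1 ▸ hdip
        have hqM : q ≤ M := not_lt.1 fun h => absurd (hM q h.le) (not_lt.2 hsq)
        refine le_trans ?_ (Finset.le_sup (Finset.mem_Icc.2 ⟨(Finset.mem_Icc.1 hq).1, hqM⟩))
        rw [if_pos (hsq.trans hn1)]
  · rw [not_frequently] at hcase
    obtain ⟨N₁, hN₁⟩ := eventually_atTop.1 hcase
    refine ⟨max N₀ N₁, le_max_left _ _, fun k => ?_⟩
    have hut : u < ⊤ := by
      refine lt_of_le_of_ne le_top fun h => ?_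
      obtain ⟨n, hn1, hn2⟩ := (hfin.and_eventually hcase).exists
      refine hn2 ?_
      obtain ⟨r, hr⟩ := WithTop.ne_top_iff_exists.1 hn1.ne
      rw [h, ← hr]
      exact_mod_cast le_top
    suffices h : ∀ t : Time T, u < t → ∀ᶠ m in atTop,
        roundEnd s R (Finset.Icc (max N₀ N₁) m) k < t from
      (h ⊤ hut).mono fun m hm => hm.trans (WithTop.coe_lt_top _)
    induction k with
    | zero =>
      refine fun t ht => Eventually.of_forall fun m => ?_
      change ((⊥ : Time T) : WithTop (Time T)) < t
      exact_mod_cast bot_le.trans_lt ht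
    | succ k ih =>
      intro t ht
      obtain ⟨M, hM⟩ := eventually_atTop.1 (H t)
      have h1 : (u : WithTop (Time T)) < min (t : WithTop (Time T))
          ((Finset.Icc (max N₀ N₁) M).inf s) := by
        refine lt_min (by exact_mod_cast ht) ((Finset.lt_inf_iff (WithTop.coe_lt_top u)).2 ?_)
        exact fun q hq => not_le.1 (hN₁ q ((le_max_right _ _).trans (Finset.mem_Icc.1 hq).1))
      obtain ⟨x, hx⟩ := WithTop.ne_top_iff_exists.1
        ((min_le_left _ _).trans_lt (WithTop.coe_lt_top t) :
          min (t : WithTop (Time T)) ((Finset.Icc (max N₀ N₁) M).inf s) < ⊤).ne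
      rw [← hx] at h1
      obtain ⟨w, huw, hwx⟩ := exists_between (show u < x by exact_mod_cast h1)
      have hwx' : (w : WithTop (Time T)) <
          min (t : WithTop (Time T)) ((Finset.Icc (max N₀ N₁) M).inf s) := by
        rw [← hx]; exact_mod_cast hwx
      obtain ⟨n, hn1, hn2⟩ := ((hhigh w huw).and_eventually
        (eventually_ge_atTop (max N₀ N₁))).exists
      obtain ⟨y, hy⟩ := WithTop.ne_top_iff_exists.1 (hn1.trans_lt (WithTop.coe_lt_top w)).ne
      have huy : u < y := by
        have := not_le.1 (hN₁ n ((le_max_right _ _).trans hn2))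
        rw [← hy] at this
        exact_mod_cast this
      filter_upwards [ih y huy, eventually_ge_atTop n] with m hm hnm
      have hdip : nextDip s (Finset.Icc (max N₀ N₁) m)
          (roundEnd s R (Finset.Icc (max N₀ N₁) m) k) ≤ s n :=
        nextDip_le (Finset.mem_Icc.2 ⟨hn2, hnm⟩) (hy ▸ hm.le)
      obtain ⟨q, hq, hfirst⟩ := exists_isFirst
        (hdip.trans_lt (hn1.trans_lt (WithTop.coe_lt_top w)))
      rw [roundEnd, nextRecovery_eq hq hfirst]
      have hsq : s q < min (t : WithTop (Time T)) ((Finset.Icc (max N₀ N₁) M).inf s) :=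
        (hfirst.1.le.trans (hdip.trans hn1)).trans_lt hwx'
      have hqM : M ≤ q := by
        by_contra hlt
        refine absurd (hsq.trans_le (min_le_right _ _)) (not_lt.2 (Finset.inf_le ?_))
        exact Finset.mem_Icc.2 ⟨(Finset.mem_Icc.1 hq).1, (not_le.1 hlt).le⟩
      exact hM q hqM (hsq.trans_le (min_le_left _ _)).le

end Rounds

/-! ### Compounding the recoveries -/

section Gain

variable (s R : ℕ → WithTop (Time T)) (I : Finset ℕ) (a : ℝ) (h : ℕ → Time T → ℝ)

open Classical in
/-- The number of units of `h n` that are held during a round which starts at the dip `D`, if the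
whole capital `x` is invested in the process `a + h n` of the first dip. -/
def roundStake (D : WithTop (Time T)) (x : ℝ) (n : ℕ) : ℝ :=
  if IsFirst s I D n then x / (a + h n (cap D ⊤)) else 0

/-- The gain after `k` rounds that start with the capital `1`. In each round, the whole capital is
invested in the process `a + h n` of the first dip until its recovery. -/
def roundGain : ℕ → Time T → ℝ
  | 0 => fun _ => 0
  | k + 1 => fun t => roundGain k t + ∑ n ∈ I,
      roundStake s I a h (nextDip s I (roundEnd s R I k))
        (1 + roundGain k (cap (nextDip s I (roundEnd s R I k)) ⊤)) n *
      (h n (cap (roundEnd s R I (k + 1)) t) - h n (cap (nextDip s I (roundEnd s R I k)) t))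

variable {s R I a h} {k : ℕ} {c : ℝ}

theorem nextDip_le_roundEnd (hsR : ∀ n, s n ≤ R n) (k : ℕ) :
    nextDip s I (roundEnd s R I k) ≤ roundEnd s R I (k + 1) := nextDip_le_nextRecovery hsR

theorem roundGain_frozen (hsR : ∀ n, s n ≤ R n) {u t : Time T} (hu : roundEnd s R I k ≤ u)
    (hut : u ≤ t) : roundGain s R I a h k t = roundGain s R I a h k u := by
  induction k with
  | zero => rfl
  | succ k ih =>
    simp only [roundGain]
    rw [ih ((roundEnd_mono hsR k.le_succ).trans hu), cap_eq_cap hu hut,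
      cap_eq_cap ((nextDip_le_roundEnd hsR k).trans hu) hut]

theorem roundGain_succ_of_le (hsR : ∀ n, s n ≤ R n) {t : Time T}
    (ht : t ≤ nextDip s I (roundEnd s R I k)) :
    roundGain s R I a h (k + 1) t = roundGain s R I a h k t := by
  simp only [roundGain]
  rw [cap_eq_right ht, cap_eq_right (ht.trans (nextDip_le_roundEnd hsR k))]
  simp

/-- In each round the capital is multiplied by the growth of the process in which it is
invested. -/
theorem roundGain_succ (hsR : ∀ n, s n ≤ R n) (ha : ∀ n t, 1 ≤ a + h n t) {t : Time T}
    (ht : nextDip s I (roundEnd s R I k) ≤ t) : ∃ n ∈ I, s n < ⊤ ∧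
      roundEnd s R I (k + 1) = R n ∧
      1 + roundGain s R I a h (k + 1) t =
        (1 + roundGain s R I a h k (cap (nextDip s I (roundEnd s R I k)) ⊤)) *
          ((a + h n (cap (R n) t)) / (a + h n (cap (s n) t))) := by
  have htop := ht.trans_lt (WithTop.coe_lt_top t)
  obtain ⟨n, hn, hfirst⟩ := exists_isFirst htop
  have hend : roundEnd s R I (k + 1) = R n := nextRecovery_eq hn hfirst
  refine ⟨n, hn, hfirst.1 ▸ htop, hend, ?_⟩
  have hcap := cap_eq_cap ht (le_top : t ≤ ⊤)
  have hle : cap (nextDip s I (roundEnd s R I k)) t ≤ t := cap_le _ _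
  have hlow : roundEnd s R I k ≤ (cap (nextDip s I (roundEnd s R I k)) t : Time T) := by
    rw [coe_cap_eq_left ht]; exact le_nextDip
  simp only [roundGain]
  rw [Finset.sum_eq_single n, roundStake, if_pos hfirst, hend, roundGain_frozen hsR hlow hle,
    hfirst.1]
  · rw [← hcap]
    have := ha n (cap (nextDip s I (roundEnd s R I k)) t)
    field_simp
    ring
  · intro q hq hqn
    rw [roundStake, if_neg fun hq' => hqn (hq'.unique hfirst hq hn), zero_mul]
  · exact fun h' => absurd hn h'

theorem roundGain_bounds (hsR : ∀ n, s n ≤ R n) (ha : ∀ n t, 1 ≤ a + h n t) (hc0 : 0 ≤ c)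
    (hc : ∀ n t, h n (cap (R n) t) - h n (cap (s n) t) ≤ c) (k : ℕ) (t : Time T) :
    0 ≤ 1 + roundGain s R I a h k t ∧ 1 + roundGain s R I a h k t ≤ (1 + c) ^ k := by
  induction k generalizing t with
  | zero => simp [roundGain]
  | succ k ih =>
    rcases le_total (t : WithTop (Time T)) (nextDip s I (roundEnd s R I k)) with ht | ht
    · rw [roundGain_succ_of_le hsR ht]
      exact ⟨(ih t).1, (ih t).2.trans (pow_le_pow_right₀ (by linarith) k.le_succ)⟩
    · obtain ⟨n, hn, -, -, heq⟩ := roundGain_succ (k := k) hsR ha ht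
      have h1 := ha n (cap (R n) t)
      have h2 := ha n (cap (s n) t)
      have h3 := hc n t
      have h4 : (a + h n (cap (R n) t)) / (a + h n (cap (s n) t)) ≤ 1 + c := by
        rw [div_le_iff₀ (by linarith)]
        nlinarith
      obtain ⟨h5, h6⟩ := ih (cap (nextDip s I (roundEnd s R I k)) ⊤)
      rw [heq]
      have h7 : 0 ≤ (a + h n (cap (R n) t)) / (a + h n (cap (s n) t)) :=
        div_nonneg (by linarith) (by linarith)
      exact ⟨mul_nonneg h5 h7, by rw [pow_succ]; exact mul_le_mul h6 h4 h7 (by positivity)⟩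

/-- Each completed round multiplies the capital by at least `1 + c / B`, if all recoveries are
complete and the processes `a + h n` start at most at `B`. -/
theorem pow_le_roundGain (hsR : ∀ n, s n ≤ R n) (ha : ∀ n t, 1 ≤ a + h n t) {B : ℝ} (hc0 : 0 ≤ c)
    (hB : ∀ n ∈ I, s n < ⊤ → a + h n (cap (s n) ⊤) ≤ B)
    (hc : ∀ n ∈ I, R n < ⊤ → c ≤ h n (cap (R n) ⊤) - h n (cap (s n) ⊤)) {k : ℕ} {t : Time T}
    (ht : roundEnd s R I k ≤ t) : (1 + c / B) ^ k ≤ 1 + roundGain s R I a h k t := by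
  induction k generalizing t with
  | zero => simp [roundGain]
  | succ k ih =>
    have hD := (nextDip_le_roundEnd hsR k).trans ht
    obtain ⟨n, hn, hs, hend, heq⟩ := roundGain_succ (k := k) hsR ha hD
    rw [hend] at ht
    have h1 : cap (R n) t = cap (R n) ⊤ := cap_eq_cap ht le_top
    have h2 : cap (s n) t = cap (s n) ⊤ := cap_eq_cap ((hsR n).trans ht) le_top
    have h3 := hB n hn hs
    have h4 := hc n hn (ht.trans_lt (WithTop.coe_lt_top t))
    have h5 := ha n (cap (s n) ⊤)
    have h6 := ih (t := cap (nextDip s I (roundEnd s R I k)) ⊤) (by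
      rw [coe_cap_eq_left (hD.trans (by exact_mod_cast le_top))]; exact le_nextDip)
    have h7 : 0 ≤ c / B := div_nonneg hc0 (by linarith)
    rw [heq, pow_succ, h1, h2]
    refine mul_le_mul h6 ?_ (by linarith) ((pow_nonneg (by linarith) k).trans h6)
    rw [le_div_iff₀ (by linarith), add_mul, one_mul]
    have h8 : c / B * (a + h n (cap (s n) ⊤)) ≤ c := by
      rw [div_mul_eq_mul_div, div_le_iff₀ (by linarith)]
      exact mul_le_mul_of_nonneg_left h3 hc0
    linarith

theorem roundGain_eq_of_le (hsR : ∀ n, s n ≤ R n) {K : ℕ} {t : Time T}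
    (ht : t ≤ roundEnd s R I K) (hK : K ≤ k) :
    roundGain s R I a h k t = roundGain s R I a h K t := by
  induction k, hK using Nat.le_induction with
  | base => rfl
  | succ k hk ih =>
    rw [roundGain_succ_of_le hsR (ht.trans ((roundEnd_mono hsR hk).trans le_nextDip)), ih]

end Gain

section Strategy

variable {σ R : ℕ → PricePath d T → WithTop (Time T)} {H : ℕ → Time T → PricePath d T → ℝ}
  {I : Finset ℕ} {a c : ℝ}

theorem isRandomTime_nextDip (hσ : ∀ n, IsRandomTime (σ n)) {r : PricePath d T → WithTop (Time T)}
    (hr : IsRandomTime r) : IsRandomTime fun ω => nextDip (σ · ω) I (r ω) := by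
  classical
  refine IsRandomTime.finset_inf I (f := fun n ω => if r ω ≤ σ n ω then σ n ω else ⊤) fun n _ => ?_
  exact (hσ n).ite (IsRandomTime.const ⊤) (KnownAt.le_le hr (hσ n)) (fun _ _ => le_rfl)
    fun _ _ => le_top

theorem knownAt_isFirst (hσ : ∀ n, IsRandomTime (σ n)) {D : PricePath d T → WithTop (Time T)}
    (hD : IsRandomTime D) (n : ℕ) : KnownAt D fun ω => IsFirst (σ · ω) I (D ω) n := by
  have h1 : ∀ k, KnownAt D fun ω => σ k ω = D ω := fun k => by
    refine ⟨measurableSet_setOfPred.1 (measurableSet_eq_fun (hσ k).measurable hD.measurable),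
      fun ω ω' h => ?_⟩
    rw [hD.nonant ω ω' h, eq_iff_iff]
    exact ⟨fun h' => ((hσ k).nonant ω' ω (h' ▸ h.symm)).trans h',
      fun h' => ((hσ k).nonant ω ω' (h' ▸ h)).trans h'⟩
  refine ⟨measurableSet_setOfPred.1 ?_, fun ω ω' h => ?_⟩
  · have : {ω | IsFirst (σ · ω) I (D ω) n} = {ω | σ n ω = D ω} ∩
        ⋂ k ∈ I, {ω | k < n → σ k ω ≠ D ω} := by
      ext ω
      simp [IsFirst]
    rw [this]
    refine (measurableSet_setOfPred.2 (h1 n).measurable).inter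
      (Finset.measurableSet_biInter I fun k _ => ?_)
    by_cases hk : k < n
    · simp only [hk, forall_true_left]
      exact (measurableSet_setOfPred.2 (h1 k).measurable).compl
    · simp [hk]
  · have h2 : ∀ k, (σ k ω' = D ω') = (σ k ω = D ω) := fun k => (h1 k).nonant ω ω' h
    simp only [IsFirst, ne_eq, h2]

theorem isRandomTime_nextRecovery (hσ : ∀ n, IsRandomTime (σ n)) (hR : ∀ n, IsRandomTime (R n))
    (hσR : ∀ n ω, σ n ω ≤ R n ω) {r : PricePath d T → WithTop (Time T)} (hr : IsRandomTime r) :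
    IsRandomTime fun ω => nextRecovery (σ · ω) (R · ω) I (r ω) := by
  classical
  refine IsRandomTime.finset_inf I (f := fun n ω =>
    if IsFirst (σ · ω) I (nextDip (σ · ω) I (r ω)) n then R n ω else ⊤) fun n _ => ?_
  exact (hR n).ite (IsRandomTime.const ⊤)
    (knownAt_isFirst hσ (isRandomTime_nextDip hσ hr) n) (fun ω h => h.1 ▸ hσR n ω)
    fun _ _ => le_top

theorem isRandomTime_roundEnd (hσ : ∀ n, IsRandomTime (σ n)) (hR : ∀ n, IsRandomTime (R n))
    (hσR : ∀ n ω, σ n ω ≤ R n ω) (k : ℕ) :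
    IsRandomTime fun ω => roundEnd (σ · ω) (R · ω) I k := by
  induction k with
  | zero => exact IsRandomTime.const _
  | succ k ih => exact isRandomTime_nextRecovery hσ hR hσR ih

theorem isIntegral_roundGain (hσ : ∀ n, IsRandomTime (σ n)) (hR : ∀ n, IsRandomTime (R n))
    (hσR : ∀ n ω, σ n ω ≤ R n ω) (hH : ∀ n, IsIntegral (H n)) (ha : ∀ n t ω, 1 ≤ a + H n t ω)
    (hc0 : 0 ≤ c) (hc : ∀ n t ω, H n (cap (R n ω) t) ω - H n (cap (σ n ω) t) ω ≤ c) (k : ℕ) :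
    IsIntegral fun t ω => roundGain (σ · ω) (R · ω) I a (fun n t => H n t ω) k t := by
  classical
  induction k with
  | zero => exact IsIntegral.zero
  | succ k ih =>
    have hD := isRandomTime_nextDip (I := I) hσ (isRandomTime_roundEnd (I := I) hσ hR hσR k)
    refine ih.add (IsIntegral.sum I fun n _ => (hH n).startStop hD
      (isRandomTime_roundEnd (I := I) hσ hR hσR (k + 1))
      (fun ω => nextDip_le_roundEnd (fun n => hσR n ω) k) ?_ ?_)
    · refine KnownAt.ite (knownAt_isFirst hσ hD n) ?_ (KnownAt.const 0)
      exact KnownAt.comp₂ (u := fun x y => (1 + x) / (a + y)) (ih.isContAdapted.knownAt hD)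
        ((hH n).isContAdapted.knownAt hD) (by unfold Function.uncurry; fun_prop)
    · refine ⟨(1 + c) ^ k, fun ω => ?_⟩
      obtain ⟨h1, h2⟩ := roundGain_bounds (I := I) (h := fun n t => H n t ω) (fun n => hσR n ω)
        (fun n t => ha n t ω) hc0 (fun n t => hc n t ω) k
        (cap (nextDip (σ · ω) I (roundEnd (σ · ω) (R · ω) I k)) ⊤)
      rw [roundStake]
      split_ifs with hf
      · have h3 := ha n (cap (nextDip (σ · ω) I (roundEnd (σ · ω) (R · ω) I k)) ⊤) ω
        rw [abs_of_nonneg (div_nonneg h1 (by linarith))]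
        exact (div_le_self h1 h3).trans h2
      · rw [abs_zero]; exact h1.trans h2

/-- Suppose that the bounded increment `c` of the wealth `a + H n` from the dip `σ n` to the
recovery `R n` is attained for all dips that happen before a given time, with finitely many
exceptions. Then, outside a null set, there are only finitely many dips: otherwise capital could be
multiplied arbitrarily often by a factor bounded away from `1`. -/
theorem vovkMeasure_frequently_dip (hσ : ∀ n, IsRandomTime (σ n)) (hR : ∀ n, IsRandomTime (R n))
    (hσR : ∀ n ω, σ n ω ≤ R n ω) (hH : ∀ n, IsIntegral (H n)) (ha : ∀ n t ω, 1 ≤ a + H n t ω)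
    (hc0 : 0 < c) (hc : ∀ n t ω, H n (cap (R n ω) t) ω - H n (cap (σ n ω) t) ω ≤ c)
    (hc' : ∀ n ω, R n ω < ⊤ → c ≤ H n (cap (R n ω) ⊤) ω - H n (cap (σ n ω) ⊤) ω) :
    vovkMeasure {ω | (∀ t : Time T, ∀ᶠ n in atTop, σ n ω ≤ t → R n ω < t) ∧
      (∃ B : ℝ, ∀ᶠ n in atTop, σ n ω < ⊤ → a + H n (cap (σ n ω) ⊤) ω ≤ B) ∧
      ∃ᶠ n in atTop, σ n ω < ⊤} = 0 := by
  refine vovkMeasure_eq_zero_of_hit fun ε hε => ?_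
  -- the index from which the exceptions are over depends on the path, hence the capital is divided
  -- among all windows of indices `[N, m]`
  have hlow : ∀ N m k t ω, -1 ≤ roundGain (σ · ω) (R · ω) (Finset.Icc N m) a
      (fun n t => H n t ω) k t := fun N m k t ω => by
    have := (roundGain_bounds (I := Finset.Icc N m) (h := fun n t => H n t ω) (fun n => hσR n ω)
      (fun n t => ha n t ω) hc0.le (fun n t => hc n t ω) k t).1
    linarith
  have hterm : ∀ m N t ω, 0 ≤ ε / 2 ^ (N + 1) * (1 + roundGain (σ · ω) (R · ω) (Finset.Icc N m) a
      (fun n t => H n t ω) m t) := fun m N t ω =>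
    mul_nonneg (by positivity) (by linarith [hlow N m m t ω])
  have hV : ∀ m t ω, -ε + ∑ N ∈ Finset.range m, ε / 2 ^ (N + 1) *
      (1 + roundGain (σ · ω) (R · ω) (Finset.Icc N m) a (fun n t => H n t ω) m t) ≤
      ∑ N ∈ Finset.range m, ε / 2 ^ (N + 1) *
        roundGain (σ · ω) (R · ω) (Finset.Icc N m) a (fun n t => H n t ω) m t := fun m t ω => by
    simp only [mul_add, mul_one, Finset.sum_add_distrib]
    linarith [sum_div_two_pow_le hε.le m]
  refine ⟨fun m t ω => ∑ N ∈ Finset.range m, ε / 2 ^ (N + 1) *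
      roundGain (σ · ω) (R · ω) (Finset.Icc N m) a (fun n t => H n t ω) m t,
    fun m => IsIntegral.sum _ fun N _ =>
      (isIntegral_roundGain hσ hR hσR hH ha hc0.le hc m).const_mul _,
    fun m t ω => le_trans ?_ (hV m t ω), ?_⟩
  · linarith [Finset.sum_nonneg fun N (_ : N ∈ Finset.range m) => hterm m N t ω]
  · rintro ω ⟨hrec, ⟨B, hB⟩, hfreq⟩
    obtain ⟨N₀, hN₀⟩ := eventually_atTop.1 hB
    obtain ⟨N, hN, hrounds⟩ := exists_roundEnd_lt_top (fun n => hσR n ω) hrec hfreq N₀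
    have hB1 : 0 < c / max B 1 := by positivity
    obtain ⟨K, hK⟩ := pow_unbounded_of_one_lt ((ε / 2 ^ (N + 1))⁻¹) (lt_add_of_pos_right 1 hB1)
    filter_upwards [hrounds K, eventually_ge_atTop K, eventually_gt_atTop N] with m hm hKm hNm
    obtain ⟨t, ht⟩ := WithTop.ne_top_iff_exists.1 hm.ne
    refine ⟨t, ?_⟩
    have h1 := pow_le_roundGain (I := Finset.Icc N m) (h := fun n t => H n t ω) (B := max B 1)
      (fun n => hσR n ω) (fun n t => ha n t ω) hc0.le
      (fun n hn hs => (hN₀ n (hN.trans (Finset.mem_Icc.1 hn).1) hs).trans (le_max_left _ _))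
      (fun n _ => hc' n ω) ht.ge
    rw [← roundGain_eq_of_le (fun n => hσR n ω) ht.le hKm] at h1
    have h2 := Finset.single_le_sum (fun N _ => hterm m N t ω) (Finset.mem_range.2 hNm)
    have h3 := hV m t ω
    have h4 := mul_le_mul_of_nonneg_left (hK.le.trans h1)
      (by positivity : 0 ≤ ε / 2 ^ (N + 1))
    rw [mul_inv_cancel₀ (by positivity)] at h4
    linarith

end Strategy

/-! ### The inequality for the outer expectations -/

/-- For typical paths `6 √[(G · S)] + 2 bdgProc n` dominates the running maximum of the integral
process in the limit, and `bdgProc n` is bounded from below at all earlier times as well. -/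
theorem IsTypical.eventually_le {G : SimpleStrategy d T} {ω : PricePath d T}
    (h : IsTypical G.grid ω) (t : Time T) {η : ℝ} (hη : 0 < η) : ∀ᶠ n in atTop, ∀ s ≤ t,
      |G.integral s ω| ≤ 6 * √(G.quadVar t ω) + η + 2 * G.bdgProc n t ω ∧
        0 ≤ 6 * √(G.quadVar t ω) + η + 2 * G.bdgProc n s ω := by
  obtain ⟨C, hC0, hC⟩ := G.exists_oscillation ω
  have h1 : Tendsto (fun n : ℕ => 6 * √(G.sqSum n t ω) + 7 * (C * (1 / 2 : ℝ) ^ n)) atTop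
      (𝓝 (6 * √(G.quadVar t ω) + 7 * (C * 0))) :=
    (((Real.continuous_sqrt.tendsto _).comp (h.tendsto_sqSum t)).const_mul 6).add
      (((tendsto_pow_atTop_nhds_zero_of_lt_one (by norm_num) (by norm_num)).const_mul C).const_mul
        7)
  filter_upwards [h1.eventually_lt_const
    (show _ < 6 * √(G.quadVar t ω) + η by linarith)] with n hn s hs
  have h2 : 0 ≤ C * (1 / 2 : ℝ) ^ n := by positivity
  have h3 := G.abs_integral_le hC n hs
  have h4 := (abs_nonneg _).trans (G.abs_integral_le hC n (le_refl s))
  have h5 : √(G.sqSum n s ω) ≤ √(G.sqSum n t ω) + C * (1 / 2) ^ n := by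
    refine Real.sqrt_le_iff.2 ⟨by positivity, (G.sqSum_le hC n hs).trans ?_⟩
    have := mul_nonneg (Real.sqrt_nonneg (G.sqSum n t ω)) h2
    rw [add_sq, Real.sq_sqrt (G.sqSum_nonneg n t ω)]
    linarith
  exact ⟨by linarith, by linarith⟩

/-- Strategies for the running maximum. Along a typical path, `6 H n + 2 bdgProc n` superhedges
`|G · S|` up to time `t` if `lam + H n` is at least the square root of the sum of squares along the
grid. As `lam + H n` dominates this root only in the limit, separately for each time, the sum has
to be stopped when it reaches the level `-(6 lam + ε)`. If this happens at a time `s`, then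
`lam + H n` lies below the root by `ε / 6`, and has to increase by `ε / 12` soon afterwards. Betting
on these increases shows that only finitely many of the processes have to be stopped. -/
theorem SimpleStrategy.exists_superhedge (G : SimpleStrategy d T) {A : Set (PricePath d T)}
    (hA : vovkMeasure Aᶜ = 0) {lam ε : ℝ} (hlam : 0 < lam) (hε : 0 < ε)
    {H : ℕ → Time T → PricePath d T → ℝ} (hH : ∀ n, IsIntegral (H n))
    (hadm : ∀ n t ω, -lam ≤ H n t ω)
    (hlim : ∀ ω ∈ A, ∀ t, ∀ b < √(G.quadVar t ω), ∀ᶠ n in atTop, b < lam + H n t ω) :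
    ∃ (A' : Set (PricePath d T)) (K : ℕ → Time T → PricePath d T → ℝ), vovkMeasure A'ᶜ = 0 ∧
      (∀ n, IsIntegral (K n)) ∧ (∀ n t ω, -(6 * lam + ε) ≤ K n t ω) ∧
      ∀ ω ∈ A', ∀ s t, s ≤ t → ∀ b < |G.integral s ω|, ∀ᶠ n in atTop,
        b < 6 * lam + ε + K n t ω := by
  obtain ⟨X, hX⟩ : ∃ X : ℕ → Time T → PricePath d T → ℝ,
      ∀ n, X n = fun t ω => (-6) * H n t ω + (-2) * G.bdgProc n t ω := ⟨_, fun _ => rfl⟩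
  have hXint : ∀ n, IsIntegral (X n) := fun n => by
    rw [hX]; exact ((hH n).const_mul _).add ((G.isIntegral_bdgProc n).const_mul _)
  have hXcont := fun n ω => (hXint n).isContAdapted.cont ω
  have hX0 : ∀ n ω, X n ⊥ ω ≤ 6 * lam + ε := fun n ω => by rw [(hXint n).bot]; positivity
  obtain ⟨σ, hσdef⟩ : ∃ σ : ℕ → PricePath d T → WithTop (Time T),
      ∀ n, σ n = hit (X n) (6 * lam + ε) := ⟨_, fun _ => rfl⟩
  have hσ : ∀ n, IsRandomTime (σ n) := fun n => by
    rw [hσdef]; exact isRandomTime_hit (hXint n).isContAdapted _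
  obtain ⟨Y, hY⟩ : ∃ Y : ℕ → Time T → PricePath d T → ℝ,
      ∀ n t ω, Y n t ω = H n t ω - H n (cap (σ n ω) t) ω := ⟨_, fun _ _ _ => rfl⟩
  have hYint : ∀ n, IsContAdapted (Y n) := fun n => by
    have : Y n = fun t ω => H n t ω - H n (cap (σ n ω) t) ω := funext fun t => funext (hY n t)
    rw [this]
    exact (hH n).isContAdapted.sub ((hH n).isContAdapted.stopped (hσ n))
  have hY0 : ∀ n ω, Y n ⊥ ω ≤ ε / 12 := fun n ω => by
    rw [hY, show cap (σ n ω) ⊥ = ⊥ from le_antisymm (cap_le _ _) bot_le, sub_self]; positivity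
  obtain ⟨R, hRdef⟩ : ∃ R : ℕ → PricePath d T → WithTop (Time T),
      ∀ n, R n = hit (Y n) (ε / 12) := ⟨_, fun _ => rfl⟩
  have hR : ∀ n, IsRandomTime (R n) := fun n => by
    rw [hRdef]; exact isRandomTime_hit (hYint n) _
  have hRY : ∀ {n ω r}, R n ω = (r : Time T) → Y n r ω = ε / 12 := fun {n ω r} h =>
    eq_of_hit_eq ((hYint n).cont ω) (hY0 n ω) (hRdef n ▸ h)
  have hσR : ∀ n ω, σ n ω ≤ R n ω := fun n ω => by
    by_contra hlt
    rw [not_le] at hlt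
    obtain ⟨r, hr⟩ := WithTop.ne_top_iff_exists.1 (hlt.trans_le le_top).ne
    have h1 := hRY hr.symm
    rw [hY, cap_eq_right (hr ▸ hlt.le), sub_self] at h1
    linarith
  have hnull := vovkMeasure_frequently_dip (a := lam + 1) (c := ε / 12) hσ hR hσR hH
    (fun n t ω => by linarith [hadm n t ω]) (by positivity)
    (fun n t ω => by
      have h1 := le_of_le_hit (c := ε / 12) ((hYint n).cont ω) (hY0 n ω) (r := cap (R n ω) t)
        (by rw [coe_cap, ← hRdef]; exact min_le_left _ _)
      rwa [hY, cap_cap, min_eq_left (hσR n ω)] at h1)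
    (fun n ω hlt => by
      obtain ⟨r, hr⟩ := WithTop.ne_top_iff_exists.1 hlt.ne
      have h1 := hRY hr.symm
      have h2 : cap (R n ω) ⊤ = r := by rw [← hr, cap_coe, min_eq_left le_top]
      rw [hY, cap_eq_cap (hr ▸ hσR n ω) le_top] at h1
      rw [h2, h1])
  have htyp := vovkMeasure_not_isTypical G.isRandomPartition_grid G.isFine_grid
  -- as `bdgProc n` is not much below `-3 √[(G · S)]`, the wealth `lam + H n` is well below
  -- `√[(G · S)]` when the sum reaches its lower bound
  have hdip : ∀ ω ∈ A, IsTypical G.grid ω → ∀ t, ∀ᶠ n in atTop, ∀ s ≤ t, σ n ω = (s : Time T) →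
      lam + H n s ω ≤ √(G.quadVar t ω) - ε / 8 := fun ω hωA hωt t => by
    filter_upwards [hωt.eventually_le t (show 0 < ε / 4 by positivity)] with n hn s hst hs
    have h1 := eq_of_hit_eq (hXcont n ω) (hX0 n ω) (hσdef n ▸ hs)
    have h2 := (hn s hst).2
    rw [hX] at h1
    linarith
  refine ⟨A ∩ {ω | IsTypical G.grid ω} ∩ {ω | ¬ ∃ᶠ n in atTop, σ n ω < ⊤},
    fun n t ω => (-1) * X n (cap (σ n ω) t) ω, ?_,
    fun n => ((hXint n).stopped (hσ n)).const_mul _, fun n t ω => ?_, ?_⟩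
  · refine vovkMeasure_mono_null ?_ (vovkMeasure_union_null (vovkMeasure_union_null hA htyp) hnull)
    intro ω hω
    by_contra hω'
    simp only [Set.mem_union, not_or, Set.mem_compl_iff, not_not] at hω'
    obtain ⟨⟨hωA, hωt⟩, hωn⟩ := hω'
    have hωt : IsTypical G.grid ω := not_not.1 hωt
    refine hω ⟨⟨hωA, hωt⟩, fun hfreq => hωn ⟨fun t => ?_, ?_, hfreq⟩⟩
    · filter_upwards [hdip ω hωA hωt t, hlim ω hωA t (√(G.quadVar t ω) - ε / 48) (by linarith)]
        with n hn1 hn2 hle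
      obtain ⟨s, hs⟩ := WithTop.ne_top_iff_exists.1 (hle.trans_lt (WithTop.coe_lt_top t)).ne
      have h1 := hn1 s (by rw [← hs] at hle; exact_mod_cast hle) hs.symm
      have h2 : ε / 12 < Y n t ω := by
        rw [hY, show cap (σ n ω) t = s by
          rw [← hs] at hle ⊢; exact min_eq_left (by exact_mod_cast hle)]
        linarith
      refine lt_of_le_of_ne (hRdef n ▸ hit_le h2.le) fun h3 => ?_
      linarith [hRY h3]
    · refine ⟨√(G.quadVar ⊤ ω) + 1, ?_⟩
      filter_upwards [hdip ω hωA hωt ⊤] with n hn hlt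
      obtain ⟨s, hs⟩ := WithTop.ne_top_iff_exists.1 hlt.ne
      have h1 := hn s le_top hs.symm
      rw [← hs, cap_coe, min_eq_left le_top]
      linarith
  · have h1 := le_of_le_hit (hXcont n ω) (hX0 n ω) (r := cap (σ n ω) t)
      (by rw [coe_cap, ← hσdef]; exact min_le_left _ _)
    linarith
  · rintro ω ⟨⟨hωA, hωt⟩, hfreq⟩ s t hst b hb
    filter_upwards [not_frequently.1 hfreq, hωt.eventually_le t (show 0 < ε / 4 by positivity),
      hlim ω hωA t (√(G.quadVar t ω) - ε / 48) (by linarith)] with n hn1 hn2 hn3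
    rw [not_lt_top_iff.1 hn1, cap_top, hX]
    have := (hn2 s hst).1
    linarith

theorem outerExp_runningMax_le (G : SimpleStrategy d T) :
    outerExp G.runningMax ≤ 6 * outerExp G.sqrtQuadVar := by
  have key : ∀ (A : Set (PricePath d T)) (_ : vovkMeasure Aᶜ = 0) (lam : ℝ) (_ : 0 < lam)
      (_ : ∃ H : ℕ → SimpleStrategy d T, (∀ n, (H n).Admissible lam) ∧
        ∀ ω ∈ A, ∀ τ : PricePath d T → Time T,
          IsStoppingTime (natFiltration d T) (fun ω' => (τ ω' : WithTop (Time T))) →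
          (G.sqrtQuadVar (τ ω) ω : EReal) ≤
            liminf (fun n => ((lam + (H n).integral (τ ω) ω : ℝ) : EReal)) atTop),
      outerExp G.runningMax ≤ 6 * ENNReal.ofReal lam := by
    rintro A hA lam hlam ⟨H, hadm, hlim⟩
    refine ENNReal.le_of_forall_pos_le_add fun ε hε _ => ?_
    obtain ⟨A', K, hA', hK, hKadm, hKlim⟩ := G.exists_superhedge hA hlam (ε := ε)
      (by exact_mod_cast hε) (H := fun n => (H n).integral) (fun n => (H n).isIntegral_integral)
      (fun n t ω => hadm n t ω) fun ω hω t => by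
        have h1 := hlim ω hω (fun _ => t) (isStoppingTime_iff.2 (IsRandomTime.const _))
        rw [SimpleStrategy.sqrtQuadVar, EReal.coe_ennreal_ofReal,
          max_eq_left (Real.sqrt_nonneg _)] at h1
        exact coe_le_liminf_iff.1 h1
    choose V hV using fun n => (hK n).exists_strategy
    have hpos : 0 < 6 * lam + ε := by positivity
    refine (iInf₂_le_of_le A' hA' (iInf₂_le_of_le (6 * lam + ε) hpos (iInf_le_of_le
      ⟨V, fun n t ω => by rw [hV]; exact hKadm n t ω, fun ω hω τ _ => ?_⟩ le_rfl))).trans ?_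
    · rw [ENNReal.ofReal_add (by positivity) (by positivity), ENNReal.ofReal_mul (by norm_num)]
      simp
    · obtain ⟨s, hs, hmax⟩ := (isClosed_Iic (a := τ ω)).isCompact.exists_isMaxOn
        ⟨τ ω, le_refl (τ ω)⟩
        (G.isIntegral_integral.isContAdapted.cont ω).abs.continuousOn
      have h1 : G.runningMax (τ ω) ω ≤ ENNReal.ofReal |G.integral s ω| :=
        iSup₂_le fun r hr => ENNReal.ofReal_le_ofReal (hmax hr)
      refine (EReal.coe_ennreal_le_coe_ennreal_iff.2 h1).trans ?_
      rw [EReal.coe_ennreal_ofReal, max_eq_left (abs_nonneg _)]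
      simp only [hV]
      exact coe_le_liminf_iff.2 (hKlim ω hω s (τ ω) hs)
  generalize outerExp G.runningMax = M at key ⊢
  simp only [outerExp, ENNReal.mul_iInf_of_ne (by norm_num : (6 : ℝ≥0∞) ≠ 0)
    (by norm_num : (6 : ℝ≥0∞) ≠ ∞), le_iInf_iff]
  exact key

end ModelFree

end

theorem theorem3p1 :
    ∃ c₁ : ℝ≥0, 0 < c₁ ∧ c₁ ≤ 6 ∧
      ∀ (d : ℕ) (T : ℝ) [Fact (0 ≤ T)], 1 ≤ d → 0 < T →
        ∀ G ∈ ModelFree.finiteQuadVarStrategies d T,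
          ModelFree.outerExp G.runningMax ≤ (c₁ : ℝ≥0∞) * ModelFree.outerExp G.sqrtQuadVar :=
  ⟨6, by norm_num, le_rfl, fun _ _ _ _ _ G _ => ModelFree.outerExp_runningMax_le G⟩
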